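/- Let $H$ be a separable real Hilbert space with inner product $\langle\cdot,\cdot\rangle$ and norm $|\cdot|$, let $A_0$ be a non-negative self-adjoint operator on $H$ with domain $D(A_0)$, and let $\gamma>0$. Put $A_1=(A_0^2+I)^{1/2}$; for $\alpha\ge 0$ let $D(A_0^\alpha)=D(A_1^\alpha)$ be normed by $|A_1^\alpha\,\cdot|$, and let $\mathscr H=D(A_0)\times H$ and $\mathscr H_\alpha=D(A_0^{1+\alpha})\times D(A_0^\alpha)$. Let $M=\{x\in H:|x|=1\}$ and $\Pi_a h=h-\langle h,a\rangle a$. Let $\mathscr S$ be the $C_0$ group on $\mathscr H$ generated by $\mathscr A(u,v)=(v,-A_0^2u)$, $D(\mathscr A)=D(A_0^2)\times D(A_0)$. Let $\alpha\ge 0$ and $f\in L^2_{\mathrm{loc}}([0,\infty);D(A_0^\alpha))$, and let $(u_0,v_0)\in\mathscr H_\alpha$ satisfy $|u_0|=1$ and $\langle u_0,v_0\rangle=0$. Then there is a unique $(u,v)\in C([0,\infty);\mathscr H)$ with $(u,v)(0)=(u_0,v_0)$, $u\in C^1([0,\infty);M)$ and $u_t=v$ such that $u$ is a mild solution of $$u_{tt}+|u_t|^2u=-A_0^2u+|A_0u|^2u-\gamma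 u_t+\Pi_{u}f,$$ that is, for all $t\ge 0$, $$(u,v)(t)=\mathscr S(t)(u_0,v_0)+\int_0^t\mathscr S(t-s)\bigl(0,\,-|v(s)|^2u(s)+|A_0u(s)|^2u(s)-\gamma v(s)+\Pi_{u(s)}f(s)\bigr)\,ds .$$ Moreover, this solution satisfies $$(u,v)\in C([0,\infty);\mathscr H_\alpha),\qquad u\in C^1([0,\infty);D(A_0^{\alpha})).$$ -/

import Mathlib

open Set Filter Topology MeasureTheory
open scoped InnerProductSpace

noncomputable section

namespace ConstrainedWave

variable {H : Type*} [NormedAddCommGroup H] [InnerProductSpace ℝ H]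

/-! ### The domain of an operator with its graph norm, and the phase space -/

/-- The domain `D(A)` with the graph inner product `⟪A u₁, A u₂⟫ + ⟪u₁, u₂⟫`, realised as the graph
of `A` inside the Hilbert space `H ⊕ H`: an element is a pair `(u, A u)`. -/
def graphDom (A : H →ₗ.[ℝ] H) : Submodule ℝ (WithLp 2 (H × H)) :=
  A.graph.comap (WithLp.linearEquiv 2 ℝ (H × H)).toLinearMap

/-- The element `u` of `D(A)` as an element of the graph space. -/
def toGraphDom (A : H →ₗ.[ℝ] H) (u : A.domain) : graphDom A :=
  ⟨WithLp.toLp 2 ((u : H), A u), A.mem_graph u⟩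

/-- The phase space `D(A) × H`, with the inner product
`⟪A u₁, A u₂⟫ + ⟪u₁, u₂⟫ + ⟪v₁, v₂⟫`. -/
abbrev PhaseSpace (A : H →ₗ.[ℝ] H) : Type _ := WithLp 2 (graphDom A × H)

/-- The component `u` of `z = (u, v)`. -/
def pos {A : H →ₗ.[ℝ] H} (z : PhaseSpace A) : H := (z.fst : WithLp 2 (H × H)).fst

/-- `A u` for `z = (u, v)`. -/
def opPos {A : H →ₗ.[ℝ] H} (z : PhaseSpace A) : H := (z.fst : WithLp 2 (H × H)).snd

/-- The component `v` of `z = (u, v)`. -/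
def vel {A : H →ₗ.[ℝ] H} (z : PhaseSpace A) : H := z.snd

/-- The element `(0, h)` of the phase space. -/
def force (A : H →ₗ.[ℝ] H) (h : H) : PhaseSpace A := WithLp.toLp 2 (0, h)

lemma pos_mem_domain {A : H →ₗ.[ℝ] H} (z : PhaseSpace A) : pos z ∈ A.domain :=
  LinearPMap.mem_domain_of_mem_graph (y := opPos z) z.fst.2

lemma apply_pos {A : H →ₗ.[ℝ] H} (z : PhaseSpace A) :
    A ⟨pos z, pos_mem_domain z⟩ = opPos z := by
  have h : ((pos z, opPos z) : H × H) ∈ A.graph := z.fst.2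
  obtain ⟨y, hy1, hy2⟩ := (LinearPMap.mem_graph_iff A).1 h
  have h3 : (⟨pos z, pos_mem_domain z⟩ : A.domain) = y := Subtype.ext hy1.symm
  rw [h3]
  exact hy2

/-! ### The wave operator and the group that it generates -/

/-- The wave operator `(u, v) ↦ (v, -A² u)` in the phase space, with domain `D(A²) × D(A)`. -/
def waveOp (A : H →ₗ.[ℝ] H) : PhaseSpace A →ₗ.[ℝ] PhaseSpace A where
  domain :=
    { carrier := {z | opPos z ∈ A.domain ∧ vel z ∈ A.domain}
      add_mem' := fun hx hy => ⟨A.domain.add_mem hx.1 hy.1, A.domain.add_mem hx.2 hy.2⟩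
      zero_mem' := ⟨A.domain.zero_mem, A.domain.zero_mem⟩
      smul_mem' := fun c _ hx => ⟨A.domain.smul_mem c hx.1, A.domain.smul_mem c hx.2⟩ }
  toFun :=
    { toFun := fun z => WithLp.toLp 2
        (toGraphDom A ⟨vel z.1, z.2.2⟩, -A ⟨opPos z.1, z.2.1⟩)
      map_add' := fun x y => by
        have h1 : A ⟨vel (x + y).1, (x + y).2.2⟩
            = A ⟨vel x.1, x.2.2⟩ + A ⟨vel y.1, y.2.2⟩ := by
          rw [← LinearPMap.map_add]; rfl
        have h2 : A ⟨opPos (x + y).1, (x + y).2.1⟩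
            = A ⟨opPos x.1, x.2.1⟩ + A ⟨opPos y.1, y.2.1⟩ := by
          rw [← LinearPMap.map_add]; rfl
        apply (WithLp.equiv 2 _).injective
        refine Prod.ext (Subtype.ext ((WithLp.equiv 2 _).injective (Prod.ext ?_ ?_))) ?_
        · rfl
        · exact h1
        · change -A ⟨opPos (x + y).1, (x + y).2.1⟩
            = -A ⟨opPos x.1, x.2.1⟩ + -A ⟨opPos y.1, y.2.1⟩
          rw [h2, neg_add]
      map_smul' := fun c x => by
        have h1 : A ⟨vel (c • x).1, (c • x).2.2⟩ = c • A ⟨vel x.1, x.2.2⟩ := by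
          rw [← LinearPMap.map_smul]; rfl
        have h2 : A ⟨opPos (c • x).1, (c • x).2.1⟩ = c • A ⟨opPos x.1, x.2.1⟩ := by
          rw [← LinearPMap.map_smul]; rfl
        apply (WithLp.equiv 2 _).injective
        refine Prod.ext (Subtype.ext ((WithLp.equiv 2 _).injective (Prod.ext ?_ ?_))) ?_
        · rfl
        · exact h1
        · change -A ⟨opPos (c • x).1, (c • x).2.1⟩ = c • -A ⟨opPos x.1, x.2.1⟩
          rw [h2, smul_neg] }

/-- A `C₀` group of bounded operators on a normed space. -/
structure IsC0Group {X : Type*} [NormedAddCommGroup X] [NormedSpace ℝ X]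
    (S : ℝ → X →L[ℝ] X) : Prop where
  map_zero : S 0 = ContinuousLinearMap.id ℝ X
  map_add : ∀ s t : ℝ, S (s + t) = (S s).comp (S t)
  continuous_orbit : ∀ x : X, Continuous fun t => S t x

/-- `G` is the infinitesimal generator of `S`: its domain is the set of all `x` whose orbit is
differentiable at `0`, and `G x` is the derivative there. -/
def IsGenerator {X : Type*} [NormedAddCommGroup X] [NormedSpace ℝ X]
    (S : ℝ → X →L[ℝ] X) (G : X →ₗ.[ℝ] X) : Prop :=
  ∀ x y : X, (x, y) ∈ G.graph ↔ HasDerivAt (fun t => S t x) y 0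

/-! ### Fractional powers -/

/-- `T` is the inverse of `A² + I`: for all `x`, one has `T x ∈ D(A²)` and `A² (T x) + T x = x`. -/
def IsInvSqAddOne (A : H →ₗ.[ℝ] H) (T : H →L[ℝ] H) : Prop :=
  ∀ x : H, ∃ w : H, (T x, w) ∈ A.graph ∧ (w, x - T x) ∈ A.graph

/-- The bounded inverse of `A² + I` exists if `A` is self-adjoint. -/
theorem exists_isInvSqAddOne [CompleteSpace H] {A : H →ₗ.[ℝ] H} (hA : IsSelfAdjoint A) :
    ∃ T : H →L[ℝ] H, IsInvSqAddOne A T := by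
  have hcl : IsClosed ((graphDom A : Submodule ℝ (WithLp 2 (H × H))) : Set (WithLp 2 (H × H))) :=
    IsClosed.preimage (WithLp.prod_continuous_ofLp 2 H H) hA.isClosed
  have : CompleteSpace (graphDom A) := hcl.completeSpace_coe
  let J : graphDom A →L[ℝ] H := (WithLp.fstL 2 ℝ H H).comp (graphDom A).subtypeL
  refine ⟨J.comp (ContinuousLinearMap.adjoint J), fun x => ?_⟩
  set p := ContinuousLinearMap.adjoint J x with hp
  have hpg : ((p : WithLp 2 (H × H)).fst, (p : WithLp 2 (H × H)).snd) ∈ A.graph := p.2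
  refine ⟨(p : WithLp 2 (H × H)).snd, hpg, ?_⟩
  have key : ∀ z : A.domain, ⟪x - (p : WithLp 2 (H × H)).fst, (z : H)⟫_ℝ
      = ⟪(p : WithLp 2 (H × H)).snd, A z⟫_ℝ := fun z => by
    have h1 : ⟪p, toGraphDom A z⟫_ℝ = ⟪x, (z : H)⟫_ℝ :=
      ContinuousLinearMap.adjoint_inner_left J (toGraphDom A z) x
    have h2 : ⟪p, toGraphDom A z⟫_ℝ
        = ⟪(p : WithLp 2 (H × H)).fst, (z : H)⟫_ℝ + ⟪(p : WithLp 2 (H × H)).snd, A z⟫_ℝ :=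
      WithLp.prod_inner_apply _ _
    rw [inner_sub_left]
    linarith
  have hd := hA.dense_domain
  have hmem : (p : WithLp 2 (H × H)).snd ∈ (LinearPMap.adjoint A).domain :=
    LinearPMap.mem_adjoint_domain_of_exists _ ⟨_, key⟩
  have hap := LinearPMap.adjoint_apply_eq hd ⟨_, hmem⟩ key
  have hg := (LinearPMap.adjoint A).mem_graph ⟨_, hmem⟩
  rw [hap] at hg
  have hAA : (LinearPMap.adjoint A).graph = A.graph :=
    congrArg LinearPMap.graph (LinearPMap.isSelfAdjoint_def.1 hA)
  exact hAA ▸ hg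

open Classical in
/-- The operator `(A² + I)⁻¹`, a bounded self-adjoint operator with `0 ≤ (A² + I)⁻¹ ≤ I` if `A` is
self-adjoint. -/
def invSqAddOne (A : H →ₗ.[ℝ] H) : H →L[ℝ] H :=
  if h : ∃ T : H →L[ℝ] H, IsInvSqAddOne A T then h.choose else 0

lemma isInvSqAddOne_invSqAddOne [CompleteSpace H] {A : H →ₗ.[ℝ] H} (hA : IsSelfAdjoint A) :
    IsInvSqAddOne A (invSqAddOne A) := by
  have h := exists_isInvSqAddOne hA
  rw [invSqAddOne, dif_pos h]
  exact h.choose_spec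

/-- The power `T ^ β`, `β ≥ 0`, of a bounded self-adjoint operator `T` with `0 ≤ T ≤ I`, by the
binomial series `∑ₖ (β choose k) (T - I) ^ k`, which converges in operator norm. -/
def contractionPow (T : H →L[ℝ] H) (β : ℝ) : H →L[ℝ] H :=
  ∑' k : ℕ, Ring.choose β k • (T - 1) ^ k

/-- The bounded operator `A₁ ^ (-α)`, `α ≥ 0`, where `A₁ = (A² + I) ^ (1/2)`. It is injective with
range `D(A ^ α) = D(A₁ ^ α)`, and it is an isometry of `H` onto `D(A ^ α)` with the norm
`‖A₁ ^ α x‖`. -/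
def negPow (A : H →ₗ.[ℝ] H) (α : ℝ) : H →L[ℝ] H :=
  contractionPow (invSqAddOne A) (α / 2)

/-- `x ∈ D(A ^ α)` and `A₁ ^ α x = y`. -/
def HasPow (A : H →ₗ.[ℝ] H) (α : ℝ) (x y : H) : Prop := x = negPow A α y

/-- The domain `D(A ^ α)`. -/
def fracDom (A : H →ₗ.[ℝ] H) (α : ℝ) : Set H := {x | ∃ y, HasPow A α x y}

/-- `u ∈ C([0, ∞); D(A ^ α))`: `A₁ ^ α u` is continuous on `[0, ∞)` with values in `H`. -/
def ContInFracDom (A : H →ₗ.[ℝ] H) (α : ℝ) (u : ℝ → H) : Prop :=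
  ∃ w : ℝ → H, (∀ t, 0 ≤ t → HasPow A α (u t) (w t)) ∧ ContinuousOn w (Ici 0)

/-- `u ∈ C¹([0, ∞); D(A ^ α))`: `A₁ ^ α u` is continuously differentiable on `[0, ∞)` with values
in `H` (one-sidedly at `0`). -/
def C1InFracDom (A : H →ₗ.[ℝ] H) (α : ℝ) (u : ℝ → H) : Prop :=
  ∃ w : ℝ → H, (∀ t, 0 ≤ t → HasPow A α (u t) (w t)) ∧ ContDiffOn ℝ 1 w (Ici 0)

/-- `f ∈ L²_loc([0, ∞); D(A ^ α))`: `A₁ ^ α f` is square integrable on `(0, b)` for every `b`. -/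
def L2LocInFracDom (A : H →ₗ.[ℝ] H) (α : ℝ) (f : ℝ → H) : Prop :=
  ∃ g : ℝ → H, (∀ᵐ t ∂(volume.restrict (Ioi (0 : ℝ))), HasPow A α (f t) (g t)) ∧
    ∀ b : ℝ, MemLp g 2 (volume.restrict (Ioc 0 b))

/-! ### The constrained wave equation -/

/-- The map `Π_a h = h - ⟪h, a⟫ a`, for `‖a‖ = 1` the orthogonal projection onto the tangent space
at `a` of the unit sphere. -/
def tangentProj (a h : H) : H := h - ⟪h, a⟫_ℝ • a

/-- The right-hand side `-‖v‖² u + ‖A u‖² u - γ v + Π_u h` without the linear term `-A² u`. -/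
def nonlinearity {A : H →ₗ.[ℝ] H} (γ : ℝ) (z : PhaseSpace A) (h : H) : H :=
  -(‖vel z‖ ^ 2 • pos z) + ‖opPos z‖ ^ 2 • pos z - γ • vel z + tangentProj (pos z) h

/-- `z = (u, v)` is a mild solution on `[0, ∞)` of
`u'' + ‖u'‖² u = -A² u + ‖A u‖² u - γ u' + Π_u f`: with `S` the `C₀` group generated by the wave
operator, `z(t) = S(t) z(0) + ∫₀ᵗ S(t - s) (0, N(z(s), f(s))) ds`, where `N` is `nonlinearity`. -/
def IsMildSolution (A : H →ₗ.[ℝ] H) (γ : ℝ) (f : ℝ → H) (z : ℝ → PhaseSpace A) : Prop :=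
  ∃ S : ℝ → PhaseSpace A →L[ℝ] PhaseSpace A, IsC0Group S ∧ IsGenerator S (waveOp A) ∧
    ∀ t, 0 ≤ t →
      z t = S t (z 0) + ∫ s in (0 : ℝ)..t, S (t - s) (force A (nonlinearity γ (z s) (f s)))

/-- `z = (u, v) ∈ C([0, ∞); D(A) × H)` is a solution of the constrained problem with initial data
`(u₀, v₀)`: `u ∈ C¹([0, ∞); M)` with `M` the unit sphere of `H`, `u' = v`, and `u` is a mild
solution of the equation. -/
structure IsSolution (A : H →ₗ.[ℝ] H) (γ : ℝ) (f : ℝ → H) (u₀ v₀ : H)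
    (z : ℝ → PhaseSpace A) : Prop where
  continuousOn : ContinuousOn z (Ici 0)
  pos_zero : pos (z 0) = u₀
  vel_zero : vel (z 0) = v₀
  norm_pos : ∀ t, 0 ≤ t → ‖pos (z t)‖ = 1
  contDiffOn_pos : ContDiffOn ℝ 1 (fun t => pos (z t)) (Ici 0)
  hasDerivWithinAt_pos : ∀ t, 0 ≤ t →
    HasDerivWithinAt (fun s => pos (z s)) (vel (z t)) (Ici 0) t
  mild : IsMildSolution A γ f z

end ConstrainedWave

end

noncomputable section

namespace ConstrainedWave

/-! ### The binomial series at the boundary of its disc of convergence -/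

/-! The equation is the first-order system `z' = 𝒜 z + (0, N(z, f))` on `D(A) × H`. With the
multiplier `λ = ‖A u‖² - ‖v‖² - ⟪f, u⟫` the nonlinearity reads `λ u - γ v + f` (`nonlinearity_eq`).
It is locally Lipschitz in `z` with a constant proportional to `1 + ‖f(s)‖`, a locally square
integrable function, so Picard iteration in an exponentially weighted norm (`exists_exp_weight`)
solves the problem with `z` cut off by a radial retraction.

Along a mild solution `p = ‖u‖² - 1` and `q = ⟪u, v⟫` satisfy the linear system `p' = 2q`, `q' = λ p
- γ q`, so Gronwall's lemma keeps both equal to zero (`IsWaveMild.constraint`). Since then `u ⊥ v`,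
the multiplier does no work and `‖z(t)‖² ≤ ‖z(0)‖² + (2γ)⁻¹ ∫ ‖f‖²` (`IsWaveMild.norm_sq_le`). A
cut-off radius above this bound is never reached, which gives global existence
(`exists_constrained_isWaveMild`). Uniqueness is again Gronwall.

For regularity, `λ` along the solution is regarded as a known scalar coefficient, which leaves a
linear equation. The operator `A₁^(-α)` commutes with `A`, hence with the group. Solving the linear
equation for the data to which `A₁^α` has been applied, and mapping back by `A₁^(-α)`, yields a
solution of the equation that `z` solves, hence `z` itself (`exists_phaseMap_eq`).

All operator theory rests on `T = (A² + I)⁻¹`. The powers of `A₁` come from the binomial series,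
absolutely convergent up to the boundary of its disc (`summable_abs_choose`). The operators `Rₙ = I
- (I - T)ⁿ` tend to `I` strongly, and `Bₙ = 𝒜 Rₙ` are commuting bounded operators with `|⟪Bₙ z, z⟫|
≤ ‖z‖²`; their exponentials converge to the group (`exists_waveGroup`), the only one generated by
`𝒜` (`eq_waveGroup`). The identities for `‖u‖²`, `⟪u, v⟫` and `‖z‖²` hold for mild solutions because
these are limits of classical solutions of `Z' = Bₙ Z + Fₙ` (`exists_isMildApprox`). -/

lemma choose_succ_mul (r : ℝ) (k : ℕ) :
    Ring.choose r (k + 1) * (k + 1) = Ring.choose r k * (r - k) := by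
  rw [Ring.choose_eq_smul, Ring.choose_eq_smul, descPochhammer_succ_right, Nat.factorial_succ,
    Polynomial.smeval_mul, Polynomial.smeval_sub, Polynomial.smeval_X, Polynomial.smeval_natCast]
  have h1 : (k.factorial : ℝ) ≠ 0 := by positivity
  have h2 : (k + 1 : ℝ) ≠ 0 := by positivity
  simp only [smul_eq_mul, pow_one, pow_zero, nsmul_eq_mul, mul_one]
  push_cast
  field_simp

lemma sum_neg_one_pow_mul_choose (r : ℝ) (n : ℕ) :
    ∑ k ∈ Finset.range (n + 1), (-1) ^ k * Ring.choose r k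
      = (-1) ^ n * Ring.choose (r - 1) n := by
  induction n with
  | zero => simp
  | succ n ih =>
    rw [Finset.sum_range_succ, ih]
    have h := Ring.choose_succ_succ (r - 1) n
    rw [sub_add_cancel] at h
    rw [h]
    ring

/-- Consecutive terms have ratio `|r - 1 - n| / (n + 1)`, which is at most `1` once `n ≥ r`. -/
lemma exists_abs_choose_sub_one_le {r : ℝ} (hr : 0 ≤ r) :
    ∃ C : ℝ, ∀ n : ℕ, |Ring.choose (r - 1) n| ≤ C := by
  obtain ⟨N, hN⟩ := exists_nat_ge r
  have hstep : ∀ n, N ≤ n → |Ring.choose (r - 1) (n + 1)| ≤ |Ring.choose (r - 1) n| := by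
    intro n hn
    have hn' : (N : ℝ) ≤ n := by exact_mod_cast hn
    have h := congrArg abs (choose_succ_mul (r - 1) n)
    have hpos : (0 : ℝ) < n + 1 := by positivity
    rw [abs_mul, abs_mul, abs_of_pos hpos] at h
    have h3 : |r - 1 - n| ≤ n + 1 := by
      rw [abs_le]; constructor <;> linarith
    refine le_of_mul_le_mul_right ?_ hpos
    rw [h]
    exact mul_le_mul_of_nonneg_left h3 (abs_nonneg _)
  have hbd : ∀ n, N ≤ n → |Ring.choose (r - 1) n| ≤ |Ring.choose (r - 1) N| := by
    intro n hn
    induction n, hn using Nat.le_induction with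
    | base => exact le_rfl
    | succ n hn ih => exact (hstep n hn).trans ih
  refine ⟨∑ k ∈ Finset.range (N + 1), |Ring.choose (r - 1) k|, fun n => ?_⟩
  have hle : ∀ m ≤ N, |Ring.choose (r - 1) m|
      ≤ ∑ k ∈ Finset.range (N + 1), |Ring.choose (r - 1) k| := fun m hm =>
    Finset.single_le_sum (f := fun k => |Ring.choose (r - 1) k|) (fun _ _ => abs_nonneg _)
      (Finset.mem_range.2 (by omega))
  rcases le_total n N with h | h
  · exact hle n h
  · exact (hbd n h).trans (hle N le_rfl)

/-- At the boundary of the disc of convergence no geometric majorant is available. The terms `(-1)^k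
* choose r k` have constant sign for `k ≥ N ≥ r`, and their partial sums are `±choose (r - 1) n`,
hence bounded; for terms of one sign this is absolute convergence. -/
lemma summable_abs_choose {r : ℝ} (hr : 0 ≤ r) : Summable fun k : ℕ => |Ring.choose r k| := by
  obtain ⟨N, hN⟩ := exists_nat_ge r
  obtain ⟨C, hC⟩ := exists_abs_choose_sub_one_le hr
  set a : ℕ → ℝ := fun k => (-1) ^ k * Ring.choose r k with ha
  have habs : ∀ k, |Ring.choose r k| = |a k| := fun k => by simp [ha, abs_mul]
  have hS : ∀ n, |∑ k ∈ Finset.range n, a k| ≤ C := by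
    intro n
    cases n with
    | zero => simpa using (abs_nonneg _).trans (hC 0)
    | succ n =>
      rw [ha, sum_neg_one_pow_mul_choose, abs_mul]
      simpa using hC n
  have hstep : ∀ k, a (k + 1) * (k + 1) = a k * (k - r) := fun k => by
    have := choose_succ_mul r k
    simp only [ha, pow_succ]
    linear_combination (-(-1) ^ k) * this
  -- `σ` is the sign of `a N`; the factor `k - r` in `hstep` is nonnegative from `N` on, so the sign
  -- persists.
  obtain ⟨σ, hσ, hsign⟩ : ∃ σ : ℝ, |σ| = 1 ∧ ∀ k, |a (k + N)| = σ * a (k + N) := by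
    have key : ∀ σ : ℝ, 0 ≤ σ * a N → ∀ k, 0 ≤ σ * a (k + N) := by
      intro σ h0 k
      induction k with
      | zero => simpa using h0
      | succ k ih =>
        have h1 := hstep (k + N)
        have hpos : (0 : ℝ) < ((k + N : ℕ) : ℝ) + 1 := by positivity
        have h2 : 0 ≤ (((k + N : ℕ) : ℝ) - r) := by push_cast; linarith [Nat.cast_nonneg (α := ℝ) k]
        have h3 : σ * a (k + N + 1) * (((k + N : ℕ) : ℝ) + 1)
            = σ * a (k + N) * (((k + N : ℕ) : ℝ) - r) := by linear_combination σ * h1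
        have h4 : 0 ≤ σ * a (k + N + 1) * (((k + N : ℕ) : ℝ) + 1) := by
          rw [h3]; positivity
        rw [show k + 1 + N = k + N + 1 by ring]
        exact nonneg_of_mul_nonneg_left h4 hpos
    rcases le_total 0 (a N) with h | h
    · refine ⟨1, by simp, fun k => ?_⟩
      rw [one_mul, abs_of_nonneg (by simpa using key 1 (by simpa using h) k)]
    · refine ⟨-1, by simp, fun k => ?_⟩
      have := key (-1) (by linarith) k
      rw [abs_of_nonpos (by linarith)]; ring
  refine (summable_nat_add_iff N).1 (summable_of_sum_range_le (c := C + C)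
    (fun _ => abs_nonneg _) fun n => ?_)
  calc ∑ i ∈ Finset.range n, |Ring.choose r (i + N)|
      = σ * ∑ i ∈ Finset.range n, a (i + N) := by
        rw [Finset.mul_sum]
        exact Finset.sum_congr rfl fun i _ => by rw [habs, hsign]
    _ ≤ |σ * ∑ i ∈ Finset.range n, a (i + N)| := le_abs_self _
    _ = |∑ i ∈ Finset.range n, a (i + N)| := by rw [abs_mul, hσ, one_mul]
    _ = |∑ i ∈ Finset.range (N + n), a i - ∑ i ∈ Finset.range N, a i| := by
        rw [Finset.sum_range_add]; congr 1
        rw [add_sub_cancel_left]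
        exact Finset.sum_congr rfl fun i _ => by rw [add_comm]
    _ ≤ C + C := (abs_sub _ _).trans (add_le_add (hS _) (hS _))

/-! ### Powers of an operator `T` with `‖T - 1‖ ≤ 1` -/

section Pow

variable {H : Type*} [NormedAddCommGroup H] [InnerProductSpace ℝ H]

lemma norm_choose_smul_pow_le {T : H →L[ℝ] H} (hT : ‖T - 1‖ ≤ 1) (r : ℝ) (k : ℕ) :
    ‖Ring.choose r k • (T - 1) ^ k‖ ≤ |Ring.choose r k| := by
  rw [norm_smul, Real.norm_eq_abs]
  refine mul_le_of_le_one_right (abs_nonneg _) ?_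
  -- The zeroth power is separate: `‖1‖ = 1` fails on the trivial space, where only `‖1‖ ≤ 1` holds.
  cases k with
  | zero => rw [pow_zero]; exact ContinuousLinearMap.norm_id_le
  | succ k => exact (norm_pow_le' _ k.succ_pos).trans (pow_le_one₀ (norm_nonneg _) hT)

lemma summable_norm_choose_smul_pow {T : H →L[ℝ] H} (hT : ‖T - 1‖ ≤ 1) {r : ℝ} (hr : 0 ≤ r) :
    Summable fun k : ℕ => ‖Ring.choose r k • (T - 1) ^ k‖ :=
  (summable_abs_choose hr).of_nonneg_of_le (fun _ => norm_nonneg _)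
    (norm_choose_smul_pow_le hT r)

lemma contractionPow_one (T : H →L[ℝ] H) : contractionPow T 1 = T := by
  have h : ∀ k ∉ Finset.range 2, Ring.choose (1 : ℝ) k • (T - 1) ^ k = 0 := by
    intro k hk
    have hk : 1 < k := by simpa using hk
    have := Ring.choose_natCast (R := ℝ) 1 k
    rw [Nat.choose_eq_zero_of_lt hk] at this
    norm_num at this
    rw [this, zero_smul]
  rw [contractionPow, tsum_eq_sum h]
  simp [Finset.sum_range_succ]

variable [CompleteSpace H]

/-- Cauchy product of two absolutely convergent series, whose coefficients combine by the
Chu–Vandermonde identity. -/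
lemma contractionPow_add {T : H →L[ℝ] H} (hT : ‖T - 1‖ ≤ 1) {a b : ℝ} (ha : 0 ≤ a) (hb : 0 ≤ b) :
    contractionPow T (a + b) = contractionPow T a * contractionPow T b := by
  rw [contractionPow, contractionPow, contractionPow,
    tsum_mul_tsum_eq_tsum_sum_antidiagonal_of_summable_norm
      (summable_norm_choose_smul_pow hT ha) (summable_norm_choose_smul_pow hT hb)]
  refine tsum_congr fun n => ?_
  rw [Ring.add_choose_eq n (Commute.all a b), Finset.sum_smul]
  refine Finset.sum_congr rfl fun ij hij => ?_
  rw [smul_mul_smul_comm, ← pow_add, Finset.HasAntidiagonal.mem_antidiagonal.1 hij]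

end Pow

section PhaseSpace

variable {H : Type*} [NormedAddCommGroup H] [InnerProductSpace ℝ H]

/-! ### The phase space in coordinates -/

section Coordinates

variable {A : H →ₗ.[ℝ] H}

/-- The inclusion of `D(A)` with the graph norm into `H`. -/
def inclL (A : H →ₗ.[ℝ] H) : graphDom A →L[ℝ] H :=
  (WithLp.fstL 2 ℝ H H).comp (graphDom A).subtypeL

/-- The operator `A` as a bounded map on its domain with the graph norm. -/
def opL (A : H →ₗ.[ℝ] H) : graphDom A →L[ℝ] H :=
  (WithLp.sndL 2 ℝ H H).comp (graphDom A).subtypeL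

lemma graphDom_mem (p : graphDom A) : (inclL A p, opL A p) ∈ A.graph := p.2

lemma graph_unique {x y y' : H} (h : (x, y) ∈ A.graph) (h' : (x, y') ∈ A.graph) : y = y' :=
  A.mem_graph_snd_inj h h' rfl

lemma graphDom_ext {p q : graphDom A} (h : inclL A p = inclL A q) : p = q := by
  have hp := graphDom_mem p
  rw [h] at hp
  exact Subtype.ext ((WithLp.equiv 2 _).injective
    (Prod.ext h (graph_unique hp (graphDom_mem q))))

lemma inner_graphDom (p q : graphDom A) :
    ⟪p, q⟫_ℝ = ⟪inclL A p, inclL A q⟫_ℝ + ⟪opL A p, opL A q⟫_ℝ :=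
  WithLp.prod_inner_apply _ _

/-- The pair `(x, y)` of the graph of `A` as an element of `D(A)` with the graph norm. -/
def mkGraphDom {x y : H} (h : (x, y) ∈ A.graph) : graphDom A := ⟨WithLp.toLp 2 (x, y), h⟩

lemma inclL_mkGraphDom {x y : H} (h : (x, y) ∈ A.graph) : inclL A (mkGraphDom h) = x := rfl

lemma opL_mkGraphDom {x y : H} (h : (x, y) ∈ A.graph) : opL A (mkGraphDom h) = y := rfl

lemma norm_inclL_le (p : graphDom A) : ‖inclL A p‖ ≤ ‖p‖ := WithLp.norm_fst_le _ _

variable (A) in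
/-- The component in `D(A)` of an element of the phase space. -/
def fstL : PhaseSpace A →L[ℝ] graphDom A := WithLp.fstL 2 ℝ _ _

variable (A) in
/-- The map `(u, v) ↦ u` from the phase space to `H`. -/
def posL : PhaseSpace A →L[ℝ] H := (inclL A).comp (fstL A)

variable (A) in
/-- The map `(u, v) ↦ A u` from the phase space to `H`. -/
def opPosL : PhaseSpace A →L[ℝ] H := (opL A).comp (fstL A)

variable (A) in
/-- The map `(u, v) ↦ v` from the phase space to `H`. -/
def velL : PhaseSpace A →L[ℝ] H := WithLp.sndL 2 ℝ _ _

variable (A) in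
/-- The element `(p, v)` of the phase space. -/
def mkL : graphDom A × H →L[ℝ] PhaseSpace A :=
  (WithLp.prodContinuousLinearEquiv 2 ℝ (graphDom A) H).symm.toContinuousLinearMap

variable (A) in
/-- The map `h ↦ (0, h)` from `H` to the phase space. -/
def forceL : H →L[ℝ] PhaseSpace A := (mkL A).comp (ContinuousLinearMap.inr ℝ _ _)

@[simp] lemma posL_apply (z : PhaseSpace A) : posL A z = pos z := rfl
@[simp] lemma opPosL_apply (z : PhaseSpace A) : opPosL A z = opPos z := rfl
@[simp] lemma velL_apply (z : PhaseSpace A) : velL A z = vel z := rfl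
@[simp] lemma pos_force (h : H) : pos (force A h) = 0 := rfl
@[simp] lemma opPos_force (h : H) : opPos (force A h) = 0 := rfl
@[simp] lemma vel_force (h : H) : vel (force A h) = h := rfl

lemma phase_mem_graph (z : PhaseSpace A) : (pos z, opPos z) ∈ A.graph := z.fst.2

lemma phase_ext {z w : PhaseSpace A} (h1 : pos z = pos w) (h2 : vel z = vel w) : z = w :=
  (WithLp.equiv 2 _).injective (Prod.ext (graphDom_ext h1) h2)

lemma inner_phase (z w : PhaseSpace A) :
    ⟪z, w⟫_ℝ = ⟪pos z, pos w⟫_ℝ + ⟪opPos z, opPos w⟫_ℝ + ⟪vel z, vel w⟫_ℝ := by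
  rw [WithLp.prod_inner_apply, inner_graphDom]; rfl

lemma norm_sq_phase (z : PhaseSpace A) :
    ‖z‖ ^ 2 = ‖pos z‖ ^ 2 + ‖opPos z‖ ^ 2 + ‖vel z‖ ^ 2 := by
  simp only [← real_inner_self_eq_norm_sq, inner_phase]

lemma norm_pos_le (z : PhaseSpace A) : ‖pos z‖ ≤ ‖z‖ :=
  le_of_sq_le_sq (by nlinarith [norm_sq_phase z, sq_nonneg ‖opPos z‖, sq_nonneg ‖vel z‖])
    (norm_nonneg _)

lemma norm_opPos_le (z : PhaseSpace A) : ‖opPos z‖ ≤ ‖z‖ :=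
  le_of_sq_le_sq (by nlinarith [norm_sq_phase z, sq_nonneg ‖pos z‖, sq_nonneg ‖vel z‖])
    (norm_nonneg _)

lemma norm_vel_le (z : PhaseSpace A) : ‖vel z‖ ≤ ‖z‖ :=
  le_of_sq_le_sq (by nlinarith [norm_sq_phase z, sq_nonneg ‖pos z‖, sq_nonneg ‖opPos z‖])
    (norm_nonneg _)

lemma norm_force (h : H) : ‖force A h‖ = ‖h‖ := WithLp.norm_toLp_snd ..

lemma pos_sub (z w : PhaseSpace A) : pos (z - w) = pos z - pos w := map_sub (posL A) z w
lemma opPos_sub (z w : PhaseSpace A) : opPos (z - w) = opPos z - opPos w := map_sub (opPosL A) z w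
lemma vel_sub (z w : PhaseSpace A) : vel (z - w) = vel z - vel w := map_sub (velL A) z w
lemma force_sub (h k : H) : force A (h - k) = force A h - force A k := map_sub (forceL A) h k

lemma continuous_pos : Continuous (pos : PhaseSpace A → H) := (posL A).continuous
lemma continuous_opPos : Continuous (opPos : PhaseSpace A → H) := (opPosL A).continuous
lemma continuous_vel : Continuous (vel : PhaseSpace A → H) := (velL A).continuous

end Coordinates

/-! ### Bounded operators that commute with `A` -/

/-- The bounded operator `P` maps `D(A)` to `D(A)` and commutes with `A` there. -/
def CommutesWith (A : H →ₗ.[ℝ] H) (P : H →L[ℝ] H) : Prop :=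
  ∀ x y : H, (x, y) ∈ A.graph → (P x, P y) ∈ A.graph

namespace CommutesWith

variable {A : H →ₗ.[ℝ] H} {P P' : H →L[ℝ] H}

lemma one : CommutesWith A (1 : H →L[ℝ] H) := fun _ _ h => h

lemma zero : CommutesWith A (0 : H →L[ℝ] H) := fun _ _ _ => A.graph.zero_mem

lemma add (h : CommutesWith A P) (h' : CommutesWith A P') : CommutesWith A (P + P') :=
  fun x y hxy => A.graph.add_mem (h x y hxy) (h' x y hxy)

lemma sub (h : CommutesWith A P) (h' : CommutesWith A P') : CommutesWith A (P - P') :=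
  fun x y hxy => A.graph.sub_mem (h x y hxy) (h' x y hxy)

lemma smul (c : ℝ) (h : CommutesWith A P) : CommutesWith A (c • P) :=
  fun x y hxy => A.graph.smul_mem c (h x y hxy)

lemma mul (h : CommutesWith A P) (h' : CommutesWith A P') : CommutesWith A (P * P') :=
  fun x y hxy => h _ _ (h' x y hxy)

lemma pow (h : CommutesWith A P) (n : ℕ) : CommutesWith A (P ^ n) := by
  induction n with
  | zero => exact one
  | succ n ih => exact pow_succ P n ▸ ih.mul h

lemma sum {ι : Type*} (s : Finset ι) {f : ι → H →L[ℝ] H} (h : ∀ i ∈ s, CommutesWith A (f i)) :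
    CommutesWith A (∑ i ∈ s, f i) := by
  classical
  induction s using Finset.induction_on with
  | empty => simpa using zero
  | insert a s ha ih =>
    rw [Finset.sum_insert ha]
    exact (h a (by simp)).add (ih fun i hi => h i (by simp [hi]))

lemma of_tendsto (hA : A.IsClosed) {ι : Type*} {l : Filter ι} [l.NeBot] {f : ι → H →L[ℝ] H}
    (h : ∀ i, CommutesWith A (f i)) (hf : ∀ x, Tendsto (fun i => f i x) l (𝓝 (P x))) :
    CommutesWith A P := fun x y hxy =>
  hA.mem_of_tendsto ((hf x).prodMk_nhds (hf y)) (Eventually.of_forall fun i => h i x y hxy)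

lemma tsum (hA : A.IsClosed) {f : ℕ → H →L[ℝ] H} (hf : Summable f)
    (h : ∀ i, CommutesWith A (f i)) : CommutesWith A (∑' i, f i) :=
  of_tendsto hA (fun s : Finset ℕ => sum s fun i _ => h i) fun x =>
    (ContinuousLinearMap.apply ℝ H x).continuous.continuousAt.tendsto.comp hf.hasSum

end CommutesWith

/-! ### Operators on the phase space induced by operators that commute with `A` -/

section PhaseMap

variable {A : H →ₗ.[ℝ] H}

/-- The map that `P` induces on `D(A)` with the graph norm. -/
def graphMap (P : H →L[ℝ] H) (hP : CommutesWith A P) : graphDom A →L[ℝ] graphDom A :=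
  (((WithLp.prodContinuousLinearEquiv 2 ℝ H H).symm.toContinuousLinearMap.comp
    ((P.comp (inclL A)).prod (P.comp (opL A))))).codRestrict (graphDom A)
    fun p => hP _ _ (graphDom_mem p)

/-- The map `(u, v) ↦ (P u, P v)` of the phase space. -/
def phaseMap (P : H →L[ℝ] H) (hP : CommutesWith A P) : PhaseSpace A →L[ℝ] PhaseSpace A :=
  (mkL A).comp (((graphMap P hP).comp (fstL A)).prod (P.comp (velL A)))

variable {P : H →L[ℝ] H} (hP : CommutesWith A P)

@[simp] lemma pos_phaseMap (z : PhaseSpace A) : pos (phaseMap P hP z) = P (pos z) := rfl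
@[simp] lemma vel_phaseMap (z : PhaseSpace A) : vel (phaseMap P hP z) = P (vel z) := rfl

lemma norm_phaseMap_le {C : ℝ} (hC : 0 ≤ C) (h : ∀ x, ‖P x‖ ≤ C * ‖x‖) (z : PhaseSpace A) :
    ‖phaseMap P hP z‖ ≤ C * ‖z‖ := by
  refine le_of_sq_le_sq ?_ (by positivity)
  rw [mul_pow, norm_sq_phase, norm_sq_phase z, mul_add, mul_add, ← mul_pow, ← mul_pow, ← mul_pow]
  gcongr <;> exact h _

end PhaseMap

/-! ### The resolvent `(A² + I)⁻¹` -/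

section Resolvent

variable [CompleteSpace H] {A : H →ₗ.[ℝ] H} [hA : Fact (IsSelfAdjoint A)]

/-- Closedness of the graph makes adjoints of maps out of `D(A)` available. Self-adjointness is a
`Fact` so that instance search finds this. -/
instance : CompleteSpace (graphDom A) := by
  have hcl : IsClosed ((graphDom A : Submodule ℝ (WithLp 2 (H × H))) : Set (WithLp 2 (H × H))) :=
    IsClosed.preimage (WithLp.prod_continuous_ofLp 2 H H) hA.out.isClosed
  exact hcl.completeSpace_coe

lemma graph_symm {x y x' y' : H} (h : (x, y) ∈ A.graph) (h' : (x', y') ∈ A.graph) :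
    ⟪y, x'⟫_ℝ = ⟪x, y'⟫_ℝ := by
  have h0 := LinearPMap.adjoint_isFormalAdjoint hA.out.dense_domain
  rw [LinearPMap.isSelfAdjoint_def.1 hA.out] at h0
  obtain ⟨a, rfl, rfl⟩ := (LinearPMap.mem_graph_iff A).1 h
  obtain ⟨b, rfl, rfl⟩ := (LinearPMap.mem_graph_iff A).1 h'
  exact h0 a b

variable (A) in
/-- The operator `(A² + I)⁻¹` as a bounded map to `D(A)` with the graph norm. -/
def resL : H →L[ℝ] graphDom A := ContinuousLinearMap.adjoint (inclL A)

lemma inner_resL (x : H) (p : graphDom A) : ⟪resL A x, p⟫_ℝ = ⟪x, inclL A p⟫_ℝ :=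
  ContinuousLinearMap.adjoint_inner_left (inclL A) p x

/-- By symmetry of `A`, the graph inner product of `(t, A t)` with any `p` is `⟪x - t, p⟫ + ⟪t, p⟫ =
⟪x, p⟫`, which characterises the adjoint of the inclusion. -/
lemma resL_eq {x t w : H} (h1 : (t, w) ∈ A.graph) (h2 : (w, x - t) ∈ A.graph) :
    resL A x = mkGraphDom h1 := by
  refine ext_inner_right ℝ fun p => ?_
  rw [inner_resL, inner_graphDom, inclL_mkGraphDom, opL_mkGraphDom,
    ← graph_symm h2 (graphDom_mem p), inner_sub_left]
  ring

/-- Uniqueness for the resolvent equation. It frees `invSqAddOne` from the choice in its definition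
and is the way to compute its values. -/
lemma invSqAddOne_eq {x t w : H} (h1 : (t, w) ∈ A.graph) (h2 : (w, x - t) ∈ A.graph) :
    invSqAddOne A x = t := by
  obtain ⟨w', h1', h2'⟩ := isInvSqAddOne_invSqAddOne hA.out x
  have := (resL_eq h1' h2').symm.trans (resL_eq h1 h2)
  exact congrArg (inclL A) this

@[simp] lemma inclL_resL (x : H) : inclL A (resL A x) = invSqAddOne A x := by
  obtain ⟨w, h1, h2⟩ := isInvSqAddOne_invSqAddOne hA.out x
  rw [resL_eq h1 h2, inclL_mkGraphDom]

lemma resL_mem (x : H) : (opL A (resL A x), x - invSqAddOne A x) ∈ A.graph := by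
  obtain ⟨w, h1, h2⟩ := isInvSqAddOne_invSqAddOne hA.out x
  rwa [resL_eq h1 h2, opL_mkGraphDom]

lemma invSqAddOne_mem (x : H) : (invSqAddOne A x, opL A (resL A x)) ∈ A.graph := by
  rw [← inclL_resL]; exact graphDom_mem _

lemma inner_invSqAddOne (x y : H) : ⟪invSqAddOne A x, y⟫_ℝ = ⟪resL A x, resL A y⟫_ℝ := by
  rw [← inclL_resL, real_inner_comm, ← inner_resL, real_inner_comm]

lemma invSqAddOne_symm (x y : H) : ⟪invSqAddOne A x, y⟫_ℝ = ⟪x, invSqAddOne A y⟫_ℝ := by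
  rw [inner_invSqAddOne, real_inner_comm, ← inner_invSqAddOne, real_inner_comm]

/-- This is `T² ≤ T`: the form `⟪T x, x⟫` is the squared graph norm of `T x`, which dominates its
norm in `H`. -/
lemma norm_sq_invSqAddOne_le (x : H) : ‖invSqAddOne A x‖ ^ 2 ≤ ⟪invSqAddOne A x, x⟫_ℝ := by
  rw [inner_invSqAddOne, real_inner_self_eq_norm_sq, ← inclL_resL]
  gcongr
  exact norm_inclL_le _

/-- Expanding the square reduces this to `T² ≤ T`. The first term shows that `I - T` is a
contraction; the second measures how much norm each application of `I - T` loses. -/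
lemma norm_sq_sub_add_le (x : H) :
    ‖x - invSqAddOne A x‖ ^ 2 + ‖invSqAddOne A x‖ ^ 2 ≤ ‖x‖ ^ 2 := by
  rw [norm_sub_sq_real, real_inner_comm]
  linarith [norm_sq_invSqAddOne_le (A := A) x]

lemma norm_one_sub_apply_le (x : H) : ‖(1 - invSqAddOne A) x‖ ≤ ‖x‖ :=
  le_of_sq_le_sq (by
    have := norm_sq_sub_add_le (A := A) x
    change ‖x - invSqAddOne A x‖ ^ 2 ≤ _
    nlinarith [sq_nonneg ‖invSqAddOne A x‖]) (norm_nonneg _)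

lemma norm_invSqAddOne_sub_one_le : ‖invSqAddOne A - 1‖ ≤ 1 := by
  rw [← norm_neg, neg_sub]
  exact ContinuousLinearMap.opNorm_le_bound _ zero_le_one fun x => by
    rw [one_mul]; exact norm_one_sub_apply_le x

lemma invSqAddOne_injective : Function.Injective (invSqAddOne A) := by
  rw [injective_iff_map_eq_zero]
  intro x hx
  have h1 := invSqAddOne_mem (A := A) x
  have h2 := resL_mem (A := A) x
  rw [hx] at h1 h2
  rw [graph_unique h1 A.graph.zero_mem, sub_zero] at h2
  exact graph_unique h2 A.graph.zero_mem

/-- If `y = A x`, applying `A` to the resolvent equation of `x` shows that `A T x` solves that of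
`y`. -/
lemma CommutesWith.invSqAddOne : CommutesWith A (invSqAddOne A) := by
  intro x y hxy
  have h1 := invSqAddOne_mem (A := A) x
  have h2 := resL_mem (A := A) x
  have h3 : (x - ConstrainedWave.invSqAddOne A x, y - opL A (resL A x)) ∈ A.graph :=
    A.graph.sub_mem hxy h1
  rw [invSqAddOne_eq h2 h3]
  exact h1

end Resolvent

end PhaseSpace

section FractionalPowers

/-! ### Strong convergence -/

/-- An `ε/2` argument with a nearby point of `D`. The bound is only required eventually, so that the
lemma also covers limits `t → 0`. -/
lemma tendsto_apply_of_dense {E F ι : Type*} [NormedAddCommGroup E] [NormedSpace ℝ E]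
    [NormedAddCommGroup F] [NormedSpace ℝ F] {l : Filter ι} {f : ι → E →L[ℝ] F} {g : E →L[ℝ] F}
    {C : ℝ} (hf : ∀ᶠ i in l, ∀ x, ‖f i x‖ ≤ C * ‖x‖) {D : Set E} (hD : Dense D)
    (h : ∀ x ∈ D, Tendsto (fun i => f i x) l (𝓝 (g x))) (x : E) :
    Tendsto (fun i => f i x) l (𝓝 (g x)) := by
  rw [Metric.tendsto_nhds]
  intro ε hε
  have hK : 0 < |C| + ‖g‖ + 1 := by positivity
  obtain ⟨y, hyD, hy⟩ := hD.exists_dist_lt x (show 0 < ε / 2 / (|C| + ‖g‖ + 1) by positivity)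
  filter_upwards [hf, (Metric.tendsto_nhds.1 (h y hyD)) (ε / 2) (by positivity)] with i hfi hi
  have h1 : ‖f i (x - y)‖ ≤ |C| * ‖x - y‖ :=
    (hfi _).trans (mul_le_mul_of_nonneg_right (le_abs_self C) (norm_nonneg _))
  have h2 : ‖g (y - x)‖ ≤ ‖g‖ * ‖x - y‖ := by
    rw [norm_sub_rev x y]; exact g.le_opNorm _
  rw [dist_eq_norm] at hi hy ⊢
  have h3 : f i x - g x = f i (x - y) + (f i y - g y) + g (y - x) := by
    rw [map_sub, map_sub]; abel
  have h4 : (|C| + ‖g‖ + 1) * ‖x - y‖ < ε / 2 := by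
    rwa [lt_div_iff₀' hK] at hy
  calc ‖f i x - g x‖ ≤ ‖f i (x - y)‖ + ‖f i y - g y‖ + ‖g (y - x)‖ := by
        rw [h3]; exact norm_add₃_le
    _ < ε := by nlinarith [norm_nonneg (x - y)]

lemma exists_tendsto_apply_of_dense {E F : Type*} [NormedAddCommGroup E] [NormedSpace ℝ E]
    [NormedAddCommGroup F] [NormedSpace ℝ F] [CompleteSpace F] {f : ℕ → E →L[ℝ] F} {C : ℝ}
    (hf : ∀ i x, ‖f i x‖ ≤ C * ‖x‖) {D : Set E} (hD : Dense D)
    (h : ∀ x ∈ D, CauchySeq fun i => f i x) :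
    ∃ g : E →L[ℝ] F, ∀ x, Tendsto (fun i => f i x) atTop (𝓝 (g x)) := by
  have hc : ∀ x, CauchySeq fun i => f i x := by
    intro x
    rw [Metric.cauchySeq_iff']
    intro ε hε
    have hK : 0 < |C| + 1 := by positivity
    obtain ⟨y, hyD, hy⟩ := hD.exists_dist_lt x (show 0 < ε / 4 / (|C| + 1) by positivity)
    obtain ⟨N, hN⟩ := Metric.cauchySeq_iff'.1 (h y hyD) (ε / 4) (by positivity)
    refine ⟨N, fun n hn => ?_⟩
    have h1 : ∀ i, ‖f i (x - y)‖ < ε / 4 := fun i => by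
      refine ((hf i _).trans (mul_le_mul_of_nonneg_right (le_abs_self C) (norm_nonneg _))).trans_lt ?_
      rw [dist_eq_norm, lt_div_iff₀' hK] at hy
      nlinarith [norm_nonneg (x - y)]
    have h2 := hN n hn
    rw [dist_eq_norm] at h2 ⊢
    have h3 : f n x - f N x = f n (x - y) + (f n y - f N y) - f N (x - y) := by
      simp only [map_sub]; abel
    rw [h3]
    calc _ ≤ ‖f n (x - y)‖ + ‖f n y - f N y‖ + ‖f N (x - y)‖ :=
          (norm_sub_le _ _).trans (add_le_add_left (norm_add_le _ _) _)
      _ < ε := by linarith [h1 n, h1 N]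
  choose g hg using fun x => cauchySeq_tendsto_of_complete (hc x)
  let g' : E →ₗ[ℝ] F := linearMapOfTendsto g (fun i => (f i).toLinearMap) (tendsto_pi_nhds.2 hg)
  exact ⟨g'.mkContinuous C fun x => le_of_tendsto (hg x).norm (Eventually.of_forall fun i => hf i x),
    hg⟩

variable {H : Type*} [NormedAddCommGroup H] [InnerProductSpace ℝ H] {A : H →ₗ.[ℝ] H}

/-- The orthogonal complement of the range of a symmetric operator is its kernel. -/
lemma dense_range_of_symm [CompleteSpace H] {P : H →L[ℝ] H} (hP : ∀ x y, ⟪P x, y⟫_ℝ = ⟪x, P y⟫_ℝ)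
    (hinj : Function.Injective P) : DenseRange P := by
  have h : (LinearMap.range P.toLinearMap).topologicalClosure = ⊤ := by
    rw [Submodule.topologicalClosure_eq_top_iff, Submodule.eq_bot_iff]
    intro x hx
    refine hinj (ext_inner_left ℝ fun y => ?_)
    rw [map_zero, inner_zero_right, ← hP]
    exact hx _ ⟨y, rfl⟩
  exact (Submodule.dense_iff_topologicalClosure_eq_top).2 h

/-! ### Approximations of the identity by functions of the resolvent -/

variable (A) in
/-- The partial sums of the Neumann series `∑ (I - T) ^ k` of `T⁻¹`, where `T = (A² + I)⁻¹`. -/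
def neumannSum (n : ℕ) : H →L[ℝ] H := ∑ k ∈ Finset.range n, (1 - invSqAddOne A) ^ k

variable (A) in
/-- The operator `I - (I - T) ^ n`, where `T = (A² + I)⁻¹`. It maps into `D(A²)` and tends to `I`
strongly. -/
def approxId (n : ℕ) : H →L[ℝ] H := 1 - (1 - invSqAddOne A) ^ n

lemma invSqAddOne_mul_neumannSum (n : ℕ) :
    invSqAddOne A * neumannSum A n = approxId A n := by
  have := mul_neg_geom_sum (1 - invSqAddOne A) n
  rwa [sub_sub_cancel] at this

lemma commute_neumannSum {P : H →L[ℝ] H} (hP : Commute (invSqAddOne A) P) (n : ℕ) :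
    Commute (neumannSum A n) P :=
  Commute.sum_left _ _ _ fun k _ => (((Commute.one_left P).sub_left hP).pow_left k)

lemma invSqAddOne_neumannSum (n : ℕ) (x : H) :
    invSqAddOne A (neumannSum A n x) = approxId A n x :=
  congrArg (fun P : H →L[ℝ] H => P x) (invSqAddOne_mul_neumannSum n)

lemma commute_invSqAddOne_neumannSum (n : ℕ) : Commute (invSqAddOne A) (neumannSum A n) :=
  (commute_neumannSum (Commute.refl _) n).symm

variable [CompleteSpace H] [hA : Fact (IsSelfAdjoint A)]

lemma commutesWith_one_sub : CommutesWith A (1 - invSqAddOne A) :=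
  CommutesWith.one.sub CommutesWith.invSqAddOne

lemma commutesWith_approxId (n : ℕ) : CommutesWith A (approxId A n) :=
  CommutesWith.one.sub (commutesWith_one_sub.pow n)

lemma commute_invSqAddOne_of_commutesWith {P : H →L[ℝ] H} (hP : CommutesWith A P) :
    Commute (invSqAddOne A) P := by
  refine ContinuousLinearMap.ext fun x => ?_
  refine invSqAddOne_eq (hP _ _ (invSqAddOne_mem x)) ?_
  have := hP _ _ (resL_mem (A := A) x)
  rwa [map_sub] at this

lemma norm_one_sub_pow_apply_le (n : ℕ) (x : H) : ‖((1 - invSqAddOne A) ^ n) x‖ ≤ ‖x‖ := by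
  induction n with
  | zero => simp
  | succ n ih =>
    rw [pow_succ']
    exact (norm_one_sub_apply_le _).trans ih

lemma norm_approxId_apply_le (n : ℕ) (x : H) : ‖approxId A n x‖ ≤ 2 * ‖x‖ :=
  calc ‖x - ((1 - invSqAddOne A) ^ n) x‖ ≤ ‖x‖ + ‖((1 - invSqAddOne A) ^ n) x‖ := norm_sub_le _ _
    _ ≤ 2 * ‖x‖ := by linarith [norm_one_sub_pow_apply_le (A := A) n x]

lemma one_sub_symm (x y : H) :
    ⟪(1 - invSqAddOne A) x, y⟫_ℝ = ⟪x, (1 - invSqAddOne A) y⟫_ℝ := by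
  simp only [_root_.sub_apply, one_apply_eq_self, inner_sub_left,
    inner_sub_right, invSqAddOne_symm]

lemma one_sub_pow_symm (n : ℕ) (x y : H) :
    ⟪((1 - invSqAddOne A) ^ n) x, y⟫_ℝ = ⟪x, ((1 - invSqAddOne A) ^ n) y⟫_ℝ := by
  induction n generalizing x y with
  | zero => simp
  | succ n ih =>
    calc ⟪((1 - invSqAddOne A) ^ (n + 1)) x, y⟫_ℝ
        = ⟪((1 - invSqAddOne A) ^ n) ((1 - invSqAddOne A) x), y⟫_ℝ := by rw [pow_succ]; rfl
      _ = ⟪x, (1 - invSqAddOne A) (((1 - invSqAddOne A) ^ n) y)⟫_ℝ := by rw [ih, one_sub_symm]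
      _ = _ := by rw [pow_succ']; rfl

lemma neumannSum_symm (n : ℕ) (x y : H) :
    ⟪neumannSum A n x, y⟫_ℝ = ⟪x, neumannSum A n y⟫_ℝ := by
  simp only [neumannSum, _root_.sum_apply, sum_inner, inner_sum, one_sub_pow_symm]

/-- The powers are contractions, so vectors in the dense range of `T` suffice. For `fₙ = (I - T)ⁿ y`
the norm loss gives `‖T fₙ‖² ≤ ‖fₙ‖² - ‖fₙ₊₁‖²`, which telescopes; hence `(I - T)ⁿ T y = T fₙ → 0`.
-/
lemma tendsto_one_sub_pow (x : H) :
    Tendsto (fun n : ℕ => ((1 - invSqAddOne A) ^ n) x) atTop (𝓝 0) := by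
  refine tendsto_apply_of_dense (g := 0) (C := 1)
    (Eventually.of_forall fun n x => by rw [one_mul]; exact norm_one_sub_pow_apply_le n x)
    (dense_range_of_symm invSqAddOne_symm invSqAddOne_injective (P := invSqAddOne A)) ?_ x
  rintro _ ⟨y, rfl⟩
  set f : ℕ → H := fun n => ((1 - invSqAddOne A) ^ n) y with hf
  have hstep : ∀ n, ‖invSqAddOne A (f n)‖ ^ 2 ≤ ‖f n‖ ^ 2 - ‖f (n + 1)‖ ^ 2 := fun n => by
    have h := norm_sq_sub_add_le (A := A) (f n)
    have h1 : f (n + 1) = f n - invSqAddOne A (f n) := by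
      simp only [hf, pow_succ']; rfl
    rw [h1]; linarith
  have hsum : Summable fun n => ‖invSqAddOne A (f n)‖ ^ 2 := by
    refine summable_of_sum_range_le (c := ‖f 0‖ ^ 2) (fun _ => by positivity) fun n => ?_
    calc _ ≤ ∑ i ∈ Finset.range n, (‖f i‖ ^ 2 - ‖f (i + 1)‖ ^ 2) :=
          Finset.sum_le_sum fun i _ => hstep i
      _ = ‖f 0‖ ^ 2 - ‖f n‖ ^ 2 := Finset.sum_range_sub' _ _
      _ ≤ ‖f 0‖ ^ 2 := by linarith [sq_nonneg ‖f n‖]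
  have h0 := hsum.tendsto_atTop_zero.sqrt
  simp only [Real.sqrt_zero, Real.sqrt_sq (norm_nonneg _)] at h0
  have h1 := tendsto_zero_iff_norm_tendsto_zero.2 h0
  refine h1.congr fun n => ?_
  exact congrArg (fun P : H →L[ℝ] H => P y)
    (((Commute.one_right _).sub_right (Commute.refl (invSqAddOne A))).pow_right n).eq

lemma tendsto_approxId (x : H) : Tendsto (fun n => approxId A n x) atTop (𝓝 x) := by
  simpa [approxId] using (tendsto_const_nhds (x := x)).sub (tendsto_one_sub_pow (A := A) x)

/-! ### The powers of `A₁` with negative exponent -/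

lemma commutesWith_negPow {α : ℝ} (hα : 0 ≤ α) : CommutesWith A (negPow A α) := by
  have h := summable_norm_choose_smul_pow (norm_invSqAddOne_sub_one_le (A := A))
    (show 0 ≤ α / 2 by positivity)
  exact CommutesWith.tsum hA.out.isClosed h.of_norm fun k =>
    ((CommutesWith.invSqAddOne.sub CommutesWith.one).pow k).smul _

lemma negPow_add {a b : ℝ} (ha : 0 ≤ a) (hb : 0 ≤ b) (x : H) :
    negPow A (a + b) x = negPow A a (negPow A b x) := by
  rw [negPow, add_div, contractionPow_add norm_invSqAddOne_sub_one_le (by positivity)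
    (by positivity)]
  rfl

lemma negPow_one_negPow_one (x : H) : negPow A 1 (negPow A 1 x) = invSqAddOne A x := by
  rw [← negPow_add zero_le_one zero_le_one, negPow,
    show ((1 : ℝ) + 1) / 2 = 1 by norm_num, contractionPow_one]

lemma negPow_symm {α : ℝ} (hα : 0 ≤ α) (x y : H) :
    ⟪negPow A α x, y⟫_ℝ = ⟪x, negPow A α y⟫_ℝ := by
  have h := (summable_norm_choose_smul_pow (norm_invSqAddOne_sub_one_le (A := A))
    (show 0 ≤ α / 2 by positivity)).of_norm.hasSum
  have h1 : ∀ x : H, HasSum (fun k => (Ring.choose (α / 2) k • (invSqAddOne A - 1) ^ k) x)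
      (negPow A α x) := fun x => h.mapL (ContinuousLinearMap.apply ℝ H x)
  have h2 := (h1 x).mapL (innerSL ℝ y)
  have h3 : HasSum _ ⟪x, negPow A α y⟫_ℝ := (h1 y).mapL (innerSL ℝ x)
  rw [real_inner_comm]
  refine h2.unique ?_
  refine h3.congr_fun ?_
  intro k
  -- The series is in powers of `T - I`, whereas symmetry is known for powers of `I - T`.
  have hk : ((invSqAddOne A - 1) ^ k) = (-1 : ℝ) ^ k • (1 - invSqAddOne A) ^ k := by
    rw [← neg_sub 1 (invSqAddOne A), neg_pow]
    rcases Nat.even_or_odd k with h | h <;> simp [h.neg_one_pow]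
  simp only [hk, innerSL_apply_apply, _root_.smul_apply, inner_smul_right]
  rw [← one_sub_pow_symm, real_inner_comm]

/-- With `y = A x`: `‖A₁⁻¹ y‖² = ⟪A x, T A x⟫ = ⟪x, A² T x⟫ = ⟪x, x - T x⟫ ≤ ‖x‖²`. -/
lemma norm_negPow_one_le {x y : H} (hxy : (x, y) ∈ A.graph) : ‖negPow A 1 y‖ ≤ ‖x‖ := by
  refine le_of_sq_le_sq ?_ (norm_nonneg _)
  have h1 := CommutesWith.invSqAddOne _ _ hxy
  have h2 := resL_mem (A := A) x
  rw [graph_unique (invSqAddOne_mem x) h1] at h2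
  rw [← real_inner_self_eq_norm_sq, negPow_symm zero_le_one, negPow_one_negPow_one,
    graph_symm hxy h2, inner_sub_right, real_inner_self_eq_norm_sq, real_inner_comm]
  nlinarith [norm_sq_invSqAddOne_le (A := A) x, sq_nonneg ‖invSqAddOne A x‖]

/-- By `norm_negPow_one_le`, the functional `z ↦ ⟪A₁⁻¹ x, A z⟫ = ⟪x, A₁⁻¹ A z⟫` is bounded by `‖x‖
‖z‖`, so `A₁⁻¹ x` lies in the domain of the adjoint, which is `D(A)`. The same bound, extended to
all `z` by density, controls `‖A A₁⁻¹ x‖`. -/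
lemma exists_negPow_one_mem_graph (x : H) : ∃ y, (negPow A 1 x, y) ∈ A.graph ∧ ‖y‖ ≤ ‖x‖ := by
  have hmem : negPow A 1 x ∈ (LinearPMap.adjoint A).domain := by
    rw [LinearPMap.mem_adjoint_domain_iff]
    refine AddMonoidHomClass.continuous_of_bound
      ((innerₛₗ ℝ (negPow A 1 x)).comp A.toFun) ‖x‖ fun z => ?_
    change |⟪negPow A 1 x, A z⟫_ℝ| ≤ ‖x‖ * ‖(z : H)‖
    rw [negPow_symm zero_le_one]
    exact (abs_real_inner_le_norm _ _).trans
      (mul_le_mul_of_nonneg_left (norm_negPow_one_le (A.mem_graph z)) (norm_nonneg _))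
  rw [LinearPMap.isSelfAdjoint_def.1 hA.out] at hmem
  refine ⟨A ⟨_, hmem⟩, A.mem_graph ⟨_, hmem⟩, ?_⟩
  set y := A ⟨_, hmem⟩
  have hy : (negPow A 1 x, y) ∈ A.graph := A.mem_graph ⟨_, hmem⟩
  have key : ∀ z : H, |⟪y, z⟫_ℝ| ≤ ‖x‖ * ‖z‖ := by
    refine fun z => hA.out.dense_domain.induction (P := fun z => |⟪y, z⟫_ℝ| ≤ ‖x‖ * ‖z‖) ?_ ?_ z
    · intro z hz
      rw [graph_symm hy (A.mem_graph ⟨z, hz⟩), negPow_symm zero_le_one]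
      exact (abs_real_inner_le_norm _ _).trans
        (mul_le_mul_of_nonneg_left (norm_negPow_one_le (A.mem_graph ⟨z, hz⟩)) (norm_nonneg _))
    · exact isClosed_le (by fun_prop) (by fun_prop)
  have h := key y
  rw [real_inner_self_eq_norm_sq, abs_of_nonneg (sq_nonneg _), sq] at h
  rcases (norm_nonneg y).eq_or_lt with h0 | h0
  · rw [← h0]; exact norm_nonneg _
  · exact le_of_mul_le_mul_right h h0

/-- The bounded operator `A A₁⁻¹`. -/
lemma exists_opNegPowOne : ∃ D : H →L[ℝ] H, ∀ x, (negPow A 1 x, D x) ∈ A.graph := by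
  choose d hd hd' using exists_negPow_one_mem_graph (A := A)
  let D : H →ₗ[ℝ] H :=
    { toFun := d
      map_add' := fun x y => graph_unique (hd _) (by
        rw [map_add]; exact A.graph.add_mem (hd x) (hd y))
      map_smul' := fun c x => graph_unique (hd _) (by
        rw [map_smul]; exact A.graph.smul_mem c (hd x)) }
  exact ⟨D.mkContinuous 1 fun x => by rw [one_mul]; exact hd' x, hd⟩

/-- The operator `A₁` is bounded from `D(A)` to `H`. -/
lemma exists_negPowOne_inverse :
    ∃ V : graphDom A →L[ℝ] H, ∀ p, negPow A 1 (V p) = inclL A p := by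
  obtain ⟨D, hD⟩ := exists_opNegPowOne (A := A)
  -- Here `A₁ = (A² + I) A₁⁻¹` is written as `(A A₁⁻¹) A + A₁⁻¹`; applying `A₁⁻¹` gives `A² T + T =
  -- I`.
  refine ⟨D.comp (opL A) + (negPow A 1).comp (inclL A), fun p => ?_⟩
  change negPow A 1 (D (opL A p) + negPow A 1 (inclL A p)) = _
  rw [map_add, negPow_one_negPow_one]
  have h1 := commutesWith_negPow zero_le_one _ _ (hD (opL A p))
  rw [negPow_one_negPow_one] at h1
  have h2 := resL_mem (A := A) (inclL A p)
  rw [graph_unique (invSqAddOne_mem _) (CommutesWith.invSqAddOne _ _ (graphDom_mem p))] at h2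
  rw [graph_unique h1 h2, sub_add_cancel]

end FractionalPowers

section WaveOperator

/-! ### Groups generated by bounded operators -/

section BoundedFlow

variable {X : Type*} [NormedAddCommGroup X] [InnerProductSpace ℝ X]

/-- The group `t ↦ exp (t B)` of a bounded operator `B`. -/
def flow (B : X →L[ℝ] X) (t : ℝ) : X →L[ℝ] X := NormedSpace.exp (t • B)

@[simp] lemma flow_zero (B : X →L[ℝ] X) : flow B 0 = 1 := by
  rw [flow, zero_smul, NormedSpace.exp_zero]

@[simp] lemma flow_zero_left (t : ℝ) : flow (0 : X →L[ℝ] X) t = 1 := by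
  rw [flow, smul_zero, NormedSpace.exp_zero]

lemma Commute.flow {B P : X →L[ℝ] X} (h : Commute P B) (t : ℝ) : Commute P (flow B t) :=
  (h.smul_right t).exp_right

variable [CompleteSpace X]

lemma flow_add (B : X →L[ℝ] X) (s t : ℝ) : flow B (s + t) = flow B s * flow B t := by
  let := NormedAlgebra.restrictScalars ℚ ℝ (X →L[ℝ] X)
  rw [flow, add_smul]
  exact NormedSpace.exp_add_of_commute (((Commute.refl B).smul_left s).smul_right t)

lemma flow_neg_apply (B : X →L[ℝ] X) (t : ℝ) (x : X) : flow B t (flow B (-t) x) = x := by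
  have h := flow_add B t (-t)
  rw [add_neg_cancel, flow_zero] at h
  exact (congrArg (fun P : X →L[ℝ] X => P x) h).symm

lemma hasDerivAt_flow (B : X →L[ℝ] X) (t : ℝ) : HasDerivAt (flow B) (flow B t * B) t :=
  hasDerivAt_exp_smul_const B t

lemma hasDerivAt_flow' (B : X →L[ℝ] X) (t : ℝ) : HasDerivAt (flow B) (B * flow B t) t :=
  hasDerivAt_exp_smul_const' B t

lemma continuous_flow (B : X →L[ℝ] X) : Continuous (flow B) :=
  continuous_iff_continuousAt.2 fun t => (hasDerivAt_flow B t).continuousAt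

lemma hasDerivAt_flow_apply (B : X →L[ℝ] X) (x : X) (t : ℝ) :
    HasDerivAt (fun s => flow B s x) (B (flow B t x)) t := by
  simpa using (hasDerivAt_flow' B t).clm_apply (hasDerivAt_const t x)

/-- The derivative of `‖flow B s x‖²` is `2⟪B ·, ·⟫`, so the weights `exp (∓2 s)` make it monotone.
Only the quadratic form enters and not `‖B‖`, hence the bound is uniform in the approximations `Bₙ`.
-/
lemma norm_flow_apply_le {B : X →L[ℝ] X} (hB : ∀ z, |⟪B z, z⟫_ℝ| ≤ ‖z‖ ^ 2) (t : ℝ) (x : X) :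
    ‖flow B t x‖ ≤ Real.exp |t| * ‖x‖ := by
  have hd : ∀ c s : ℝ, HasDerivAt (fun s => Real.exp (c * s) * ‖flow B s x‖ ^ 2)
      (Real.exp (c * s) * (c * ‖flow B s x‖ ^ 2 + 2 * ⟪B (flow B s x), flow B s x⟫_ℝ)) s := by
    intro c s
    have h1 := (hasDerivAt_flow_apply B x s).norm_sq
    have h2 := ((hasDerivAt_id s).const_mul c).exp
    convert! h2.mul h1 using 1
    rw [real_inner_comm]
    simp only [id, mul_one]
    ring
  have key : ‖flow B t x‖ ^ 2 ≤ (Real.exp |t| * ‖x‖) ^ 2 := by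
    have hxp : (Real.exp |t| * ‖x‖) ^ 2 = Real.exp (2 * |t|) * ‖x‖ ^ 2 := by
      rw [mul_pow, ← Real.exp_nat_mul]; norm_num
    rw [hxp]
    rcases le_total 0 t with ht | ht
    · have hanti : Antitone fun s => Real.exp (-2 * s) * ‖flow B s x‖ ^ 2 :=
        antitone_of_hasDerivAt_nonpos (hd (-2)) fun s =>
          mul_nonpos_of_nonneg_of_nonpos (Real.exp_pos _).le
            (by linarith [(abs_le.1 (hB (flow B s x))).2])
      have h := hanti ht
      simp only [mul_zero, Real.exp_zero, one_mul, flow_zero, one_apply_eq_self] at h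
      rw [abs_of_nonneg ht]
      calc ‖flow B t x‖ ^ 2 = Real.exp (2 * t) * (Real.exp (-2 * t) * ‖flow B t x‖ ^ 2) := by
            rw [← mul_assoc, ← Real.exp_add]; simp
        _ ≤ _ := mul_le_mul_of_nonneg_left h (Real.exp_pos _).le
    · have hmono : Monotone fun s => Real.exp (2 * s) * ‖flow B s x‖ ^ 2 :=
        monotone_of_hasDerivAt_nonneg (hd 2) fun s =>
          mul_nonneg (Real.exp_pos _).le
            (by linarith [(abs_le.1 (hB (flow B s x))).1])
      have h := hmono ht
      simp only [mul_zero, Real.exp_zero, one_mul, flow_zero, one_apply_eq_self] at h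
      rw [abs_of_nonpos ht]
      calc ‖flow B t x‖ ^ 2 = Real.exp (2 * -t) * (Real.exp (2 * t) * ‖flow B t x‖ ^ 2) := by
            rw [← mul_assoc, ← Real.exp_add]; simp
        _ ≤ _ := mul_le_mul_of_nonneg_left h (Real.exp_pos _).le
  exact le_of_sq_le_sq key (by positivity)

/-- The path `s ↦ flow B' (t - s) (flow B s x)` joins the two vectors. By commutation its derivative
is the product of the flows applied to `B x - B' x`. -/
lemma norm_flow_sub_flow_le {B B' : X →L[ℝ] X} (hB : ∀ z, |⟪B z, z⟫_ℝ| ≤ ‖z‖ ^ 2)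
    (hB' : ∀ z, |⟪B' z, z⟫_ℝ| ≤ ‖z‖ ^ 2) (hc : Commute B B') (t : ℝ) (x : X) :
    ‖flow B t x - flow B' t x‖ ≤ Real.exp (2 * |t|) * ‖B x - B' x‖ * |t| := by
  have hd : ∀ s, HasDerivAt (fun s => flow B' (t - s) (flow B s x))
      (flow B' (t - s) (flow B s (B x - B' x))) s := by
    intro s
    have h1 : HasDerivAt (fun s => flow B' (t - s)) (-(flow B' (t - s) * B')) s := by
      simpa using! (hasDerivAt_flow B' (t - s)).scomp s ((hasDerivAt_id s).const_sub t)
    have h2 := h1.clm_apply (hasDerivAt_flow_apply B x s)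
    have e1 : B (flow B s x) = flow B s (B x) :=
      congrArg (fun P : X →L[ℝ] X => P x) (Commute.flow (Commute.refl B) s).eq
    have e2 : B' (flow B s x) = flow B s (B' x) :=
      congrArg (fun P : X →L[ℝ] X => P x) (Commute.flow hc.symm s).eq
    convert! h2 using 1
    change _ = -(flow B' (t - s) (B' (flow B s x))) + _
    rw [e1, e2, map_sub, map_sub]
    abel
  have hb : ∀ s ∈ uIcc 0 t, ‖flow B' (t - s) (flow B s (B x - B' x))‖
      ≤ Real.exp (2 * |t|) * ‖B x - B' x‖ := by
    intro s hs
    have h1 : |t - s| ≤ |t| := by simpa using abs_sub_right_of_mem_uIcc hs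
    have h2 : |s| ≤ |t| := by simpa using abs_sub_left_of_mem_uIcc hs
    calc _ ≤ Real.exp |t - s| * (Real.exp |s| * ‖B x - B' x‖) :=
          (norm_flow_apply_le hB' _ _).trans
            (mul_le_mul_of_nonneg_left (norm_flow_apply_le hB _ _) (Real.exp_pos _).le)
      _ ≤ Real.exp |t| * (Real.exp |t| * ‖B x - B' x‖) := by gcongr
      _ = _ := by rw [← mul_assoc, ← Real.exp_add, two_mul]
  have h := (convex_uIcc 0 t).norm_image_sub_le_of_norm_hasDerivWithin_le
    (fun s _ => (hd s).hasDerivWithinAt) hb left_mem_uIcc right_mem_uIcc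
  simpa using h

/-- Differentiate `flow B (-s) (x s)` and replace `B x` by `R y`: if `R` is close to the identity,
the path stays close to `x 0`, whatever the size of `B`. -/
lemma flow_neg_sub_eq_integral {B R : X →L[ℝ] X} {x y : ℝ → X} (hx : ∀ s, HasDerivAt x (y s) s)
    (hy : Continuous y) (h : ∀ s, B (x s) = R (y s)) (t : ℝ) :
    flow B (-t) (x t) - x 0 = ∫ s in (0 : ℝ)..t, flow B (-s) (y s - R (y s)) := by
  have hd : ∀ s ∈ uIcc 0 t, HasDerivAt (fun s => flow B (-s) (x s))
      (flow B (-s) (y s - R (y s))) s := fun s _ => by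
    have e1 : HasDerivAt (fun s => flow B (-s)) (-(flow B (-s) * B)) s := by
      simpa using! (hasDerivAt_flow B (-s)).scomp s (hasDerivAt_neg s)
    convert! e1.clm_apply (hx s) using 1
    change _ = -(flow B (-s) (B (x s))) + _
    rw [h, map_sub]
    abel
  have hc : Continuous fun s => flow B (-s) (y s - R (y s)) :=
    ((continuous_flow _).comp continuous_neg).clm_apply (hy.sub (R.continuous.comp hy))
  rw [intervalIntegral.integral_eq_sub_of_hasDerivAt hd (hc.intervalIntegrable _ _)]
  simp

/-- Meant for an orbit `x` of an arbitrary group generated by the wave operator: it shows that the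
approximate flows undo this orbit in the limit. -/
lemma tendsto_flow_neg {B R : ℕ → X →L[ℝ] X} {x y : ℝ → X} (hx : ∀ s, HasDerivAt x (y s) s)
    (hy : Continuous y) (h : ∀ n s, B n (x s) = R n (y s))
    (hB : ∀ n z, |⟪B n z, z⟫_ℝ| ≤ ‖z‖ ^ 2) (hR : ∀ n z, ‖R n z‖ ≤ 2 * ‖z‖)
    (hR' : ∀ z, Tendsto (fun n => R n z) atTop (𝓝 z)) (t : ℝ) :
    Tendsto (fun n => flow (B n) (-t) (x t)) atTop (𝓝 (x 0)) := by
  have h2 : Tendsto (fun n => flow (B n) (-t) (x t) - x 0) atTop (𝓝 0) := by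
    simp only [fun n => flow_neg_sub_eq_integral hx hy (h n) t]
    have h0 : ∫ s in (0 : ℝ)..t, (0 : X) = 0 := by simp
    rw [← h0]
    refine intervalIntegral.tendsto_integral_filter_of_dominated_convergence
      (fun s => Real.exp |s| * (3 * ‖y s‖)) ?_ ?_ ?_ ?_
    · exact Eventually.of_forall fun n => (((continuous_flow _).comp continuous_neg).clm_apply
        (hy.sub ((R n).continuous.comp hy))).aestronglyMeasurable
    · refine Eventually.of_forall fun n => ae_of_all _ fun s _ => ?_
      refine (norm_flow_apply_le (hB n) (-s) _).trans ?_
      rw [abs_neg]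
      gcongr
      refine (norm_sub_le _ _).trans ?_
      linarith [hR n (y s)]
    · exact Continuous.intervalIntegrable (by fun_prop) _ _
    · refine ae_of_all _ fun s _ => ?_
      refine squeeze_zero_norm (fun n => norm_flow_apply_le (hB n) (-s) _) ?_
      have := ((hR' (y s)).const_sub (y s)).norm.const_mul (Real.exp |-s|)
      simpa using this
  simpa using h2.add_const (x 0)

end BoundedFlow

/-! ### Yosida approximations of the wave operator -/

variable {H : Type*} [NormedAddCommGroup H] [InnerProductSpace ℝ H] {A : H →ₗ.[ℝ] H}

/-- The condition `vel z ∈ D(A)` need not be listed, since `pos w` always lies in `D(A)`. -/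
lemma mem_graph_waveOp {z w : PhaseSpace A} :
    (z, w) ∈ (waveOp A).graph ↔ pos w = vel z ∧ (opPos z, -vel w) ∈ A.graph := by
  rw [LinearPMap.mem_graph_iff]
  constructor
  · rintro ⟨y, rfl, rfl⟩
    refine ⟨rfl, ?_⟩
    have : -vel ((waveOp A) y) = A ⟨opPos (y : PhaseSpace A), y.2.1⟩ := neg_neg _
    rw [this]
    exact A.mem_graph ⟨opPos (y : PhaseSpace A), y.2.1⟩
  · rintro ⟨h1, h2⟩
    have hz : z ∈ (waveOp A).domain :=
      ⟨LinearPMap.mem_domain_of_mem_graph h2, h1 ▸ pos_mem_domain w⟩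
    refine ⟨⟨z, hz⟩, rfl, phase_ext h1.symm ?_⟩
    change -A ⟨opPos z, hz.1⟩ = vel w
    rw [graph_unique (A.mem_graph ⟨opPos z, hz.1⟩) h2, neg_neg]

lemma tendsto_phase {ι : Type*} {l : Filter ι} {f : ι → PhaseSpace A} {z : PhaseSpace A}
    (h1 : Tendsto (fun i => pos (f i)) l (𝓝 (pos z)))
    (h2 : Tendsto (fun i => opPos (f i)) l (𝓝 (opPos z)))
    (h3 : Tendsto (fun i => vel (f i)) l (𝓝 (vel z))) : Tendsto f l (𝓝 z) := by
  rw [tendsto_iff_norm_sub_tendsto_zero] at h1 h2 h3 ⊢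
  have h := ((h1.pow 2).add (h2.pow 2)).add (h3.pow 2)
  have h' := h.sqrt
  simp only [← pos_sub, ← opPos_sub, ← vel_sub, ← norm_sq_phase, Real.sqrt_sq (norm_nonneg _)] at h'
  simpa using h'

lemma invSqAddOne_neumannSum' (n : ℕ) (x : H) :
    neumannSum A n (invSqAddOne A x) = approxId A n x := by
  rw [← invSqAddOne_neumannSum]
  exact congrArg (fun P : H →L[ℝ] H => P x) (commute_invSqAddOne_neumannSum n).symm.eq

variable [CompleteSpace H] [hA : Fact (IsSelfAdjoint A)]

lemma isClosed_waveOp : (waveOp A).IsClosed := by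
  have : ((waveOp A).graph : Set (PhaseSpace A × PhaseSpace A))
      = {p | pos p.2 = vel p.1} ∩ (fun p => (opPos p.1, -vel p.2)) ⁻¹' A.graph :=
    Set.ext fun ⟨_, _⟩ => mem_graph_waveOp
  rw [LinearPMap.IsClosed, this]
  refine IsClosed.inter (isClosed_eq (continuous_pos.comp continuous_snd)
    (continuous_vel.comp continuous_fst)) (hA.out.isClosed.preimage ?_)
  exact (continuous_opPos.comp continuous_fst).prodMk (continuous_vel.comp continuous_snd).neg

variable (A) in
/-- The bounded approximation `(u, v) ↦ (Rₙ v, -A² Rₙ u)` of the wave operator, where `Rₙ` is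
`approxId A n`. -/
def waveApprox (n : ℕ) : PhaseSpace A →L[ℝ] PhaseSpace A :=
  (mkL A).comp (((resL A).comp ((neumannSum A n).comp (velL A))).prod
    (-((1 - invSqAddOne A).comp ((neumannSum A n).comp (posL A)))))

lemma pos_waveApprox (n : ℕ) (z : PhaseSpace A) :
    pos (waveApprox A n z) = approxId A n (vel z) :=
  (inclL_resL _).trans (invSqAddOne_neumannSum _ _)

lemma vel_waveApprox (n : ℕ) (z : PhaseSpace A) :
    vel (waveApprox A n z) = -(neumannSum A n (pos z) - approxId A n (pos z)) := by
  rw [← invSqAddOne_neumannSum]; rfl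

variable (A) in
/-- The operator `Rₙ`, acting on both components of the phase space. -/
def phaseApproxId (n : ℕ) : PhaseSpace A →L[ℝ] PhaseSpace A :=
  phaseMap (approxId A n) (commutesWith_approxId n)

lemma norm_phaseApproxId_apply_le (n : ℕ) (z : PhaseSpace A) :
    ‖phaseApproxId A n z‖ ≤ 2 * ‖z‖ :=
  norm_phaseMap_le _ zero_le_two (norm_approxId_apply_le n) z

lemma tendsto_phaseApproxId (z : PhaseSpace A) :
    Tendsto (fun n => phaseApproxId A n z) atTop (𝓝 z) :=
  tendsto_phase (tendsto_approxId _) (tendsto_approxId _) (tendsto_approxId _)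

/-- This is `Bₙ = Rₙ 𝒜` on `D(𝒜)`. If `w = 𝒜 z`, then `T (pos z - vel w) = pos z`, and the Neumann
sum turns `T` into `Rₙ`. -/
lemma waveApprox_eq {z w : PhaseSpace A} (h : (z, w) ∈ (waveOp A).graph) (n : ℕ) :
    waveApprox A n z = phaseApproxId A n w := by
  obtain ⟨h1, h2⟩ := mem_graph_waveOp.1 h
  refine phase_ext ?_ ?_
  · rw [pos_waveApprox, ← h1]; rfl
  · rw [vel_waveApprox]
    change _ = approxId A n (vel w)
    have h3 : invSqAddOne A (pos z + -vel w) = pos z :=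
      invSqAddOne_eq (phase_mem_graph z) (by rwa [add_sub_cancel_left])
    have h4 := congrArg (neumannSum A n) h3
    rw [map_add, map_neg, map_add, map_neg, invSqAddOne_neumannSum', invSqAddOne_neumannSum'] at h4
    rw [← h4]
    abel

/-- This is `Bₙ = 𝒜 Rₙ` on the whole phase space; in particular `Rₙ` maps into `D(𝒜)`. -/
lemma phaseApproxId_mem_graph (n : ℕ) (z : PhaseSpace A) :
    (phaseApproxId A n z, waveApprox A n z) ∈ (waveOp A).graph := by
  refine mem_graph_waveOp.2 ⟨pos_waveApprox n z, ?_⟩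
  rw [vel_waveApprox, neg_neg]
  have h1 := commutesWith_approxId n _ _ (phase_mem_graph z)
  have h2 := invSqAddOne_mem (A := A) (neumannSum A n (pos z))
  rw [invSqAddOne_neumannSum] at h2
  have h3 := resL_mem (A := A) (neumannSum A n (pos z))
  rw [graph_unique h2 h1, invSqAddOne_neumannSum] at h3
  exact h3

lemma commute_waveApprox_phaseMap {P : H →L[ℝ] H} (hP : CommutesWith A P) (n : ℕ) :
    Commute (phaseMap P hP) (waveApprox A n) := by
  have h0 := commute_invSqAddOne_of_commutesWith hP
  have h1 : ∀ x, P (neumannSum A n x) = neumannSum A n (P x) := fun x =>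
    congrArg (fun Q : H →L[ℝ] H => Q x) (commute_neumannSum h0 n).symm.eq
  have h2 : ∀ x, P (invSqAddOne A x) = invSqAddOne A (P x) := fun x =>
    congrArg (fun Q : H →L[ℝ] H => Q x) h0.symm.eq
  refine ContinuousLinearMap.ext fun z => phase_ext ?_ ?_
  · change P (pos (waveApprox A n z)) = pos (waveApprox A n (phaseMap P hP z))
    rw [pos_waveApprox, pos_waveApprox, vel_phaseMap, ← invSqAddOne_neumannSum,
      ← invSqAddOne_neumannSum, h2, h1]
  · change P (vel (waveApprox A n z)) = vel (waveApprox A n (phaseMap P hP z))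
    rw [vel_waveApprox, vel_waveApprox, pos_phaseMap, ← h1, ← invSqAddOne_neumannSum,
      ← invSqAddOne_neumannSum, ← h1, ← h2, map_neg, map_sub]

lemma commute_waveApprox (n m : ℕ) : Commute (waveApprox A n) (waveApprox A m) := by
  have h0 : ∀ x, neumannSum A n (neumannSum A m x) = neumannSum A m (neumannSum A n x) := fun x =>
    congrArg (fun Q : H →L[ℝ] H => Q x)
      (commute_neumannSum (commute_invSqAddOne_neumannSum m) n).eq
  have h1 : ∀ x, approxId A n (neumannSum A m x) = approxId A m (neumannSum A n x) := fun x => by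
    rw [← invSqAddOne_neumannSum, ← invSqAddOne_neumannSum, h0]
  have h2 : ∀ k l x, neumannSum A k (approxId A l x) = approxId A k (neumannSum A l x) :=
    fun k l x => by rw [← invSqAddOne_neumannSum, invSqAddOne_neumannSum']
  have h3 : ∀ x, approxId A n (approxId A m x) = approxId A m (approxId A n x) := fun x =>
    congrArg (fun Q : H →L[ℝ] H => Q x)
      ((Commute.one_left _).sub_left ((Commute.one_right _).sub_right
        (Commute.pow_pow_self (1 - invSqAddOne A) n m))).eq
  refine ContinuousLinearMap.ext fun z => phase_ext ?_ ?_
  · change pos (waveApprox A n (waveApprox A m z)) = pos (waveApprox A m (waveApprox A n z))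
    simp only [pos_waveApprox, vel_waveApprox, map_neg, map_sub, h1, h3]
  · change vel (waveApprox A n (waveApprox A m z)) = vel (waveApprox A m (waveApprox A n z))
    simp only [pos_waveApprox, vel_waveApprox, h2, h1, h3]

/-- The energy part of the form is skew and cancels. What remains comes from the term `‖u‖²` of the
phase norm. -/
lemma inner_waveApprox (n : ℕ) (z : PhaseSpace A) :
    ⟪waveApprox A n z, z⟫_ℝ = ⟪approxId A n (pos z), vel z⟫_ℝ := by
  have h := inner_resL (A := A) (neumannSum A n (vel z)) (fstL A z)
  rw [inner_graphDom] at h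
  rw [inner_phase]
  change _ + _ + ⟪-(neumannSum A n (pos z) - invSqAddOne A (neumannSum A n (pos z))), vel z⟫_ℝ = _
  rw [invSqAddOne_neumannSum, inner_neg_left, inner_sub_left]
  have h2 : ⟪neumannSum A n (vel z), pos z⟫_ℝ = ⟪neumannSum A n (pos z), vel z⟫_ℝ := by
    rw [neumannSum_symm, real_inner_comm]
  have h3 : ⟪pos (waveApprox A n z), pos z⟫_ℝ + ⟪opPos (waveApprox A n z), opPos z⟫_ℝ
    = ⟪neumannSum A n (vel z), pos z⟫_ℝ := h
  linarith

lemma abs_inner_waveApprox_le (n : ℕ) (z : PhaseSpace A) :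
    |⟪waveApprox A n z, z⟫_ℝ| ≤ ‖z‖ ^ 2 := by
  rw [inner_waveApprox]
  refine (abs_real_inner_le_norm _ _).trans ?_
  have h1 := mul_le_mul_of_nonneg_right (norm_approxId_apply_le (A := A) n (pos z))
    (norm_nonneg (vel z))
  have h2 := norm_sq_phase z
  nlinarith [sq_nonneg (‖pos z‖ - ‖vel z‖), sq_nonneg ‖opPos z‖]

end WaveOperator

section WaveGroup

/-! ### The wave group -/

variable {H : Type*} [NormedAddCommGroup H] [InnerProductSpace ℝ H] {A : H →ₗ.[ℝ] H}

/-! Shortcuts for instance search. -/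

instance : NormedAddCommGroup (PhaseSpace A) := inferInstance
instance : InnerProductSpace ℝ (PhaseSpace A) := inferInstance
instance : NormedSpace ℝ (PhaseSpace A) := InnerProductSpace.toNormedSpace
instance : T2Space (PhaseSpace A) := TopologicalSpace.t2Space_of_metrizableSpace
instance : TopologicalSpace.PseudoMetrizableSpace (PhaseSpace A) :=
  PseudoEMetricSpace.pseudoMetrizableSpace
instance : SecondCountableTopologyEither ℝ (PhaseSpace A) := secondCountableTopologyEither_of_left _ _

variable [CompleteSpace H] [hA : Fact (IsSelfAdjoint A)]

variable (A) in
/-- The group generated by the bounded approximation `waveApprox A n` of the wave operator. -/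
def approxFlow (n : ℕ) (t : ℝ) : PhaseSpace A →L[ℝ] PhaseSpace A := flow (waveApprox A n) t

lemma norm_approxFlow_apply_le (n : ℕ) (t : ℝ) (z : PhaseSpace A) :
    ‖approxFlow A n t z‖ ≤ Real.exp |t| * ‖z‖ :=
  norm_flow_apply_le (abs_inner_waveApprox_le n) t z

lemma continuous_approxFlow_apply (n : ℕ) (z : PhaseSpace A) :
    Continuous fun t => approxFlow A n t z :=
  (continuous_flow _).clm_apply continuous_const

lemma tendsto_waveApprox {z w : PhaseSpace A} (h : (z, w) ∈ (waveOp A).graph) :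
    Tendsto (fun n => waveApprox A n z) atTop (𝓝 w) :=
  (tendsto_phaseApproxId w).congr fun n => (waveApprox_eq h n).symm

lemma dense_waveOp : Dense {z : PhaseSpace A | ∃ w, (z, w) ∈ (waveOp A).graph} := fun z =>
  mem_closure_of_tendsto (tendsto_phaseApproxId z)
    (Eventually.of_forall fun n => ⟨_, phaseApproxId_mem_graph n z⟩)

/-- On `D(𝒜)` the sequence `Bₙ z` converges, so `norm_flow_sub_flow_le` makes the flows a Cauchy
sequence; the uniform bound extends this to all `z`. -/
lemma exists_waveGroup (t : ℝ) : ∃ S : PhaseSpace A →L[ℝ] PhaseSpace A,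
    ∀ z, Tendsto (fun n => approxFlow A n t z) atTop (𝓝 (S z)) := by
  refine exists_tendsto_apply_of_dense (C := Real.exp |t|)
    (fun n z => norm_approxFlow_apply_le n t z) dense_waveOp ?_
  rintro z ⟨w, hzw⟩
  have hc := (tendsto_waveApprox hzw).cauchySeq
  rw [Metric.cauchySeq_iff'] at hc ⊢
  intro ε hε
  -- The summand `1` only ensures `K > 0`, also for `t = 0`.
  set K := Real.exp (2 * |t|) * |t| + 1
  have hK : 0 < K := by positivity
  obtain ⟨N, hN⟩ := hc (ε / K) (by positivity)
  refine ⟨N, fun n hn => ?_⟩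
  have h1 := hN n hn
  rw [dist_eq_norm, lt_div_iff₀ hK] at h1
  rw [dist_eq_norm]
  have h2 : ‖approxFlow A n t z - approxFlow A N t z‖ ≤ _ :=
    norm_flow_sub_flow_le (abs_inner_waveApprox_le n) (abs_inner_waveApprox_le N)
      (commute_waveApprox n N) t z
  nlinarith [norm_nonneg (waveApprox A n z - waveApprox A N z)]

variable (A) in
/-- The `C₀` group generated by the wave operator. -/
def waveGroup (t : ℝ) : PhaseSpace A →L[ℝ] PhaseSpace A := (exists_waveGroup t).choose

lemma tendsto_approxFlow (t : ℝ) (z : PhaseSpace A) :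
    Tendsto (fun n => approxFlow A n t z) atTop (𝓝 (waveGroup A t z)) :=
  (exists_waveGroup t).choose_spec z

lemma norm_waveGroup_apply_le (t : ℝ) (z : PhaseSpace A) :
    ‖waveGroup A t z‖ ≤ Real.exp |t| * ‖z‖ :=
  le_of_tendsto (tendsto_approxFlow t z).norm
    (Eventually.of_forall fun n => norm_approxFlow_apply_le n t z)

lemma tendsto_approxFlow_apply (t : ℝ) {f : ℕ → PhaseSpace A} {z : PhaseSpace A}
    (hf : Tendsto f atTop (𝓝 z)) :
    Tendsto (fun n => approxFlow A n t (f n)) atTop (𝓝 (waveGroup A t z)) := by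
  have h1 : Tendsto (fun n => approxFlow A n t (f n - z)) atTop (𝓝 0) := by
    refine squeeze_zero_norm (fun n => norm_approxFlow_apply_le n t _) ?_
    simpa using (tendsto_iff_norm_sub_tendsto_zero.1 hf).const_mul (Real.exp |t|)
  simpa using h1.add (tendsto_approxFlow t z)

lemma waveGroup_zero : waveGroup A 0 = ContinuousLinearMap.id ℝ (PhaseSpace A) := by
  refine ContinuousLinearMap.ext fun z => tendsto_nhds_unique (tendsto_approxFlow 0 z) ?_
  simp only [approxFlow, flow_zero]
  exact tendsto_const_nhds

lemma waveGroup_add (s t : ℝ) :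
    waveGroup A (s + t) = (waveGroup A s).comp (waveGroup A t) := by
  refine ContinuousLinearMap.ext fun z => tendsto_nhds_unique (tendsto_approxFlow (s + t) z) ?_
  simp only [approxFlow, flow_add]
  exact tendsto_approxFlow_apply s (tendsto_approxFlow t z)

lemma waveGroup_add_apply (s t : ℝ) (z : PhaseSpace A) :
    waveGroup A (s + t) z = waveGroup A s (waveGroup A t z) := by
  rw [waveGroup_add]; rfl

lemma waveGroup_neg_apply (t : ℝ) (z : PhaseSpace A) :
    waveGroup A t (waveGroup A (-t) z) = z := by
  rw [← waveGroup_add_apply, add_neg_cancel, waveGroup_zero]; rfl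

lemma tendsto_waveGroup_zero (z : PhaseSpace A) :
    Tendsto (fun t => waveGroup A t z) (𝓝 0) (𝓝 z) := by
  refine tendsto_apply_of_dense (g := ContinuousLinearMap.id ℝ _) (C := Real.exp 1)
    ?_ dense_waveOp ?_ z
  · filter_upwards [Metric.ball_mem_nhds (0 : ℝ) one_pos] with t ht z
    refine (norm_waveGroup_apply_le t z).trans ?_
    rw [Metric.mem_ball, dist_zero_right, Real.norm_eq_abs] at ht
    gcongr
  · rintro z ⟨w, hzw⟩
    have h : ∀ t, ‖waveGroup A t z - z‖ ≤ Real.exp (2 * |t|) * ‖w‖ * |t| := fun t => by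
      refine le_of_tendsto_of_tendsto ((tendsto_approxFlow t z).sub_const z).norm
        (((tendsto_waveApprox hzw).norm.const_mul _).mul_const _) (Eventually.of_forall fun n => ?_)
      -- Comparison with the flow of the zero operator, which is the identity.
      simpa using! norm_flow_sub_flow_le (abs_inner_waveApprox_le n) (B' := 0)
        (fun z => by simp) (Commute.zero_right _) t z
    refine tendsto_iff_norm_sub_tendsto_zero.2 (squeeze_zero (fun _ => norm_nonneg _) h ?_)
    have hc : Continuous fun t : ℝ => Real.exp (2 * |t|) * ‖w‖ * |t| := by fun_prop
    simpa using hc.tendsto 0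

lemma continuous_waveGroup_apply (z : PhaseSpace A) : Continuous fun t => waveGroup A t z := by
  refine continuous_iff_continuousAt.2 fun t => ?_
  have h1 : Tendsto (fun s : ℝ => s - t) (𝓝 t) (𝓝 0) := by
    simpa using (continuous_sub_right t).tendsto t
  have h2 := ((waveGroup A t).continuous.tendsto z).comp ((tendsto_waveGroup_zero z).comp h1)
  refine h2.congr fun s => ?_
  change waveGroup A t (waveGroup A (s - t) z) = _
  rw [← waveGroup_add_apply, add_sub_cancel]

lemma isC0Group_waveGroup : IsC0Group (waveGroup A) :=
  ⟨waveGroup_zero, waveGroup_add, continuous_waveGroup_apply⟩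

/-- The wave group is jointly continuous. -/
lemma continuous_waveGroup : Continuous fun p : ℝ × PhaseSpace A => waveGroup A p.1 p.2 := by
  refine continuous_iff_continuousAt.2 fun ⟨t, z⟩ => ?_
  have h1 : Tendsto (fun p : ℝ × PhaseSpace A => waveGroup A p.1 (p.2 - z)) (𝓝 (t, z)) (𝓝 0) := by
    refine squeeze_zero_norm (fun p => norm_waveGroup_apply_le p.1 _) ?_
    have hc : Continuous fun p : ℝ × PhaseSpace A => Real.exp |p.1| * ‖p.2 - z‖ := by fun_prop
    simpa using hc.tendsto (t, z)
  have h2 := ((continuous_waveGroup_apply z).comp continuous_fst).tendsto (t, z)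
  simpa [ContinuousAt] using! h1.add h2

lemma commute_waveGroup {P : H →L[ℝ] H} (hP : CommutesWith A P) (t : ℝ) (z : PhaseSpace A) :
    phaseMap P hP (waveGroup A t z) = waveGroup A t (phaseMap P hP z) := by
  refine tendsto_nhds_unique (((phaseMap P hP).continuous.tendsto _).comp (tendsto_approxFlow t z))
    ((tendsto_approxFlow t _).congr fun n => ?_)
  exact (congrArg (fun Q : PhaseSpace A →L[ℝ] PhaseSpace A => Q z)
    (Commute.flow (commute_waveApprox_phaseMap hP n) t).eq).symm

lemma waveGroup_sub_eq_integral {z w : PhaseSpace A} (h : (z, w) ∈ (waveOp A).graph) (t : ℝ) :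
    waveGroup A t z - z = ∫ s in (0 : ℝ)..t, waveGroup A s w := by
  have h1 : ∀ n, approxFlow A n t z - z
      = ∫ s in (0 : ℝ)..t, approxFlow A n s (waveApprox A n z) := fun n => by
    have hd : ∀ s ∈ uIcc 0 t, HasDerivAt (fun s => approxFlow A n s z)
        (approxFlow A n s (waveApprox A n z)) s := fun s _ => by
      simpa using! (hasDerivAt_flow (waveApprox A n) s).clm_apply (hasDerivAt_const s z)
    rw [intervalIntegral.integral_eq_sub_of_hasDerivAt hd
      ((continuous_approxFlow_apply n _).intervalIntegrable _ _)]
    simp [approxFlow]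
  obtain ⟨C, hC⟩ := (tendsto_waveApprox h).norm.bddAbove_range
  refine tendsto_nhds_unique ((tendsto_approxFlow t z).sub_const z) ?_
  simp only [h1]
  refine intervalIntegral.tendsto_integral_filter_of_dominated_convergence
    (fun s => Real.exp |s| * C) ?_ ?_ ?_ ?_
  · exact Eventually.of_forall fun n => (continuous_approxFlow_apply n _).aestronglyMeasurable
  · exact Eventually.of_forall fun n => ae_of_all _ fun s _ =>
      (norm_approxFlow_apply_le n s _).trans
        (mul_le_mul_of_nonneg_left (hC ⟨n, rfl⟩) (Real.exp_pos _).le)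
  · exact Continuous.intervalIntegrable (by fun_prop) _ _
  · exact ae_of_all _ fun s _ => tendsto_approxFlow_apply s (tendsto_waveApprox h)

lemma hasDerivAt_waveGroup_zero {z w : PhaseSpace A} (h : (z, w) ∈ (waveOp A).graph) :
    HasDerivAt (fun t => waveGroup A t z) w 0 := by
  have h1 : ∀ t, waveGroup A t z = (∫ s in (0 : ℝ)..t, waveGroup A s w) + z := fun t => by
    rw [← waveGroup_sub_eq_integral h, sub_add_cancel]
  have hc := continuous_waveGroup_apply w
  have h2 := (intervalIntegral.integral_hasDerivAt_right (hc.intervalIntegrable 0 0)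
    hc.aestronglyMeasurable.stronglyMeasurableAtFilter hc.continuousAt).add_const z
  rw [waveGroup_zero] at h2
  exact h2.congr_of_eventuallyEq (Eventually.of_forall h1)

/-- For the converse, let the orbit of `z` have derivative `w` at `0`. As `Rₙ` commutes with the
group, the orbit of `Rₙ z` has derivative `Rₙ w`, which must be `𝒜 Rₙ z = Bₙ z`. Letting `n → ∞`,
closedness of `𝒜` gives `w = 𝒜 z`. -/
lemma isGenerator_waveGroup : IsGenerator (waveGroup A) (waveOp A) := by
  refine fun z w => ⟨hasDerivAt_waveGroup_zero, fun h => ?_⟩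
  have h1 : ∀ n, waveApprox A n z = phaseApproxId A n w := fun n => by
    have hd := (phaseApproxId A n).hasFDerivAt.comp_hasDerivAt (0 : ℝ) h
    refine (hasDerivAt_waveGroup_zero (phaseApproxId_mem_graph n z)).unique
      (hd.congr_of_eventuallyEq (Eventually.of_forall fun t => ?_))
    exact (commute_waveGroup (commutesWith_approxId n) t z).symm
  refine isClosed_waveOp.mem_of_tendsto ((tendsto_phaseApproxId z).prodMk_nhds
    (tendsto_phaseApproxId w)) (Eventually.of_forall fun n => ?_)
  rw [← h1]
  exact phaseApproxId_mem_graph n z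

/-- The wave operator generates only one `C₀` group. -/
lemma eq_waveGroup {S : ℝ → PhaseSpace A →L[ℝ] PhaseSpace A} (hS : IsC0Group S)
    (hG : IsGenerator S (waveOp A)) : S = waveGroup A := by
  have hadd : ∀ s t z, S (s + t) z = S s (S t z) := fun s t z => by rw [hS.map_add]; rfl
  have hderiv : ∀ {z w}, (z, w) ∈ (waveOp A).graph → ∀ s,
      HasDerivAt (fun t => S t z) (S s w) s := by
    intro z w h s
    have h1 : HasDerivAt (fun t => S t z) w (s - s) := by
      rw [sub_self]; exact (hG z w).1 h
    have h2 := (S s).hasFDerivAt.comp_hasDerivAt s (h1.comp_sub_const s s)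
    refine h2.congr_of_eventuallyEq (Eventually.of_forall fun t => ?_)
    change S t z = S s (S (t - s) z)
    rw [← hadd, add_sub_cancel]
  have hgraph : ∀ {z w}, (z, w) ∈ (waveOp A).graph → ∀ s, (S s z, S s w) ∈ (waveOp A).graph := by
    intro z w h s
    have h1 := (S s).hasFDerivAt.comp_hasDerivAt (0 : ℝ) ((hG z w).1 h)
    refine (hG _ _).2 (h1.congr_of_eventuallyEq (Eventually.of_forall fun t => ?_))
    change S t (S s z) = S s (S t z)
    rw [← hadd, ← hadd, add_comm]
  funext t
  refine ContinuousLinearMap.ext fun z => ?_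
  have hd := dense_waveOp (A := A)
  refine congrFun (Continuous.ext_on hd (S t).continuous (waveGroup A t).continuous ?_) z
  rintro z ⟨w, hzw⟩
  -- Since `S` preserves the graph of `𝒜`, `exp (-t Bₙ) S(t) z` tends to `z`; it also tends to
  -- `waveGroup A (-t) (S t z)`.
  have h2 := tendsto_flow_neg (hderiv hzw) (hS.continuous_orbit w)
    (fun n s => waveApprox_eq (hgraph hzw s) n) abs_inner_waveApprox_le
    norm_phaseApproxId_apply_le tendsto_phaseApproxId t
  have h3 := tendsto_nhds_unique h2 (tendsto_approxFlow (-t) (S t z))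
  rw [hS.map_zero, ContinuousLinearMap.id_apply] at h3
  rw [← waveGroup_neg_apply t (S t z), ← h3]

end WaveGroup

/-! ### Integral equations with a square integrable Lipschitz constant -/

/-- `φ` is square integrable on bounded intervals. -/
def L2Loc {E : Type*} [NormedAddCommGroup E] (φ : ℝ → E) : Prop :=
  ∀ a b : ℝ, MemLp φ 2 (volume.restrict (Ioc a b))

section L2Loc

variable {E : Type*} [NormedAddCommGroup E] {φ : ℝ → E}

lemma L2Loc.intervalIntegrable (hφ : L2Loc φ) (a b : ℝ) : IntervalIntegrable φ volume a b :=
  ⟨(hφ a b).integrable one_le_two, (hφ b a).integrable one_le_two⟩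

lemma L2Loc.intervalIntegrable_norm_sq (hφ : L2Loc φ) (a b : ℝ) :
    IntervalIntegrable (fun s => ‖φ s‖ ^ 2) volume a b :=
  ⟨(hφ a b).norm.integrable_sq, (hφ b a).norm.integrable_sq⟩

end L2Loc

/-- By Young's inequality, `C φ e^(l(s-t)) ≤ ε C² φ² + e^(2l(s-t)) / (4ε)`. A small `ε` makes the
first integral at most `1/4`, and `l = 1/(2ε)` does the same for the second, as `1/(4ε) * 1/(2l) =
1/4`. -/
lemma exists_exp_weight {φ : ℝ → ℝ} (hφ : L2Loc φ) (C b : ℝ) :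
    ∃ l : ℝ, 0 < l ∧ ∀ t ∈ Icc 0 b,
      ∫ s in (0 : ℝ)..t, C * φ s * Real.exp (l * s) ≤ Real.exp (l * t) / 2 := by
  set M := ∫ s in (0 : ℝ)..b, ‖φ s‖ ^ 2 with hM
  have hM' : 0 ≤ C ^ 2 * |M| := by positivity
  set ε := 1 / (4 * (C ^ 2 * |M| + 1)) with hε
  have hε0 : 0 < ε := by positivity
  have h1 : ε * (C ^ 2 * |M|) ≤ 1 / 4 := by
    rw [hε, div_mul_eq_mul_div, div_le_div_iff₀ (by positivity) (by norm_num)]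
    linarith
  refine ⟨1 / (2 * ε), by positivity, fun t ht => ?_⟩
  set l := 1 / (2 * ε) with hl
  have hl0 : 0 < l := by positivity
  have hd : ∀ s ∈ uIcc 0 t, HasDerivAt (fun s => Real.exp (2 * l * (s - t)) / (2 * l))
      (Real.exp (2 * l * (s - t))) s := fun s _ => by
    have := ((((hasDerivAt_id s).sub_const t).const_mul (2 * l)).exp).div_const (2 * l)
    convert! this using 1
    simp only [id, mul_one]
    field_simp
  have h2 : ∫ s in (0 : ℝ)..t, Real.exp (2 * l * (s - t)) ≤ 1 / (2 * l) := by
    rw [intervalIntegral.integral_eq_sub_of_hasDerivAt hd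
      (Continuous.intervalIntegrable (by fun_prop) _ _)]
    have : 0 ≤ Real.exp (2 * l * (0 - t)) / (2 * l) := by positivity
    simp only [sub_self, mul_zero, Real.exp_zero]
    linarith
  have h3 : ∫ s in (0 : ℝ)..t, ‖φ s‖ ^ 2 ≤ |M| := by
    refine le_trans ?_ (le_abs_self M)
    exact intervalIntegral.integral_mono_interval le_rfl ht.1 ht.2
      (ae_of_all _ fun s => by positivity) (hφ.intervalIntegrable_norm_sq 0 b)
  have hi1 : IntervalIntegrable (fun s => ε * C ^ 2 * ‖φ s‖ ^ 2) volume 0 t :=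
    (hφ.intervalIntegrable_norm_sq 0 t).const_mul _
  have hi2 : IntervalIntegrable (fun s => 1 / (4 * ε) * Real.exp (2 * l * (s - t))) volume 0 t :=
    Continuous.intervalIntegrable (by fun_prop) _ _
  have h4 : ∫ s in (0 : ℝ)..t, C * φ s * Real.exp (l * (s - t)) ≤ 1 / 2 := by
    calc _ ≤ ∫ s in (0 : ℝ)..t,
          (ε * C ^ 2 * ‖φ s‖ ^ 2 + 1 / (4 * ε) * Real.exp (2 * l * (s - t))) := by
          refine intervalIntegral.integral_mono_on ht.1 ?_ (hi1.add hi2) fun s _ => ?_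
          · exact ((hφ.intervalIntegrable 0 t).const_mul C).mul_continuousOn
              (Continuous.continuousOn (by fun_prop))
          · have e1 : Real.exp (2 * l * (s - t)) = Real.exp (l * (s - t)) ^ 2 := by
              rw [← Real.exp_nat_mul]; congr 1; push_cast; ring
            rw [e1, Real.norm_eq_abs, sq_abs]
            have e2 : ε * C ^ 2 * φ s ^ 2 + 1 / (4 * ε) * Real.exp (l * (s - t)) ^ 2
                - C * φ s * Real.exp (l * (s - t))
                = (2 * ε * (C * φ s) - Real.exp (l * (s - t))) ^ 2 / (4 * ε) := by
              field_simp; ring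
            have e3 : 0 ≤ (2 * ε * (C * φ s) - Real.exp (l * (s - t))) ^ 2 / (4 * ε) := by
              positivity
            linarith
      _ = ε * C ^ 2 * (∫ s in (0 : ℝ)..t, ‖φ s‖ ^ 2)
            + 1 / (4 * ε) * ∫ s in (0 : ℝ)..t, Real.exp (2 * l * (s - t)) := by
          rw [intervalIntegral.integral_add hi1 hi2, intervalIntegral.integral_const_mul,
            intervalIntegral.integral_const_mul]
      _ ≤ ε * C ^ 2 * |M| + 1 / (4 * ε) * (1 / (2 * l)) := by gcongr
      _ ≤ 1 / 2 := by
          have : 1 / (4 * ε) * (1 / (2 * l)) = 1 / 4 := by rw [hl]; field_simp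
          rw [this]; linarith
  have h5 : ∀ s, C * φ s * Real.exp (l * s)
      = Real.exp (l * t) * (C * φ s * Real.exp (l * (s - t))) := fun s => by
    have : Real.exp (l * s) = Real.exp (l * t) * Real.exp (l * (s - t)) := by
      rw [← Real.exp_add]; congr 1; ring
    rw [this]; ring
  simp only [h5]
  rw [intervalIntegral.integral_const_mul]
  nlinarith [Real.exp_pos (l * t)]

/-- Gronwall's lemma with a square integrable coefficient. -/
lemma eq_zero_of_le_integral {φ : ℝ → ℝ} (hφ : L2Loc φ) (hφ0 : ∀ s, 0 ≤ φ s) {C b : ℝ} (hC : 0 ≤ C)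
    {D : ℝ → ℝ} (hD : ContinuousOn D (Icc 0 b)) (hD0 : ∀ t ∈ Icc 0 b, 0 ≤ D t)
    (h : ∀ t ∈ Icc 0 b, D t ≤ ∫ s in (0 : ℝ)..t, C * φ s * D s) : ∀ t ∈ Icc 0 b, D t = 0 := by
  obtain ⟨l, hl, hw⟩ := exists_exp_weight hφ C b
  intro t ht
  obtain ⟨t₀, ht₀, hmax⟩ := isCompact_Icc.exists_isMaxOn ⟨t, ht⟩
    (hD.mul (Continuous.continuousOn (s := Icc 0 b)
      (show Continuous fun s : ℝ => Real.exp (-(l * s)) by fun_prop)))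
  set m := D t₀ * Real.exp (-(l * t₀)) with hm
  have hle : ∀ s ∈ Icc 0 b, D s ≤ m * Real.exp (l * s) := fun s hs => by
    have : D s * Real.exp (-(l * s)) * Real.exp (l * s) ≤ m * Real.exp (l * s) :=
      mul_le_mul_of_nonneg_right (hmax hs) (Real.exp_pos (l * s)).le
    rwa [mul_assoc, ← Real.exp_add, neg_add_cancel, Real.exp_zero, mul_one] at this
  have hm0 : 0 ≤ m := mul_nonneg (hD0 _ ht₀) (Real.exp_pos _).le
  -- At the maximum point of `D s * exp (-l s)`, with value `m`, this reads `m ≤ m / 2`.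
  have h1 : D t₀ ≤ m * (Real.exp (l * t₀) / 2) := by
    refine (h t₀ ht₀).trans ?_
    calc _ ≤ ∫ s in (0 : ℝ)..t₀, m * (C * φ s * Real.exp (l * s)) := by
          refine intervalIntegral.integral_mono_on ht₀.1 ?_ ?_ fun s hs => ?_
          · refine ((hφ.intervalIntegrable 0 t₀).const_mul C).mul_continuousOn (hD.mono ?_)
            rw [uIcc_of_le ht₀.1]; exact Icc_subset_Icc_right ht₀.2
          · exact (((hφ.intervalIntegrable 0 t₀).const_mul C).mul_continuousOn
              (Continuous.continuousOn (by fun_prop))).const_mul m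
          · have := mul_le_mul_of_nonneg_left (hle s ⟨hs.1, hs.2.trans ht₀.2⟩)
              (mul_nonneg hC (hφ0 s))
            linarith
      _ ≤ _ := by
          rw [intervalIntegral.integral_const_mul]
          exact mul_le_mul_of_nonneg_left (hw t₀ ht₀) hm0
  have h2 : D t₀ = m * Real.exp (l * t₀) := by
    rw [hm, mul_assoc, ← Real.exp_add]; simp
  have h3 : m = 0 := by nlinarith [Real.exp_pos (l * t₀)]
  have h4 := hle t ht
  rw [h3, zero_mul] at h4
  exact le_antisymm h4 (hD0 t ht)

section IntegralEquation

variable {X Y : Type*} [NormedAddCommGroup X] [NormedSpace ℝ X] [NormedAddCommGroup Y]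
  [NormedSpace ℝ Y]

/-- The map `x ↦ G(s, x)` is Lipschitz with a constant that is at most a multiple of `φ(s)`, locally
uniformly in `s ≥ 0`, and it maps continuous functions to locally integrable functions. -/
structure IsCaratheodory (φ : ℝ → ℝ) (G : ℝ → X → Y) : Prop where
  intervalIntegrable : ∀ y : ℝ → X, Continuous y → ∀ a b : ℝ,
    IntervalIntegrable (fun s => G s (y s)) volume a b
  lipschitz : ∀ b : ℝ, ∃ C : ℝ, 0 ≤ C ∧ ∀ s ∈ Icc 0 b, ∀ x y,
    ‖G s x - G s y‖ ≤ C * φ s * ‖x - y‖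

variable {φ : ℝ → ℝ} {G : ℝ → X → X}

/-- In the norm with weight `exp (-l t)` on `[0, b]` the integral operator is a contraction with
factor `1/2`. -/
lemma IsCaratheodory.norm_integral_sub_le (hG : IsCaratheodory φ G) (hφ : L2Loc φ)
    (hφ0 : ∀ s, 0 ≤ φ s) (b : ℝ) :
    ∃ l : ℝ, 0 < l ∧ ∀ t ∈ Icc 0 b, ∀ x y : ℝ → X, Continuous x → Continuous y → ∀ K : ℝ,
      (∀ s ∈ Icc 0 b, ‖x s - y s‖ ≤ K * Real.exp (l * s)) →
      ‖(∫ s in (0 : ℝ)..t, G s (x s)) - ∫ s in (0 : ℝ)..t, G s (y s)‖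
        ≤ K / 2 * Real.exp (l * t) := by
  obtain ⟨C, hC, hL⟩ := hG.lipschitz b
  obtain ⟨l, hl, hw⟩ := exists_exp_weight hφ C b
  refine ⟨l, hl, fun t ht x y hx hy K hK => ?_⟩
  have hK0 : 0 ≤ K := by
    have := (norm_nonneg _).trans (hK t ht)
    exact nonneg_of_mul_nonneg_left this (Real.exp_pos _)
  rw [← intervalIntegral.integral_sub (hG.intervalIntegrable x hx _ _)
    (hG.intervalIntegrable y hy _ _)]
  refine (intervalIntegral.norm_integral_le_of_norm_le (g := fun s =>
    K * (C * φ s * Real.exp (l * s))) ht.1 (ae_of_all _ fun s hs => ?_) ?_).trans ?_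
  · have hs' : s ∈ Icc 0 b := ⟨hs.1.le, hs.2.trans ht.2⟩
    have := mul_le_mul_of_nonneg_left (hK s hs') (mul_nonneg hC (hφ0 s))
    linarith [hL s hs' (x s) (y s)]
  · exact (((hφ.intervalIntegrable 0 t).const_mul C).mul_continuousOn
      (Continuous.continuousOn (by fun_prop))).const_mul K
  · rw [intervalIntegral.integral_const_mul]
    linarith [mul_le_mul_of_nonneg_left (hw t ht) hK0]

variable [CompleteSpace X]

/-- Global solvability of the integral equation `y(t) = y₀ + ∫₀ᵗ G(s, y(s)) ds`. -/
lemma IsCaratheodory.exists_solution (hG : IsCaratheodory φ G) (hφ : L2Loc φ)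
    (hφ0 : ∀ s, 0 ≤ φ s) (y₀ : X) :
    ∃ y : ℝ → X, Continuous y ∧ ∀ t, 0 ≤ t → y t = y₀ + ∫ s in (0 : ℝ)..t, G s (y s) := by
  -- The truncation `max t 0` keeps the iterates constant for `t ≤ 0` and continuous on all of `ℝ`.
  let Φ : (ℝ → X) → ℝ → X := fun y t => y₀ + ∫ s in (0 : ℝ)..max t 0, G s (y s)
  let Y : ℕ → ℝ → X := fun n => Φ^[n] fun _ => y₀
  have hYs : ∀ n, Y (n + 1) = Φ (Y n) := fun n => Function.iterate_succ_apply' Φ n _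
  have hΦc : ∀ y, Continuous y → Continuous (Φ y) := fun y hy =>
    continuous_const.add ((intervalIntegral.continuous_primitive (hG.intervalIntegrable y hy) 0).comp
      (continuous_id.max continuous_const))
  have hYc : ∀ n, Continuous (Y n) := fun n => by
    induction n with
    | zero => exact continuous_const
    | succ n ih => rw [hYs]; exact hΦc _ ih
  have hYmax : ∀ n t, Y n t = Y n (max t 0) := fun n t => by
    cases n with
    | zero => rfl
    | succ n => simp only [hYs, Φ, max_assoc, max_self]
  -- The contraction estimate is carried along so that it refers to the same weight `l` as the
  -- geometric decay of the increments.
  have hgeom : ∀ b, 0 ≤ b → ∃ l M : ℝ, 0 < l ∧ (∀ n, ∀ t ∈ Icc 0 b,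
      dist (Y n t) (Y (n + 1) t) ≤ M * Real.exp (l * t) * (1 / 2) ^ n) ∧
      ∀ t ∈ Icc 0 b, ∀ x y : ℝ → X, Continuous x → Continuous y → ∀ K : ℝ,
      (∀ s ∈ Icc 0 b, ‖x s - y s‖ ≤ K * Real.exp (l * s)) →
      ‖(∫ s in (0 : ℝ)..t, G s (x s)) - ∫ s in (0 : ℝ)..t, G s (y s)‖
        ≤ K / 2 * Real.exp (l * t) := by
    intro b hb
    obtain ⟨l, hl, hw⟩ := hG.norm_integral_sub_le hφ hφ0 b
    obtain ⟨M, hM⟩ := isCompact_Icc.bddAbove_image (K := Icc 0 b)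
      (f := fun t => dist (Y 0 t) (Y 1 t)) ((hYc 0).dist (hYc 1)).continuousOn
    refine ⟨l, M, hl, fun n => ?_, hw⟩
    induction n with
    | zero =>
      intro t ht
      have h1 : dist (Y 0 t) (Y 1 t) ≤ M := hM ⟨t, ht, rfl⟩
      have h2 : 1 ≤ Real.exp (l * t) := Real.one_le_exp (mul_nonneg hl.le ht.1)
      have h3 : 0 ≤ M := dist_nonneg.trans h1
      rw [pow_zero, mul_one]
      nlinarith
    | succ n ih =>
      intro t ht
      have h1 := hw t ht (Y n) (Y (n + 1)) (hYc _) (hYc _) (M * (1 / 2) ^ n) fun s hs => by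
        rw [← dist_eq_norm]; linarith [ih s hs]
      rw [dist_eq_norm, hYs, hYs]
      simp only [Φ, max_eq_left ht.1, add_sub_add_left_eq_sub]
      refine h1.trans (le_of_eq ?_)
      ring
  have hcau : ∀ t, ∃ y, Tendsto (fun n => Y n t) atTop (𝓝 y) := fun t => by
    obtain ⟨l, M, -, h, -⟩ := hgeom (max t 0) (le_max_right _ _)
    refine cauchySeq_tendsto_of_complete (cauchySeq_of_le_geometric (1 / 2)
      (M * Real.exp (l * max t 0)) (by norm_num) fun n => ?_)
    rw [hYmax, hYmax (n + 1)]
    exact h n _ ⟨le_max_right _ _, le_rfl⟩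
  choose y hy using hcau
  have hyb : ∀ b, 0 ≤ b → ∃ l M : ℝ, 0 < l ∧ (∀ n, ∀ t ∈ Icc 0 b,
      ‖Y n t - y t‖ ≤ M * (1 / 2) ^ n * Real.exp (l * t)) ∧
      ∀ t ∈ Icc 0 b, ∀ x y : ℝ → X, Continuous x → Continuous y → ∀ K : ℝ,
      (∀ s ∈ Icc 0 b, ‖x s - y s‖ ≤ K * Real.exp (l * s)) →
      ‖(∫ s in (0 : ℝ)..t, G s (x s)) - ∫ s in (0 : ℝ)..t, G s (y s)‖
        ≤ K / 2 * Real.exp (l * t) := by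
    intro b hb
    obtain ⟨l, M, hl, h, hw⟩ := hgeom b hb
    refine ⟨l, 2 * M, hl, fun n t ht => ?_, hw⟩
    rw [← dist_eq_norm]
    refine (dist_le_of_le_geometric_of_tendsto (1 / 2) (M * Real.exp (l * t)) (by norm_num)
      (fun n => h n t ht) (hy t) n).trans (le_of_eq ?_)
    ring
  have hymax : ∀ t, y t = y (max t 0) := fun t =>
    tendsto_nhds_unique (hy t) ((hy (max t 0)).congr fun n => (hYmax n t).symm)
  have hyc : Continuous y := by
    refine continuous_iff_continuousAt.2 fun t => ?_
    obtain ⟨l, M, hl, h, -⟩ := hyb (max t 0 + 1) (by positivity)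
    have hu : TendstoUniformlyOn Y y atTop (Iio (max t 0 + 1)) := by
      rw [Metric.tendstoUniformlyOn_iff]
      intro ε hε
      have h0 : Tendsto (fun n : ℕ => M * (1 / 2) ^ n * Real.exp (l * (max t 0 + 1))) atTop (𝓝 0) := by
        simpa using ((tendsto_pow_atTop_nhds_zero_of_lt_one (r := (1 / 2 : ℝ)) (by norm_num)
          (by norm_num)).const_mul M).mul_const (Real.exp (l * (max t 0 + 1)))
      filter_upwards [h0.eventually (gt_mem_nhds hε)] with n hn s hs
      have hs1 : max s 0 ≤ max t 0 + 1 := max_le (le_of_lt hs) (by positivity)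
      have h1 := h n (max s 0) ⟨le_max_right _ _, hs1⟩
      rw [dist_comm, dist_eq_norm, hYmax, hymax]
      have hM : 0 ≤ M * (1 / 2) ^ n :=
        nonneg_of_mul_nonneg_left ((norm_nonneg _).trans h1) (Real.exp_pos _)
      refine lt_of_le_of_lt (h1.trans ?_) hn
      gcongr
    exact (hu.continuousOn (Frequently.of_forall fun n => (hYc n).continuousOn)).continuousAt
      (Iio_mem_nhds (by linarith [le_max_left t 0]))
  refine ⟨y, hyc, fun t ht => ?_⟩
  obtain ⟨l, M, hl, h, hw⟩ := hyb t ht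
  have ht' : t ∈ Icc 0 t := ⟨ht, le_rfl⟩
  have h1 : Tendsto (fun n => Y (n + 1) t) atTop (𝓝 (y₀ + ∫ s in (0 : ℝ)..t, G s (y s))) := by
    rw [tendsto_iff_norm_sub_tendsto_zero]
    refine squeeze_zero (fun _ => norm_nonneg _) (g := fun n : ℕ =>
      M * (1 / 2) ^ n / 2 * Real.exp (l * t)) (fun n => ?_) ?_
    · rw [hYs]
      simp only [Φ, max_eq_left ht, add_sub_add_left_eq_sub]
      exact hw t ht' (Y n) y (hYc n) hyc _ (h n)
    · simpa using (((tendsto_pow_atTop_nhds_zero_of_lt_one (r := (1 / 2 : ℝ)) (by norm_num)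
          (by norm_num)).const_mul M).div_const 2).mul_const (Real.exp (l * t))
  exact tendsto_nhds_unique ((tendsto_add_atTop_iff_nat 1).2 (hy t)) h1

end IntegralEquation

/-! ### Smooth approximation of mild solutions -/

section MildApprox

lemma tendsto_clm_apply {E F ι : Type*} [NormedAddCommGroup E] [NormedSpace ℝ E]
    [NormedAddCommGroup F] [NormedSpace ℝ F] {l : Filter ι} {f : ι → E →L[ℝ] F} {g : E →L[ℝ] F}
    {u : ι → E} {x : E} (hf : Tendsto f l (𝓝 g)) (hu : Tendsto u l (𝓝 x)) :
    Tendsto (fun i => f i (u i)) l (𝓝 (g x)) :=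
  ((isBoundedBilinearMap_apply (𝕜 := ℝ) (E := E) (F := F)).continuous.tendsto (g, x)).comp (hf.prodMk_nhds hu)

lemma aestronglyMeasurable_clm_apply {E F : Type*} [NormedAddCommGroup E] [NormedSpace ℝ E]
    [NormedAddCommGroup F] [NormedSpace ℝ F] {μ : Measure ℝ} {f : ℝ → E →L[ℝ] F} {u : ℝ → E}
    (hf : AEStronglyMeasurable f μ) (hu : AEStronglyMeasurable u μ) :
    AEStronglyMeasurable (fun s => f s (u s)) μ :=
  (isBoundedBilinearMap_apply (𝕜 := ℝ) (E := E) (F := F)).continuous.comp_aestronglyMeasurable (hf.prodMk hu)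

lemma exists_continuous_approx {E : Type*} [NormedAddCommGroup E] [NormedSpace ℝ E] {h : ℝ → E}
    {b : ℝ} (hb : 0 ≤ b) (hh : IntervalIntegrable h volume 0 b) :
    ∃ g : ℕ → ℝ → E, (∀ n, Continuous (g n)) ∧
      Tendsto (fun n => ∫ s in (0 : ℝ)..b, ‖g n s - h s‖) atTop (𝓝 0) := by
  have hi : Integrable h (volume.restrict (Ioc 0 b)) := hh.1
  have key : ∀ n : ℕ, ∃ g : ℝ → E, Continuous g ∧
      ∫ s in (0 : ℝ)..b, ‖g s - h s‖ ≤ 1 / ((n : ℝ) + 1) := fun n => by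
    obtain ⟨g, -, hg, hc, -⟩ := hi.exists_hasCompactSupport_integral_sub_le
      (show 0 < 1 / ((n : ℝ) + 1) by positivity)
    refine ⟨g, hc, ?_⟩
    rw [intervalIntegral.integral_of_le hb]
    simpa only [norm_sub_rev] using hg
  choose g hc hg using key
  refine ⟨g, hc, squeeze_zero (fun n => ?_) hg tendsto_one_div_add_atTop_nhds_zero_nat⟩
  exact intervalIntegral.integral_nonneg hb fun _ _ => norm_nonneg _

variable {X : Type*} [NormedAddCommGroup X] [InnerProductSpace ℝ X]

/-- The function `Z n` solves `Z' = B n Z + F' n` classically, it is uniformly bounded by `K` and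
tends to `z` on `[0, b]`, where `F' n` tends to `F` in `L¹(0, b)`. -/
structure IsMildApprox (B : ℕ → X →L[ℝ] X) (b : ℝ) (F z : ℝ → X) (Z F' : ℕ → ℝ → X) (K : ℝ) :
    Prop where
  le_right : 0 ≤ b
  intervalIntegrable : IntervalIntegrable F volume 0 b
  continuous : ∀ n, Continuous (F' n)
  hasDerivAt : ∀ n t, HasDerivAt (Z n) (B n (Z n t) + F' n t) t
  init : ∀ n, Z n 0 = z 0
  tendsto : ∀ t ∈ Icc 0 b, Tendsto (fun n => Z n t) atTop (𝓝 (z t))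
  norm_le : ∀ n, ∀ t ∈ Icc 0 b, ‖Z n t‖ ≤ K
  tendsto_integral : Tendsto (fun n => ∫ s in (0 : ℝ)..b, ‖F' n s - F s‖) atTop (𝓝 0)

namespace IsMildApprox

variable {B : ℕ → X →L[ℝ] X} {b : ℝ} {F z : ℝ → X} {Z F' : ℕ → ℝ → X} {K : ℝ}

lemma continuous_path (h : IsMildApprox B b F z Z F' K) (n : ℕ) : Continuous (Z n) :=
  continuous_iff_continuousAt.2 fun t => (h.hasDerivAt n t).continuousAt

lemma bound_nonneg (h : IsMildApprox B b F z Z F' K) : 0 ≤ K :=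
  (norm_nonneg _).trans (h.norm_le 0 0 ⟨le_rfl, h.le_right⟩)

lemma integrable_of_mem (h : IsMildApprox B b F z Z F' K) {t : ℝ} (ht : t ∈ Icc 0 b) :
    IntervalIntegrable F volume 0 t :=
  h.intervalIntegrable.mono_set (by
    rw [uIcc_of_le ht.1, uIcc_of_le h.le_right]; exact Icc_subset_Icc_right ht.2)

lemma tendsto_integral_of_mem (h : IsMildApprox B b F z Z F' K) {t : ℝ} (ht : t ∈ Icc 0 b) :
    Tendsto (fun n => ∫ s in (0 : ℝ)..t, ‖F' n s - F s‖) atTop (𝓝 0) := by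
  refine squeeze_zero (fun n => intervalIntegral.integral_nonneg ht.1 fun _ _ => norm_nonneg _)
    (fun n => ?_) h.tendsto_integral
  exact intervalIntegral.integral_mono_interval le_rfl ht.1 ht.2
    (ae_of_all _ fun s => norm_nonneg _)
    (((h.continuous n).intervalIntegrable _ _).sub h.intervalIntegrable).norm

variable {E : Type*} [NormedAddCommGroup E] [NormedSpace ℝ E]

lemma tendsto_integral_linear (h : IsMildApprox B b F z Z F' K) (l : X →L[ℝ] E) {t : ℝ}
    (ht : t ∈ Icc 0 b) :
    Tendsto (fun n => ∫ s in (0 : ℝ)..t, l (F' n s)) atTop (𝓝 (∫ s in (0 : ℝ)..t, l (F s))) := by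
  have hF := h.integrable_of_mem ht
  rw [tendsto_iff_norm_sub_tendsto_zero]
  refine squeeze_zero (fun _ => norm_nonneg _) (fun n => ?_)
    (by simpa using (h.tendsto_integral_of_mem ht).const_mul ‖l‖)
  have hF' := (h.continuous n).intervalIntegrable (μ := volume) 0 t
  rw [← intervalIntegral.integral_sub ⟨l.integrable_comp hF'.1, l.integrable_comp hF'.2⟩
    ⟨l.integrable_comp hF.1, l.integrable_comp hF.2⟩, ← intervalIntegral.integral_const_mul]
  refine intervalIntegral.norm_integral_le_of_norm_le ht.1 (ae_of_all _ fun s _ => ?_)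
    ((hF'.sub hF).norm.const_mul _)
  rw [← map_sub]
  exact l.le_opNorm _

/-- Replacing `F'` by `F` costs `‖β‖ K` times the `L¹` distance; replacing `Z n` by `z` is then
dominated convergence. -/
lemma tendsto_integral_bilinear (h : IsMildApprox B b F z Z F' K) (β : X →L[ℝ] X →L[ℝ] E) {t : ℝ}
    (ht : t ∈ Icc 0 b) :
    Tendsto (fun n => ∫ s in (0 : ℝ)..t, β (Z n s) (F' n s)) atTop
      (𝓝 (∫ s in (0 : ℝ)..t, β (z s) (F s))) := by
  have hF := h.integrable_of_mem ht
  have hK := h.bound_nonneg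
  have hmem : ∀ s ∈ uIoc 0 t, s ∈ Icc 0 b := fun s hs => by
    rw [uIoc_of_le ht.1] at hs; exact ⟨hs.1.le, hs.2.trans ht.2⟩
  have hm : AEStronglyMeasurable F (volume.restrict (uIoc 0 t)) := by
    rw [uIoc_of_le ht.1]; exact hF.1.aestronglyMeasurable
  have hmeas : ∀ n, AEStronglyMeasurable (fun s => β (Z n s) (F s)) (volume.restrict (uIoc 0 t)) :=
    fun n => aestronglyMeasurable_clm_apply
      (β.continuous.comp (h.continuous_path n)).aestronglyMeasurable hm
  have hle : ∀ n, ∀ s ∈ Icc 0 b, ∀ x, ‖β (Z n s) x‖ ≤ ‖β‖ * K * ‖x‖ := fun n s hs x =>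
    (β.le_opNorm₂ _ _).trans (by gcongr; exact h.norm_le n s hs)
  have h1 : Tendsto (fun n => ∫ s in (0 : ℝ)..t, β (Z n s) (F s)) atTop
      (𝓝 (∫ s in (0 : ℝ)..t, β (z s) (F s))) := by
    refine intervalIntegral.tendsto_integral_filter_of_dominated_convergence
      (fun s => ‖β‖ * K * ‖F s‖) (Eventually.of_forall hmeas) ?_ (hF.norm.const_mul _) ?_
    · exact Eventually.of_forall fun n => ae_of_all _ fun s hs => hle n s (hmem s hs) _
    · exact ae_of_all _ fun s hs => ((ContinuousLinearMap.apply ℝ E (F s)).continuous.tendsto _).comp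
        ((β.continuous.tendsto _).comp (h.tendsto s (hmem s hs)))
  have hint : ∀ n, IntervalIntegrable (fun s => β (Z n s) (F s)) volume 0 t := fun n => by
    refine (hF.norm.const_mul (‖β‖ * K)).mono_fun (hmeas n) ?_
    refine (ae_restrict_iff' measurableSet_uIoc).2 (ae_of_all _ fun s hs => ?_)
    change _ ≤ ‖‖β‖ * K * ‖F s‖‖
    rw [Real.norm_of_nonneg (by positivity)]
    exact hle n s (hmem s hs) _
  have hint' : ∀ n, IntervalIntegrable (fun s => β (Z n s) (F' n s)) volume 0 t := fun n =>
    ((β.continuous.comp (h.continuous_path n)).clm_apply (h.continuous n)).intervalIntegrable _ _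
  have h2 : Tendsto (fun n => (∫ s in (0 : ℝ)..t, β (Z n s) (F' n s))
      - ∫ s in (0 : ℝ)..t, β (Z n s) (F s)) atTop (𝓝 0) := by
    refine squeeze_zero_norm (fun n => ?_)
      (by simpa using (h.tendsto_integral_of_mem ht).const_mul (‖β‖ * K))
    rw [← intervalIntegral.integral_sub (hint' n) (hint n), ← intervalIntegral.integral_const_mul]
    refine intervalIntegral.norm_integral_le_of_norm_le ht.1 (ae_of_all _ fun s hs => ?_)
      ((((h.continuous n).intervalIntegrable _ _).sub hF).norm.const_mul _)
    rw [← map_sub]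
    exact hle n s (hmem s (by rwa [uIoc_of_le ht.1])) _
  simpa using h2.add h1

variable {R : ℕ → X →L[ℝ] X}

lemma tendsto_approx (h : IsMildApprox B b F z Z F' K) (hR : ∀ n x, ‖R n x‖ ≤ 2 * ‖x‖)
    (hR' : ∀ x, Tendsto (fun n => R n x) atTop (𝓝 x)) {t : ℝ} (ht : t ∈ Icc 0 b) :
    Tendsto (fun n => R n (Z n t)) atTop (𝓝 (z t)) := by
  have h1 : Tendsto (fun n => R n (Z n t - z t)) atTop (𝓝 0) := by
    refine squeeze_zero_norm (fun n => hR n _) ?_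
    simpa using (tendsto_iff_norm_sub_tendsto_zero.1 (h.tendsto t ht)).const_mul 2
  simpa using h1.add (hR' (z t))

/-- No bound on `B n` uniform in `n` is available. The hypothesis `hlm` trades `B n` for the
uniformly bounded `R n`, after which the limit can be taken in the integrated equation of `Z n`. -/
lemma apply_linear [CompleteSpace E] (h : IsMildApprox B b F z Z F' K)
    (hR : ∀ n x, ‖R n x‖ ≤ 2 * ‖x‖) (hR' : ∀ x, Tendsto (fun n => R n x) atTop (𝓝 x))
    {l m : X →L[ℝ] E} (hlm : ∀ n x, l (B n x) = m (R n x)) {t : ℝ} (ht : t ∈ Icc 0 b) :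
    l (z t) = l (z 0) + ((∫ s in (0 : ℝ)..t, m (z s)) + ∫ s in (0 : ℝ)..t, l (F s)) := by
  have hmem : ∀ s ∈ uIoc 0 t, s ∈ Icc 0 b := fun s hs => by
    rw [uIoc_of_le ht.1] at hs; exact ⟨hs.1.le, hs.2.trans ht.2⟩
  have hc : ∀ n, Continuous fun s => m (R n (Z n s)) := fun n =>
    m.continuous.comp ((R n).continuous.comp (h.continuous_path n))
  have hc' : ∀ n, Continuous fun s => l (F' n s) := fun n => l.continuous.comp (h.continuous n)
  have h1 : ∀ n, l (Z n t) = l (z 0) + ((∫ s in (0 : ℝ)..t, m (R n (Z n s)))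
      + ∫ s in (0 : ℝ)..t, l (F' n s)) := fun n => by
    rw [← intervalIntegral.integral_add ((hc n).intervalIntegrable _ _)
      ((hc' n).intervalIntegrable _ _), intervalIntegral.integral_eq_sub_of_hasDerivAt
      (f := fun s => l (Z n s)) (f' := fun s => m (R n (Z n s)) + l (F' n s)) (fun s _ => ?_) (((hc n).add (hc' n)).intervalIntegrable _ _)]
    · rw [h.init]; abel
    · have := l.hasFDerivAt.comp_hasDerivAt s (h.hasDerivAt n s)
      rw [map_add, hlm] at this
      exact this
  have h2 : Tendsto (fun n => ∫ s in (0 : ℝ)..t, m (R n (Z n s))) atTop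
      (𝓝 (∫ s in (0 : ℝ)..t, m (z s))) := by
    refine intervalIntegral.tendsto_integral_filter_of_dominated_convergence
      (fun _ => ‖m‖ * (2 * K)) ?_ ?_ intervalIntegrable_const ?_
    · exact Eventually.of_forall fun n => (hc n).aestronglyMeasurable
    · exact Eventually.of_forall fun n => ae_of_all _ fun s hs => (m.le_opNorm _).trans (by
        gcongr; exact (hR n _).trans (by linarith [h.norm_le n s (hmem s hs)]))
    · exact ae_of_all _ fun s hs => (m.continuous.tendsto _).comp
        (h.tendsto_approx hR hR' (hmem s hs))
  refine tendsto_nhds_unique ((l.continuous.tendsto _).comp (h.tendsto t ht)) ?_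
  refine ((h2.add (h.tendsto_integral_linear l ht)).const_add (l (z 0))).congr fun n => ?_
  exact (h1 n).symm

/-- The same device for a quadratic quantity. The trade is required only for the sum of both terms
on the diagonal, so that cancellations such as skewness can be used. -/
lemma apply_bilinear (h : IsMildApprox B b F z Z F' K)
    (hR : ∀ n x, ‖R n x‖ ≤ 2 * ‖x‖) (hR' : ∀ x, Tendsto (fun n => R n x) atTop (𝓝 x))
    {β δ : X →L[ℝ] X →L[ℝ] ℝ} (hβδ : ∀ n x, β (B n x) x + β x (B n x) = δ (R n x) x) {t : ℝ}
    (ht : t ∈ Icc 0 b) :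
    β (z t) (z t) = β (z 0) (z 0) + ((∫ s in (0 : ℝ)..t, δ (z s) (z s))
      + ((∫ s in (0 : ℝ)..t, β (F s) (z s)) + ∫ s in (0 : ℝ)..t, β (z s) (F s))) := by
  have hmem : ∀ s ∈ uIoc 0 t, s ∈ Icc 0 b := fun s hs => by
    rw [uIoc_of_le ht.1] at hs; exact ⟨hs.1.le, hs.2.trans ht.2⟩
  have hZ := h.continuous_path
  have hK := h.bound_nonneg
  have hc : ∀ n, Continuous fun s => δ (R n (Z n s)) (Z n s) := fun n =>
    (δ.continuous.comp ((R n).continuous.comp (hZ n))).clm_apply (hZ n)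
  have hc1 : ∀ n, Continuous fun s => β (F' n s) (Z n s) := fun n =>
    (β.continuous.comp (h.continuous n)).clm_apply (hZ n)
  have hc2 : ∀ n, Continuous fun s => β (Z n s) (F' n s) := fun n =>
    (β.continuous.comp (hZ n)).clm_apply (h.continuous n)
  have h1 : ∀ n, β (Z n t) (Z n t) = β (z 0) (z 0) + ((∫ s in (0 : ℝ)..t, δ (R n (Z n s)) (Z n s))
      + ((∫ s in (0 : ℝ)..t, β (F' n s) (Z n s)) + ∫ s in (0 : ℝ)..t, β (Z n s) (F' n s))) :=
      fun n => by
    rw [← intervalIntegral.integral_add ((hc1 n).intervalIntegrable _ _)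
      ((hc2 n).intervalIntegrable _ _), ← intervalIntegral.integral_add
      (g := fun s => β (F' n s) (Z n s) + β (Z n s) (F' n s))
      ((hc n).intervalIntegrable _ _) (((hc1 n).add (hc2 n)).intervalIntegrable _ _),
      intervalIntegral.integral_eq_sub_of_hasDerivAt
      (f := fun s => β (Z n s) (Z n s))
      (f' := fun s => δ (R n (Z n s)) (Z n s) + (β (F' n s) (Z n s) + β (Z n s) (F' n s))) (fun s _ => ?_)
      (((hc n).add ((hc1 n).add (hc2 n))).intervalIntegrable _ _)]
    · rw [h.init]; abel
    · have := (β.hasFDerivAt.comp_hasDerivAt s (h.hasDerivAt n s)).clm_apply (h.hasDerivAt n s)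
      convert! this using 1
      simp only [← hβδ, map_add, _root_.add_apply, Function.comp_apply]
      abel
  have h2 : Tendsto (fun n => ∫ s in (0 : ℝ)..t, δ (R n (Z n s)) (Z n s)) atTop
      (𝓝 (∫ s in (0 : ℝ)..t, δ (z s) (z s))) := by
    refine intervalIntegral.tendsto_integral_filter_of_dominated_convergence
      (fun _ => ‖δ‖ * (2 * K) * K) ?_ ?_ intervalIntegrable_const ?_
    · exact Eventually.of_forall fun n => (hc n).aestronglyMeasurable
    · refine Eventually.of_forall fun n => ae_of_all _ fun s hs => (δ.le_opNorm₂ _ _).trans ?_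
      have e := h.norm_le n s (hmem s hs)
      have e' := (hR n (Z n s)).trans (mul_le_mul_of_nonneg_left e zero_le_two)
      gcongr
    · exact ae_of_all _ fun s hs => tendsto_clm_apply ((δ.continuous.tendsto _).comp
        (h.tendsto_approx hR hR' (hmem s hs))) (h.tendsto s (hmem s hs))
  have h3 := h.tendsto_integral_bilinear β ht
  have h4 := h.tendsto_integral_bilinear β.flip ht
  simp only [ContinuousLinearMap.flip_apply] at h4
  refine tendsto_nhds_unique (tendsto_clm_apply ((β.continuous.tendsto _).comp
    (h.tendsto t ht)) (h.tendsto t ht)) ?_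
  refine ((h2.add (h4.add h3)).const_add _).congr fun n => ?_
  exact (h1 n).symm

end IsMildApprox

lemma intervalIntegrable_group_neg {S : ℝ → X →L[ℝ] X}
    (hSn : ∀ t z, ‖S t z‖ ≤ Real.exp |t| * ‖z‖) (hSc : Continuous fun p : ℝ × X => S p.1 p.2)
    {F : ℝ → X} {a b : ℝ} (hF : IntervalIntegrable F volume a b) :
    IntervalIntegrable (fun s => S (-s) (F s)) volume a b := by
  have hc : ContinuousOn (fun s : ℝ => Real.exp |s|) (uIcc a b) :=
    Continuous.continuousOn (by fun_prop)
  refine (hF.norm.continuousOn_mul hc).mono_fun ?_ (ae_of_all _ fun s => ?_)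
  · exact hSc.comp_aestronglyMeasurable
      (continuous_neg.aestronglyMeasurable.prodMk hF.def'.aestronglyMeasurable)
  · change _ ≤ ‖Real.exp |s| * ‖F s‖‖
    rw [Real.norm_of_nonneg (by positivity)]
    simpa using hSn (-s) (F s)

/-- `Z n` is given by the variation of constants formula with the flow of `B n` and a continuous
`L¹` approximation of `F`; it is a classical solution because `B n` is bounded. -/
lemma exists_isMildApprox [CompleteSpace X] {B : ℕ → X →L[ℝ] X} {S : ℝ → X →L[ℝ] X}
    (hB : ∀ n z, |⟪B n z, z⟫_ℝ| ≤ ‖z‖ ^ 2)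
    (hS : ∀ t z, Tendsto (fun n => flow (B n) t z) atTop (𝓝 (S t z)))
    {b : ℝ} (hb : 0 ≤ b) {F : ℝ → X} (hF : IntervalIntegrable F volume 0 b) {z : ℝ → X}
    (hz : ∀ t ∈ Icc 0 b, z t = S t (z 0 + ∫ s in (0 : ℝ)..t, S (-s) (F s))) :
    ∃ Z F' K, IsMildApprox B b F z Z F' K := by
  obtain ⟨F', hF'c, hF'⟩ := exists_continuous_approx hb hF
  set y : ℕ → ℝ → X := fun n t => z 0 + ∫ s in (0 : ℝ)..t, flow (B n) (-s) (F' n s) with hy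
  have hc : ∀ n, Continuous fun s => flow (B n) (-s) (F' n s) := fun n =>
    ((continuous_flow _).comp continuous_neg).clm_apply (hF'c n)
  have hyd : ∀ n t, HasDerivAt (y n) (flow (B n) (-t) (F' n t)) t := fun n t =>
    (intervalIntegral.integral_hasDerivAt_right ((hc n).intervalIntegrable _ _)
      ((hc n).aestronglyMeasurable.stronglyMeasurableAtFilter) (hc n).continuousAt).const_add _
  have hmem : ∀ t ∈ Icc 0 b, ∀ s ∈ uIoc 0 t, s ∈ Icc 0 b := fun t ht s hs => by
    rw [uIoc_of_le ht.1] at hs; exact ⟨hs.1.le, hs.2.trans ht.2⟩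
  have hexp : ∀ s ∈ Icc 0 b, ∀ n x, ‖flow (B n) (-s) x‖ ≤ Real.exp b * ‖x‖ := fun s hs n x => by
    refine (norm_flow_apply_le (hB n) _ _).trans ?_
    rw [abs_neg, abs_of_nonneg hs.1]
    gcongr
    exact hs.2
  have hFt : ∀ t ∈ Icc 0 b, IntervalIntegrable F volume 0 t := fun t ht => hF.mono_set (by
    rw [uIcc_of_le ht.1, uIcc_of_le hb]; exact Icc_subset_Icc_right ht.2)
  have hFm : ∀ t ∈ Icc 0 b, ∀ n, AEStronglyMeasurable (fun s => flow (B n) (-s) (F s))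
      (volume.restrict (uIoc 0 t)) := fun t ht n =>
    aestronglyMeasurable_clm_apply ((continuous_flow _).comp continuous_neg).aestronglyMeasurable
      (hFt t ht).def'.aestronglyMeasurable
  have hFi : ∀ t ∈ Icc 0 b, ∀ n, IntervalIntegrable (fun s => flow (B n) (-s) (F s)) volume 0 t :=
      fun t ht n => by
    refine ((hFt t ht).norm.const_mul (Real.exp b)).mono_fun (hFm t ht n) ?_
    refine (ae_restrict_iff' measurableSet_uIoc).2 (ae_of_all _ fun s hs => ?_)
    change _ ≤ ‖Real.exp b * ‖F s‖‖
    rw [Real.norm_of_nonneg (by positivity)]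
    exact hexp s (hmem t ht s hs) n _
  have hdiff : ∀ t ∈ Icc 0 b, ∀ n, ‖(∫ s in (0 : ℝ)..t, flow (B n) (-s) (F' n s))
      - ∫ s in (0 : ℝ)..t, flow (B n) (-s) (F s)‖
      ≤ Real.exp b * ∫ s in (0 : ℝ)..b, ‖F' n s - F s‖ := fun t ht n => by
    have hi : IntervalIntegrable (fun s => ‖F' n s - F s‖) volume 0 b :=
      (((hF'c n).intervalIntegrable _ _).sub hF).norm
    rw [← intervalIntegral.integral_sub ((hc n).intervalIntegrable _ _) (hFi t ht n)]
    refine (intervalIntegral.norm_integral_le_of_norm_le (g := fun s => Real.exp b * ‖F' n s - F s‖)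
      ht.1 (ae_of_all _ fun s hs => ?_) ?_).trans ?_
    · rw [← map_sub]
      exact hexp s (hmem t ht s (by rwa [uIoc_of_le ht.1])) n _
    · exact ((((hF'c n).intervalIntegrable _ _).sub (hFt t ht)).norm).const_mul _
    · rw [intervalIntegral.integral_const_mul]
      gcongr
      exact intervalIntegral.integral_mono_interval le_rfl ht.1 ht.2
        (ae_of_all _ fun s => norm_nonneg _) hi
  have hylim : ∀ t ∈ Icc 0 b, Tendsto (fun n => y n t) atTop
      (𝓝 (z 0 + ∫ s in (0 : ℝ)..t, S (-s) (F s))) := fun t ht => by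
    refine Tendsto.const_add _ ?_
    have h1 : Tendsto (fun n => ∫ s in (0 : ℝ)..t, flow (B n) (-s) (F s)) atTop
        (𝓝 (∫ s in (0 : ℝ)..t, S (-s) (F s))) := by
      refine intervalIntegral.tendsto_integral_filter_of_dominated_convergence
        (fun s => Real.exp b * ‖F s‖) (Eventually.of_forall (hFm t ht)) ?_
        ((hFt t ht).norm.const_mul _) (ae_of_all _ fun s _ => hS (-s) (F s))
      exact Eventually.of_forall fun n => ae_of_all _ fun s hs => hexp s (hmem t ht s hs) n _
    have h2 := squeeze_zero_norm (hdiff t ht) (by simpa using hF'.const_mul (Real.exp b))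
    simpa using h2.add h1
  obtain ⟨K, hK⟩ := hF'.bddAbove_range
  have hyb : ∀ n, ∀ t ∈ Icc 0 b, ‖y n t‖
      ≤ ‖z 0‖ + (Real.exp b * K + Real.exp b * ∫ s in (0 : ℝ)..b, ‖F s‖) := fun n t ht => by
    refine (norm_add_le _ _).trans (add_le_add le_rfl ?_)
    have h1 : ‖∫ s in (0 : ℝ)..t, flow (B n) (-s) (F s)‖
        ≤ Real.exp b * ∫ s in (0 : ℝ)..b, ‖F s‖ := by
      refine (intervalIntegral.norm_integral_le_of_norm_le (g := fun s => Real.exp b * ‖F s‖)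
        ht.1 (ae_of_all _ fun s hs => hexp s (hmem t ht s (by rwa [uIoc_of_le ht.1])) n _)
        ((hFt t ht).norm.const_mul _)).trans ?_
      rw [intervalIntegral.integral_const_mul]
      gcongr
      exact intervalIntegral.integral_mono_interval le_rfl ht.1 ht.2
        (ae_of_all _ fun s => norm_nonneg _) hF.norm
    have h2 := (hdiff t ht n).trans (mul_le_mul_of_nonneg_left (hK ⟨n, rfl⟩) (Real.exp_pos b).le)
    have h3 := norm_le_insert' (∫ s in (0 : ℝ)..t, flow (B n) (-s) (F' n s))
      (∫ s in (0 : ℝ)..t, flow (B n) (-s) (F s))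
    linarith
  refine ⟨fun n t => flow (B n) t (y n t), F', Real.exp b *
    (‖z 0‖ + (Real.exp b * K + Real.exp b * ∫ s in (0 : ℝ)..b, ‖F s‖)), hb, hF, hF'c,
    fun n t => ?_, fun n => by simp [hy], fun t ht => ?_, fun n t ht => ?_, hF'⟩
  · convert! (hasDerivAt_flow' (B n) t).clm_apply (hyd n t) using 1
    rw [flow_neg_apply]; rfl
  · rw [hz t ht]
    have h1 : Tendsto (fun n => flow (B n) t (y n t - (z 0 + ∫ s in (0 : ℝ)..t, S (-s) (F s))))
        atTop (𝓝 0) := by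
      refine squeeze_zero_norm (fun n => norm_flow_apply_le (hB n) t _) ?_
      simpa using (tendsto_iff_norm_sub_tendsto_zero.1 (hylim t ht)).const_mul (Real.exp |t|)
    simpa only [map_sub, sub_add_cancel, zero_add] using
      h1.add (hS t (z 0 + ∫ s in (0 : ℝ)..t, S (-s) (F s)))
  · refine (norm_flow_apply_le (hB n) t _).trans ?_
    rw [abs_of_nonneg ht.1]
    gcongr
    · exact ht.2
    · exact hyb n t ht

end MildApprox

section MildSolutions

lemma intervalIntegrable_force {H : Type*} [NormedAddCommGroup H] [InnerProductSpace ℝ H]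
    {A : H →ₗ.[ℝ] H} {h : ℝ → H} {a b : ℝ} (hh : IntervalIntegrable h volume a b) :
    IntervalIntegrable (fun s => force A (h s)) volume a b :=
  ⟨(forceL A).integrable_comp hh.1, (forceL A).integrable_comp hh.2⟩

lemma continuous_group_apply {X : Type*} [NormedAddCommGroup X] [NormedSpace ℝ X]
    {S : ℝ → X →L[ℝ] X} (hS : Continuous fun p : ℝ × X => S p.1 p.2) {y : ℝ → X}
    (hy : Continuous y) : Continuous fun s => S s (y s) :=
  hS.comp (continuous_id.prodMk hy)

variable {H : Type*} [NormedAddCommGroup H] [InnerProductSpace ℝ H] [CompleteSpace H]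
  {A : H →ₗ.[ℝ] H} [hA : Fact (IsSelfAdjoint A)]

/-! ### Mild solutions of the inhomogeneous wave equation -/

/-- The function `z` is a mild solution of `u'' = -A² u + h` on `[0, b]`. -/
def IsWaveMild (A : H →ₗ.[ℝ] H) [Fact (IsSelfAdjoint A)] (b : ℝ) (h : ℝ → H)
    (z : ℝ → PhaseSpace A) : Prop :=
  ∀ t ∈ Icc 0 b, z t = waveGroup A t (z 0 + ∫ s in (0 : ℝ)..t, waveGroup A (-s) (force A (h s)))

variable {b : ℝ} {h : ℝ → H} {z : ℝ → PhaseSpace A}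

lemma IsWaveMild.congr_ae (hz : IsWaveMild A b h z) {k : ℝ → H}
    (hk : ∀ᵐ s ∂(volume.restrict (Ioc 0 b)), h s = k s) : IsWaveMild A b k z := by
  intro t ht
  rw [hz t ht]
  congr 2
  refine intervalIntegral.integral_congr_ae ?_
  rw [ae_restrict_iff' measurableSet_Ioc] at hk
  filter_upwards [hk] with s hs hst
  rw [uIoc_of_le ht.1] at hst
  rw [hs ⟨hst.1, hst.2.trans ht.2⟩]

lemma intervalIntegrable_waveGroup_force {a b : ℝ} (hh : IntervalIntegrable h volume a b) :
    IntervalIntegrable (fun s => waveGroup A (-s) (force A (h s))) volume a b :=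
  intervalIntegrable_group_neg norm_waveGroup_apply_le continuous_waveGroup
    (intervalIntegrable_force hh)

lemma IsWaveMild.exists_isMildApprox (hz : IsWaveMild A b h z) (hb : 0 ≤ b)
    (hh : IntervalIntegrable h volume 0 b) :
    ∃ Z F' K, IsMildApprox (waveApprox A) b (fun s => force A (h s)) z Z F' K :=
  ConstrainedWave.exists_isMildApprox abs_inner_waveApprox_le tendsto_approxFlow hb
    (intervalIntegrable_force hh) hz

/-! ### Identities for mild solutions, obtained from the approximations -/

section Identities

variable (hz : IsWaveMild A b h z) (hb : 0 ≤ b) (hh : IntervalIntegrable h volume 0 b)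

include hz hb hh

lemma IsWaveMild.pos_eq {t : ℝ} (ht : t ∈ Icc 0 b) :
    pos (z t) = pos (z 0) + ∫ s in (0 : ℝ)..t, vel (z s) := by
  obtain ⟨Z, F', K, h⟩ := hz.exists_isMildApprox hb hh
  have := h.apply_linear norm_phaseApproxId_apply_le tendsto_phaseApproxId (l := posL A)
    (m := velL A) pos_waveApprox ht
  simpa using this

lemma IsWaveMild.norm_sq_pos {t : ℝ} (ht : t ∈ Icc 0 b) :
    ‖pos (z t)‖ ^ 2 = ‖pos (z 0)‖ ^ 2 + ∫ s in (0 : ℝ)..t, 2 * ⟪pos (z s), vel (z s)⟫_ℝ := by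
  obtain ⟨Z, F', K, h⟩ := hz.exists_isMildApprox hb hh
  have := h.apply_bilinear norm_phaseApproxId_apply_le tendsto_phaseApproxId
    (β := (innerSL ℝ).bilinearComp (posL A) (posL A))
    (δ := (2 : ℝ) • (innerSL ℝ).bilinearComp (velL A) (posL A)) (fun n x => by
      simp only [ContinuousLinearMap.bilinearComp_apply, posL_apply, velL_apply,
        innerSL_apply_apply, _root_.smul_apply, smul_eq_mul, pos_waveApprox]
      rw [real_inner_comm _ (pos x), two_mul]; rfl) ht
  simp only [ContinuousLinearMap.bilinearComp_apply, posL_apply, velL_apply,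
    innerSL_apply_apply, _root_.smul_apply, smul_eq_mul, pos_force, inner_zero_left,
    inner_zero_right, intervalIntegral.integral_zero, add_zero, real_inner_self_eq_norm_sq] at this
  simpa only [real_inner_comm] using this

/-- For the approximations, symmetry gives `⟪u, A² Rₙ u⟫ = ⟪A u, A Rₙ u⟫`, which is bounded by the
phase norm and has the limit `‖A u‖²`. -/
lemma IsWaveMild.inner_pos_vel {t : ℝ} (ht : t ∈ Icc 0 b) :
    ⟪pos (z t), vel (z t)⟫_ℝ = ⟪pos (z 0), vel (z 0)⟫_ℝ
      + ((∫ s in (0 : ℝ)..t, (‖vel (z s)‖ ^ 2 - ‖opPos (z s)‖ ^ 2))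
        + ∫ s in (0 : ℝ)..t, ⟪pos (z s), h s⟫_ℝ) := by
  obtain ⟨Z, F', K, h⟩ := hz.exists_isMildApprox hb hh
  have := h.apply_bilinear norm_phaseApproxId_apply_le tendsto_phaseApproxId
    (β := (innerSL ℝ).bilinearComp (posL A) (velL A))
    (δ := (innerSL ℝ).bilinearComp (velL A) (velL A)
      - (innerSL ℝ).bilinearComp (opPosL A) (opPosL A)) (fun n x => by
      have h1 := (mem_graph_waveOp.1 (phaseApproxId_mem_graph n x)).2
      have h2 := graph_symm (phase_mem_graph x) h1
      simp only [ContinuousLinearMap.bilinearComp_apply, posL_apply, velL_apply, opPosL_apply,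
        innerSL_apply_apply, _root_.sub_apply, pos_waveApprox]
      rw [real_inner_comm (opPos x), h2, inner_neg_right, sub_neg_eq_add]; rfl) ht
  simpa [real_inner_self_eq_norm_sq] using this

/-- The energy `‖A u‖² + ‖v‖²` is conserved up to the work of `h`; the term with `⟪u, v⟫` is the
derivative of `‖u‖²`. -/
lemma IsWaveMild.norm_sq {t : ℝ} (ht : t ∈ Icc 0 b) :
    ‖z t‖ ^ 2 = ‖z 0‖ ^ 2 + ((∫ s in (0 : ℝ)..t, 2 * ⟪pos (z s), vel (z s)⟫_ℝ)
        + 2 * ∫ s in (0 : ℝ)..t, ⟪h s, vel (z s)⟫_ℝ) := by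
  obtain ⟨Z, F', K, hap⟩ := hz.exists_isMildApprox hb hh
  have := hap.apply_bilinear norm_phaseApproxId_apply_le tendsto_phaseApproxId
    (β := innerSL ℝ) (δ := (2 : ℝ) • (innerSL ℝ).bilinearComp (posL A) (velL A)) (fun n x => by
      change ⟪waveApprox A n x, x⟫_ℝ + ⟪x, waveApprox A n x⟫_ℝ
        = 2 * ⟪approxId A n (pos x), vel x⟫_ℝ
      rw [real_inner_comm _ x, inner_waveApprox, two_mul]) ht
  replace this : ⟪z t, z t⟫_ℝ = ⟪z 0, z 0⟫_ℝ
      + ((∫ s in (0 : ℝ)..t, 2 * ⟪pos (z s), vel (z s)⟫_ℝ)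
        + ((∫ s in (0 : ℝ)..t, ⟪force A (h s), z s⟫_ℝ)
          + ∫ s in (0 : ℝ)..t, ⟪z s, force A (h s)⟫_ℝ)) := this
  have e1 : ∀ x y, ⟪force A x, y⟫_ℝ = ⟪x, vel y⟫_ℝ := fun x y => by
    rw [inner_phase, pos_force, opPos_force, vel_force, inner_zero_left, inner_zero_left,
      zero_add, zero_add]
  have e2 : ∀ x y, ⟪y, force A x⟫_ℝ = ⟪x, vel y⟫_ℝ := fun x y => by rw [real_inner_comm, e1]
  simp only [e1, e2, real_inner_self_eq_norm_sq] at this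
  rw [this, two_mul (∫ s in (0 : ℝ)..t, ⟪h s, vel (z s)⟫_ℝ)]

end Identities

lemma IsWaveMild.phaseMap (hz : IsWaveMild A b h z) (hh : IntervalIntegrable h volume 0 b)
    {P : H →L[ℝ] H} (hP : CommutesWith A P) :
    IsWaveMild A b (fun s => P (h s)) fun t => phaseMap P hP (z t) := by
  intro t ht
  have hi : IntervalIntegrable (fun s => waveGroup A (-s) (force A (h s))) volume 0 t :=
    intervalIntegrable_waveGroup_force (hh.mono_set (by
      rw [uIcc_of_le ht.1, uIcc_of_le (ht.1.trans ht.2)]; exact Icc_subset_Icc_right ht.2))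
  change ConstrainedWave.phaseMap P hP (z t) = _
  rw [hz t ht, commute_waveGroup, map_add, ← ContinuousLinearMap.intervalIntegral_comp_comm _ hi]
  congr 3
  funext s
  rw [commute_waveGroup]
  congr 1
  exact phase_ext (map_zero P) rfl

/-- Continuous dependence, in the form of uniqueness. -/
lemma IsWaveMild.eqOn {φ : ℝ → ℝ} (hφ : L2Loc φ) (hφ0 : ∀ s, 0 ≤ φ s) {C : ℝ} (hC : 0 ≤ C)
    {k : ℝ → H} {w : ℝ → PhaseSpace A} (hz : IsWaveMild A b h z) (hw : IsWaveMild A b k w)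
    (hh : IntervalIntegrable h volume 0 b) (hk : IntervalIntegrable k volume 0 b)
    (hzc : ContinuousOn z (Icc 0 b)) (hwc : ContinuousOn w (Icc 0 b)) (h0 : z 0 = w 0)
    (hL : ∀ s ∈ Icc 0 b, ‖h s - k s‖ ≤ C * φ s * ‖z s - w s‖) : EqOn z w (Icc 0 b) := by
  have hmain := eq_zero_of_le_integral hφ hφ0 (b := b) (C := Real.exp b * (Real.exp b * C))
    (D := fun s => ‖z s - w s‖) (by positivity) (hzc.sub hwc).norm (fun _ _ => norm_nonneg _) ?_
  · exact fun t ht => sub_eq_zero.1 (norm_eq_zero.1 (hmain t ht))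
  intro t ht
  have hsub : uIcc 0 t ⊆ uIcc 0 b := by
    rw [uIcc_of_le ht.1, uIcc_of_le (ht.1.trans ht.2)]; exact Icc_subset_Icc_right ht.2
  have hsub' : uIcc 0 t ⊆ Icc 0 b := by
    rw [uIcc_of_le ht.1]; exact Icc_subset_Icc_right ht.2
  have hi := intervalIntegrable_waveGroup_force (A := A) (hh.mono_set hsub)
  have hj := intervalIntegrable_waveGroup_force (A := A) (hk.mono_set hsub)
  rw [hz t ht, hw t ht, h0, ← map_sub, add_sub_add_left_eq_sub, ← intervalIntegral.integral_sub hi hj]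
  refine (norm_waveGroup_apply_le t _).trans ?_
  have hgoal : ∫ s in (0 : ℝ)..t, Real.exp b * (Real.exp b * C) * φ s * ‖z s - w s‖
      = Real.exp b * ∫ s in (0 : ℝ)..t, Real.exp b * C * φ s * ‖z s - w s‖ := by
    rw [← intervalIntegral.integral_const_mul]; congr 1; funext s; ring
  rw [hgoal, abs_of_nonneg ht.1]
  refine mul_le_mul (Real.exp_le_exp.2 ht.2) ?_ (norm_nonneg _) (Real.exp_pos _).le
  refine intervalIntegral.norm_integral_le_of_norm_le ht.1 (ae_of_all _ fun s hs => ?_) ?_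
  · have hs' : s ∈ Icc 0 b := ⟨hs.1.le, hs.2.trans ht.2⟩
    rw [← map_sub, ← force_sub]
    refine (norm_waveGroup_apply_le _ _).trans ?_
    rw [norm_force, abs_neg, abs_of_nonneg hs'.1, mul_assoc, mul_assoc]
    refine mul_le_mul (Real.exp_le_exp.2 hs'.2) ?_ (norm_nonneg _) (Real.exp_pos _).le
    simpa only [mul_assoc] using hL s hs'
  · exact ((hφ.intervalIntegrable 0 t).const_mul _).mul_continuousOn
      ((hzc.sub hwc).norm.mono hsub')

/-- Global mild solvability of the wave equation with a globally Lipschitz nonlinearity. -/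
lemma exists_isWaveMild {φ : ℝ → ℝ} {N : ℝ → PhaseSpace A → H} (hN : IsCaratheodory φ N)
    (hφ : L2Loc φ) (hφ0 : ∀ s, 0 ≤ φ s) (z₀ : PhaseSpace A) :
    ∃ z : ℝ → PhaseSpace A, Continuous z ∧ z 0 = z₀ ∧
      ∀ b, IsWaveMild A b (fun s => N s (z s)) z := by
  have hc : ∀ y : ℝ → PhaseSpace A, Continuous y → Continuous fun s => waveGroup A s (y s) :=
    fun y hy => continuous_group_apply continuous_waveGroup hy
  -- For `y(t) = S(-t) z(t)` the mild equation becomes an integral equation without a linear part,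
  -- to which `IsCaratheodory.exists_solution` applies.
  have hG : IsCaratheodory φ fun s y => waveGroup A (-s) (force A (N s (waveGroup A s y))) := by
    refine ⟨fun y hy a b => ?_, fun b => ?_⟩
    · exact intervalIntegrable_waveGroup_force (hN.intervalIntegrable _ (hc y hy) a b)
    · obtain ⟨C, hC, hL⟩ := hN.lipschitz b
      refine ⟨Real.exp b * (C * Real.exp b), by positivity, fun s hs x y => ?_⟩
      rw [← map_sub, ← force_sub]
      refine (norm_waveGroup_apply_le _ _).trans ?_
      have h1 := hL s hs (waveGroup A s x) (waveGroup A s y)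
      rw [← map_sub] at h1
      have h2 := norm_waveGroup_apply_le s (x - y)
      rw [abs_of_nonneg hs.1] at h2
      have h3 := Real.exp_le_exp.2 hs.2
      rw [norm_force, abs_neg, abs_of_nonneg hs.1]
      have h4 := hφ0 s
      calc _ ≤ Real.exp b * (C * φ s * (Real.exp b * ‖x - y‖)) := by
            refine mul_le_mul h3 (h1.trans ?_) (norm_nonneg _) (Real.exp_pos _).le
            refine mul_le_mul_of_nonneg_left (h2.trans ?_) (by positivity)
            gcongr
        _ = _ := by ring
  obtain ⟨y, hyc, hy⟩ := hG.exists_solution hφ hφ0 z₀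
  have hy0 : y 0 = z₀ := by simpa using hy 0 le_rfl
  refine ⟨fun t => waveGroup A t (y t), hc y hyc, ?_, fun b t ht => ?_⟩
  · simp [waveGroup_zero, hy0]
  · simp only [waveGroup_zero, hy0]
    rw [hy t ht.1]; rfl

end MildSolutions

/-! ### The nonlinearity -/

section Nonlinearity

variable {H : Type*} [NormedAddCommGroup H] [InnerProductSpace ℝ H] {A : H →ₗ.[ℝ] H}

/-- The Lagrange multiplier of the constraint `‖u‖ = 1`. -/
def multiplier (z : PhaseSpace A) (h : H) : ℝ := ‖opPos z‖ ^ 2 - ‖vel z‖ ^ 2 - ⟪h, pos z⟫_ℝ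

/-- The normal part of `f` joins the multiplier, and `f` itself remains as an additive term. Both
the cancellation in the constraint and the freezing of the coefficient rely on this form. -/
lemma nonlinearity_eq (γ : ℝ) (z : PhaseSpace A) (h : H) :
    nonlinearity γ z h = multiplier z h • pos z - γ • vel z + h := by
  simp only [nonlinearity, multiplier, tangentProj, sub_smul]
  abel

lemma abs_multiplier_le {z : PhaseSpace A} {r : ℝ} (hz : ‖z‖ ≤ r) (h : H) :
    |multiplier z h| ≤ (r ^ 2 + r) * (1 + ‖h‖) := by
  have hr : 0 ≤ r := (norm_nonneg _).trans hz
  have h1 : ‖opPos z‖ ^ 2 ≤ r ^ 2 :=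
    pow_le_pow_left₀ (norm_nonneg _) ((norm_opPos_le z).trans hz) 2
  have h2 : ‖vel z‖ ^ 2 ≤ r ^ 2 := pow_le_pow_left₀ (norm_nonneg _) ((norm_vel_le z).trans hz) 2
  have h3 := abs_le.1 (abs_real_inner_le_norm h (pos z))
  have h4 : ‖h‖ * ‖pos z‖ ≤ ‖h‖ * r :=
    mul_le_mul_of_nonneg_left ((norm_pos_le z).trans hz) (norm_nonneg _)
  have h5 : 0 ≤ r ^ 2 * ‖h‖ := by positivity
  rw [multiplier, abs_le]
  constructor <;> nlinarith [sq_nonneg ‖opPos z‖, sq_nonneg ‖vel z‖]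

/-- The three terms of the difference contribute `r² + r‖h‖`, `(4r + ‖h‖) r` and `γ`. The dependence
on `h` is linear, so with `h = f(s)` the Lipschitz constant is locally square integrable in time. -/
lemma norm_nonlinearity_sub_le {γ : ℝ} (hγ : 0 ≤ γ) {z w : PhaseSpace A} {r : ℝ} (hz : ‖z‖ ≤ r)
    (hw : ‖w‖ ≤ r) (h : H) :
    ‖nonlinearity γ z h - nonlinearity γ w h‖
      ≤ (5 * r ^ 2 + 2 * r + γ) * (1 + ‖h‖) * ‖z - w‖ := by
  have hr : 0 ≤ r := (norm_nonneg _).trans hz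
  set d := ‖z - w‖ with hd
  have hd0 : 0 ≤ d := norm_nonneg _
  have hp : ‖pos z - pos w‖ ≤ d := by rw [← pos_sub]; exact norm_pos_le _
  have ho : ‖opPos z - opPos w‖ ≤ d := by rw [← opPos_sub]; exact norm_opPos_le _
  have hv : ‖vel z - vel w‖ ≤ d := by rw [← vel_sub]; exact norm_vel_le _
  have sq_sub : ∀ x y : H, ‖x‖ ≤ r → ‖y‖ ≤ r → ‖x - y‖ ≤ d →
      |‖x‖ ^ 2 - ‖y‖ ^ 2| ≤ 2 * r * d := fun x y hx hy hxy => by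
    rw [sq_sub_sq, abs_mul, abs_of_nonneg (by positivity)]
    exact mul_le_mul (by linarith) ((abs_norm_sub_norm_le x y).trans hxy) (abs_nonneg _)
      (by positivity)
  have h1 : |multiplier z h| ≤ (r ^ 2 + r * ‖h‖) := by
    have h1 : ‖opPos z‖ ^ 2 ≤ r ^ 2 :=
      pow_le_pow_left₀ (norm_nonneg _) ((norm_opPos_le z).trans hz) 2
    have h2 : ‖vel z‖ ^ 2 ≤ r ^ 2 :=
      pow_le_pow_left₀ (norm_nonneg _) ((norm_vel_le z).trans hz) 2
    have h3 := abs_le.1 (abs_real_inner_le_norm h (pos z))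
    have h4 : ‖h‖ * ‖pos z‖ ≤ ‖h‖ * r :=
      mul_le_mul_of_nonneg_left ((norm_pos_le z).trans hz) (norm_nonneg _)
    rw [multiplier, abs_le]
    constructor <;> nlinarith [sq_nonneg ‖opPos z‖, sq_nonneg ‖vel z‖]
  have h2 : |multiplier z h - multiplier w h| ≤ (4 * r + ‖h‖) * d := by
    have e1 := abs_le.1 (sq_sub _ _ ((norm_opPos_le z).trans hz) ((norm_opPos_le w).trans hw) ho)
    have e2 := abs_le.1 (sq_sub _ _ ((norm_vel_le z).trans hz) ((norm_vel_le w).trans hw) hv)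
    have e3 := abs_le.1 ((abs_real_inner_le_norm h (pos z - pos w)).trans
      (mul_le_mul_of_nonneg_left hp (norm_nonneg _)))
    rw [inner_sub_right] at e3
    rw [multiplier, multiplier, abs_le]
    constructor <;> nlinarith
  have h3 : nonlinearity γ z h - nonlinearity γ w h = multiplier z h • (pos z - pos w)
      + (multiplier z h - multiplier w h) • pos w - γ • (vel z - vel w) := by
    rw [nonlinearity_eq, nonlinearity_eq]
    module
  rw [h3]
  calc _ ≤ |multiplier z h| * ‖pos z - pos w‖ + |multiplier z h - multiplier w h| * ‖pos w‖
          + γ * ‖vel z - vel w‖ := by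
        refine (norm_sub_le _ _).trans (add_le_add ((norm_add_le _ _).trans (le_of_eq ?_))
          (le_of_eq ?_))
        · rw [norm_smul, norm_smul, Real.norm_eq_abs, Real.norm_eq_abs]
        · rw [norm_smul, Real.norm_of_nonneg hγ]
    _ ≤ (r ^ 2 + r * ‖h‖) * d + (4 * r + ‖h‖) * d * r + γ * d := by
        gcongr
        exact (norm_pos_le w).trans hw
    _ ≤ _ := by
        have : 0 ≤ (5 * r ^ 2 + γ) * ‖h‖ * d + 2 * r * d := by positivity
        nlinarith

variable {f : ℝ → H} {z : ℝ → PhaseSpace A} {a b : ℝ}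

lemma intervalIntegrable_inner (hf : IntervalIntegrable f volume a b) {u : ℝ → H}
    (hu : ContinuousOn u (uIcc a b)) :
    IntervalIntegrable (fun s => ⟪f s, u s⟫_ℝ) volume a b := by
  refine (hf.norm.mul_continuousOn hu.norm).mono_fun ?_ (ae_of_all _ fun s => ?_)
  · refine hf.def'.1.inner ?_
    exact ((hu.mono uIoc_subset_uIcc).aestronglyMeasurable measurableSet_uIoc)
  · change _ ≤ ‖‖f s‖ * ‖u s‖‖
    rw [Real.norm_of_nonneg (by positivity)]
    exact abs_real_inner_le_norm _ _

lemma intervalIntegrable_multiplier (hf : IntervalIntegrable f volume a b)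
    (hz : ContinuousOn z (uIcc a b)) :
    IntervalIntegrable (fun s => multiplier (z s) (f s)) volume a b :=
  (((continuous_opPos.comp_continuousOn hz).norm.pow 2).intervalIntegrable.sub
    ((continuous_vel.comp_continuousOn hz).norm.pow 2).intervalIntegrable).sub
    (intervalIntegrable_inner hf (continuous_pos.comp_continuousOn hz))

lemma intervalIntegrable_nonlinearity (γ : ℝ) (hf : IntervalIntegrable f volume a b)
    (hz : ContinuousOn z (uIcc a b)) :
    IntervalIntegrable (fun s => nonlinearity γ (z s) (f s)) volume a b := by
  simp only [nonlinearity_eq]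
  exact (((intervalIntegrable_multiplier hf hz).smul_continuousOn
    (continuous_pos.comp_continuousOn hz)).sub
    ((continuous_vel.comp_continuousOn hz).const_smul γ).intervalIntegrable).add hf

end Nonlinearity

/-! ### The radial retraction onto a ball -/

section Retract

variable {X : Type*} [NormedAddCommGroup X] [NormedSpace ℝ X]

/-- The radial retraction onto the closed ball of radius `r`. -/
def retract (r : ℝ) (x : X) : X := (r / max r ‖x‖) • x

lemma retract_of_norm_le {r : ℝ} (hr : 0 < r) {x : X} (hx : ‖x‖ ≤ r) : retract r x = x := by
  rw [retract, max_eq_left hx, div_self hr.ne', one_smul]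

lemma norm_retract_le {r : ℝ} (hr : 0 < r) (x : X) : ‖retract r x‖ ≤ r := by
  have hm : 0 < max r ‖x‖ := lt_max_of_lt_left hr
  rw [retract, norm_smul, Real.norm_of_nonneg (by positivity), div_mul_eq_mul_div, div_le_iff₀ hm]
  exact mul_le_mul_of_nonneg_left (le_max_right _ _) hr.le

lemma norm_retract_sub_le {r : ℝ} (hr : 0 < r) (x y : X) :
    ‖retract r x - retract r y‖ ≤ 2 * ‖x - y‖ := by
  have hx : 0 < max r ‖x‖ := lt_max_of_lt_left hr
  have hy : 0 < max r ‖y‖ := lt_max_of_lt_left hr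
  have h1 : retract r x - retract r y = (r / max r ‖x‖) • (x - y)
      + (r / max r ‖x‖ - r / max r ‖y‖) • y := by
    rw [retract, retract]; module
  have h2 : r / max r ‖x‖ ≤ 1 := (div_le_one hx).2 (le_max_left _ _)
  have h3 : |r / max r ‖x‖ - r / max r ‖y‖| * ‖y‖ ≤ ‖x - y‖ := by
    have e1 : r / max r ‖x‖ - r / max r ‖y‖
        = r / max r ‖x‖ * ((max r ‖y‖ - max r ‖x‖) / max r ‖y‖) := by
      field_simp
    have e2 : |max r ‖y‖ - max r ‖x‖| ≤ ‖x - y‖ := by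
      refine (abs_max_sub_max_le_max r ‖y‖ r ‖x‖).trans (max_le (by simp) ?_)
      rw [abs_sub_comm]
      exact abs_norm_sub_norm_le x y
    rw [e1, abs_mul, abs_of_nonneg (by positivity : 0 ≤ r / max r ‖x‖), abs_div,
      abs_of_pos hy, mul_assoc]
    have e3 : |max r ‖y‖ - max r ‖x‖| / max r ‖y‖ * ‖y‖ ≤ ‖x - y‖ := by
      rw [div_mul_eq_mul_div, div_le_iff₀ hy]
      exact mul_le_mul e2 (le_max_right _ _) (norm_nonneg _) (norm_nonneg _)
    have e4 : 0 ≤ |max r ‖y‖ - max r ‖x‖| / max r ‖y‖ * ‖y‖ := by positivity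
    exact (mul_le_of_le_one_left e4 h2).trans e3
  rw [h1]
  refine (norm_add_le _ _).trans ?_
  rw [norm_smul, norm_smul, Real.norm_eq_abs, Real.norm_eq_abs,
    abs_of_nonneg (by positivity : 0 ≤ r / max r ‖x‖)]
  nlinarith [norm_nonneg (x - y)]

lemma continuous_retract {r : ℝ → ℝ} (hr : Continuous r) (hr0 : ∀ s, 0 < r s) {x : ℝ → X}
    (hx : Continuous x) : Continuous fun s => retract (r s) (x s) :=
  (hr.div (hr.max hx.norm) fun s => (lt_max_of_lt_left (hr0 s)).ne').smul hx

end Retract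

/-! ### A priori estimates -/

lemma L2Loc.one_add_norm {E : Type*} [NormedAddCommGroup E] {f : ℝ → E} (hf : L2Loc f) :
    L2Loc fun s => 1 + ‖f s‖ := fun a b => by
  have h1 : MemLp (fun _ : ℝ => (1 : ℝ)) 2 (volume.restrict (Ioc a b)) := memLp_const 1
  exact h1.add (hf a b).norm

lemma exists_norm_le {X : Type*} [NormedAddCommGroup X] {z : ℝ → X} {b : ℝ}
    (hzc : ContinuousOn z (Icc 0 b)) : ∃ r : ℝ, 0 ≤ r ∧ ∀ s ∈ Icc 0 b, ‖z s‖ ≤ r := by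
  obtain ⟨r, hr⟩ := isCompact_Icc.exists_bound_of_continuousOn hzc
  exact ⟨max r 0, le_max_right _ _, fun s hs => (hr s hs).trans (le_max_left _ _)⟩

section APriori

variable {H : Type*} [NormedAddCommGroup H] [InnerProductSpace ℝ H] [CompleteSpace H]
  {A : H →ₗ.[ℝ] H} [hA : Fact (IsSelfAdjoint A)]

variable {γ b : ℝ} {f : ℝ → H} {z : ℝ → PhaseSpace A}

/-- The constraint `‖u‖ = 1`, `⟪u, u'⟫ = 0` is preserved. -/
lemma IsWaveMild.constraint (hγ : 0 ≤ γ) (hf : L2Loc f) (hzc : ContinuousOn z (Icc 0 b))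
    (hz : IsWaveMild A b (fun s => nonlinearity γ (z s) (f s)) z)
    (hp : ‖pos (z 0)‖ = 1) (hq : ⟪pos (z 0), vel (z 0)⟫_ℝ = 0) :
    ∀ t ∈ Icc 0 b, ‖pos (z t)‖ = 1 ∧ ⟪pos (z t), vel (z t)⟫_ℝ = 0 := by
  intro t₀ ht₀
  have hb : 0 ≤ b := ht₀.1.trans ht₀.2
  have hzu : ContinuousOn z (uIcc 0 b) := by rwa [uIcc_of_le hb]
  have hh := intervalIntegrable_nonlinearity γ (hf.intervalIntegrable 0 b) hzu
  obtain ⟨r, hr, hzr⟩ := exists_norm_le hzc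
  have hpc := continuous_pos.comp_continuousOn hzc
  have hvc := continuous_vel.comp_continuousOn hzc
  -- The defects `p` and `q` solve `p' = 2q`, `q' = λ p - γ q` with zero initial values, where `λ`
  -- is the multiplier.
  set p : ℝ → ℝ := fun s => ‖pos (z s)‖ ^ 2 - 1 with hpdef
  set q : ℝ → ℝ := fun s => ⟪pos (z s), vel (z s)⟫_ℝ with hqdef
  have hpc' : ContinuousOn p (Icc 0 b) := (hpc.norm.pow 2).sub continuousOn_const
  have hqc' : ContinuousOn q (Icc 0 b) := hpc.inner hvc
  have key := eq_zero_of_le_integral hf.one_add_norm (fun s => by positivity) (b := b)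
    (C := 2 + γ + (r ^ 2 + r)) (D := fun s => |p s| + |q s|) (by positivity)
    (hpc'.abs.add hqc'.abs) (fun _ _ => by positivity) (fun t ht => ?_) t₀ ht₀
  · have h1 : |p t₀| = 0 := by linarith [abs_nonneg (p t₀), abs_nonneg (q t₀)]
    have h2 : |q t₀| = 0 := by linarith [abs_nonneg (p t₀), abs_nonneg (q t₀)]
    refine ⟨?_, abs_eq_zero.1 h2⟩
    have h3 : ‖pos (z t₀)‖ ^ 2 = 1 := sub_eq_zero.1 (abs_eq_zero.1 h1)
    exact (pow_eq_one_iff_of_nonneg (norm_nonneg _) two_ne_zero).1 h3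
  have hsub : Icc 0 t ⊆ Icc 0 b := Icc_subset_Icc_right ht.2
  have hsub' : uIcc 0 t ⊆ Icc 0 b := by rwa [uIcc_of_le ht.1]
  have hqi : IntervalIntegrable q volume 0 t := (hqc'.mono hsub').intervalIntegrable
  have hci : IntervalIntegrable (fun s => multiplier (z s) (f s) * p s) volume 0 t :=
    (intervalIntegrable_multiplier (hf.intervalIntegrable 0 t) (hzc.mono hsub')).mul_continuousOn
      (hpc'.mono hsub')
  have ep : p t = ∫ s in (0 : ℝ)..t, 2 * q s := by
    simp only [hpdef, hz.norm_sq_pos hb hh ht, hp]; ring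
  have eq : q t = ∫ s in (0 : ℝ)..t, (multiplier (z s) (f s) * p s - γ * q s) := by
    have e1 : IntervalIntegrable (fun s => ‖vel (z s)‖ ^ 2 - ‖opPos (z s)‖ ^ 2) volume 0 t :=
      (((hvc.norm.pow 2).sub ((continuous_opPos.comp_continuousOn hzc).norm.pow 2)).mono
        hsub').intervalIntegrable
    have e2 : IntervalIntegrable (fun s => ⟪pos (z s), nonlinearity γ (z s) (f s)⟫_ℝ) volume 0 t := by
      simp only [real_inner_comm (nonlinearity γ _ _)]
      exact intervalIntegrable_inner (intervalIntegrable_nonlinearity γ (hf.intervalIntegrable 0 t)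
        (hzc.mono hsub')) (hpc.mono hsub')
    have e3 := hz.inner_pos_vel hb hh ht
    rw [hq, zero_add, ← intervalIntegral.integral_add e1 e2] at e3
    rw [hqdef]
    refine e3.trans (intervalIntegral.integral_congr fun s _ => ?_)
    -- The terms `‖v‖² - ‖A u‖² + ⟪u, f⟫` equal `-λ`, so that `λ ‖u‖²` becomes `λ p`.
    simp only [nonlinearity_eq, inner_add_right, inner_sub_right, real_inner_smul_right,
      real_inner_self_eq_norm_sq, hpdef, real_inner_comm (f s)]
    simp only [multiplier]
    rw [real_inner_comm (pos (z s)) (f s)]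
    ring
  have habs : |p t| + |q t| ≤ (∫ s in (0 : ℝ)..t, |2 * q s|)
      + ∫ s in (0 : ℝ)..t, |multiplier (z s) (f s) * p s - γ * q s| := by
    rw [ep, eq]
    exact add_le_add (intervalIntegral.abs_integral_le_integral_abs ht.1)
      (intervalIntegral.abs_integral_le_integral_abs ht.1)
  refine habs.trans ?_
  have i1 : IntervalIntegrable (fun s => |2 * q s|) volume 0 t := (hqi.const_mul 2).abs
  have i2 : IntervalIntegrable (fun s => |multiplier (z s) (f s) * p s - γ * q s|) volume 0 t :=
    (hci.sub (hqi.const_mul γ)).abs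
  rw [← intervalIntegral.integral_add i1 i2]
  refine intervalIntegral.integral_mono_on ht.1 (i1.add i2) ?_ fun s hs => ?_
  · exact ((hf.one_add_norm.intervalIntegrable 0 t).const_mul _).mul_continuousOn
      ((hpc'.abs.add hqc'.abs).mono hsub')
  · have e1 := abs_multiplier_le (hzr s (hsub hs)) (f s)
    have e2 := abs_sub (multiplier (z s) (f s) * p s) (γ * q s)
    rw [abs_mul, abs_mul, abs_of_nonneg hγ] at e2
    rw [abs_mul, abs_of_pos (two_pos : (0 : ℝ) < 2)]
    have e3 := mul_le_mul_of_nonneg_right e1 (abs_nonneg (p s))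
    have e4 : 0 ≤ (2 + γ) * ‖f s‖ * |q s| + (2 + γ) * (1 + ‖f s‖) * |p s|
      + (r ^ 2 + r) * (1 + ‖f s‖) * |q s| := by positivity
    nlinarith

/-- The energy estimate. -/
lemma IsWaveMild.norm_sq_le (hγ : 0 < γ) (hf : L2Loc f) (hzc : ContinuousOn z (Icc 0 b))
    (hz : IsWaveMild A b (fun s => nonlinearity γ (z s) (f s)) z)
    (hp : ‖pos (z 0)‖ = 1) (hq : ⟪pos (z 0), vel (z 0)⟫_ℝ = 0) :
    ∀ t ∈ Icc 0 b, ‖z t‖ ^ 2 ≤ ‖z 0‖ ^ 2 + 1 / (2 * γ) * ∫ s in (0 : ℝ)..t, ‖f s‖ ^ 2 := by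
  intro t ht
  have hb : 0 ≤ b := ht.1.trans ht.2
  have hzu : ContinuousOn z (uIcc 0 b) := by rwa [uIcc_of_le hb]
  have hh := intervalIntegrable_nonlinearity γ (hf.intervalIntegrable 0 b) hzu
  have hcon := hz.constraint hγ.le hf hzc hp hq
  have hsub' : uIcc 0 t ⊆ Icc 0 b := by
    rw [uIcc_of_le ht.1]; exact Icc_subset_Icc_right ht.2
  have h1 : ∫ s in (0 : ℝ)..t, 2 * ⟪pos (z s), vel (z s)⟫_ℝ = 0 := by
    rw [intervalIntegral.integral_congr (g := fun _ => (0 : ℝ)) fun s hs => by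
      simp only [(hcon s (hsub' hs)).2, mul_zero]]
    simp
  rw [hz.norm_sq hb hh ht, h1, zero_add]
  have h2 : ∫ s in (0 : ℝ)..t, ⟪nonlinearity γ (z s) (f s), vel (z s)⟫_ℝ
      ≤ ∫ s in (0 : ℝ)..t, 1 / (4 * γ) * ‖f s‖ ^ 2 := by
    refine intervalIntegral.integral_mono_on ht.1 ?_
      ((hf.intervalIntegrable_norm_sq 0 t).const_mul _) fun s hs => ?_
    · exact intervalIntegrable_inner (intervalIntegrable_nonlinearity γ (hf.intervalIntegrable 0 t)
        (hzc.mono hsub')) (continuous_vel.comp_continuousOn (hzc.mono hsub'))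
    -- As `u ⊥ v`, only `⟪f, v⟫ - γ ‖v‖²` is left, and completing the square bounds it by `‖f‖² /
    -- (4γ)`.
    · have e1 := (hcon s ⟨hs.1, hs.2.trans ht.2⟩).2
      rw [nonlinearity_eq, inner_add_left, inner_sub_left, real_inner_smul_left,
        real_inner_smul_left, e1, mul_zero, zero_sub, real_inner_self_eq_norm_sq]
      have e2 := real_inner_le_norm (f s) (vel (z s))
      have e3 : 1 / (4 * γ) * ‖f s‖ ^ 2 + γ * ‖vel (z s)‖ ^ 2 - ‖f s‖ * ‖vel (z s)‖
          = (‖f s‖ - 2 * γ * ‖vel (z s)‖) ^ 2 / (4 * γ) := by field_simp; ring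
      have e4 : 0 ≤ (‖f s‖ - 2 * γ * ‖vel (z s)‖) ^ 2 / (4 * γ) := by positivity
      linarith
  rw [intervalIntegral.integral_const_mul] at h2
  have e : 1 / (2 * γ) * (∫ s in (0 : ℝ)..t, ‖f s‖ ^ 2)
      = 2 * (1 / (4 * γ) * ∫ s in (0 : ℝ)..t, ‖f s‖ ^ 2) := by
    field_simp
    ring
  rw [e]
  linarith

end APriori

/-! ### Global existence and uniqueness -/

/-- The radius may vary in time, because it is bounded on compact intervals. The factor `2` is the
Lipschitz constant of the retraction. -/
lemma isCaratheodory_nonlinearity_retract {H : Type*} [NormedAddCommGroup H]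
    [InnerProductSpace ℝ H] {A : H →ₗ.[ℝ] H} {γ : ℝ} {f : ℝ → H} (hγ : 0 ≤ γ) (hf : L2Loc f) {R : ℝ → ℝ}
    (hR : Continuous R) (hR0 : ∀ s, 0 < R s) :
    IsCaratheodory (fun s => 1 + ‖f s‖)
      fun s (z : PhaseSpace A) => nonlinearity γ (retract (R s) z) (f s) := by
  refine ⟨fun y hy a b => intervalIntegrable_nonlinearity γ (hf.intervalIntegrable a b)
    (continuous_retract hR hR0 hy).continuousOn, fun b => ?_⟩
  obtain ⟨r, hr, hRr⟩ := exists_norm_le (hR.continuousOn (s := Icc 0 b))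
  refine ⟨(5 * r ^ 2 + 2 * r + γ) * 2, by positivity, fun s hs x y => ?_⟩
  have h1 : R s ≤ r := (le_abs_self _).trans (hRr s hs)
  refine (norm_nonlinearity_sub_le hγ ((norm_retract_le (hR0 s) x).trans h1)
    ((norm_retract_le (hR0 s) y).trans h1) (f s)).trans ?_
  have h2 := mul_le_mul_of_nonneg_left (norm_retract_sub_le (hR0 s) x y)
    (by positivity : 0 ≤ (5 * r ^ 2 + 2 * r + γ) * (1 + ‖f s‖))
  linarith

section Global

variable {H : Type*} [NormedAddCommGroup H] [InnerProductSpace ℝ H] [CompleteSpace H]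
  {A : H →ₗ.[ℝ] H} [hA : Fact (IsSelfAdjoint A)] {γ : ℝ} {f : ℝ → H}

/-- Global mild solvability of the constrained wave equation. -/
lemma exists_constrained_isWaveMild (hγ : 0 < γ) (hf : L2Loc f) (z₀ : PhaseSpace A)
    (hp : ‖pos z₀‖ = 1) (hq : ⟪pos z₀, vel z₀⟫_ℝ = 0) :
    ∃ z : ℝ → PhaseSpace A, Continuous z ∧ z 0 = z₀ ∧
      ∀ b, IsWaveMild A b (fun s => nonlinearity γ (z s) (f s)) z := by
  -- The right-hand side of the energy estimate; the absolute value keeps it nonnegative for `t <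
  -- 0`.
  set E : ℝ → ℝ := fun t => ‖z₀‖ ^ 2 + 1 / (2 * γ) * |∫ s in (0 : ℝ)..t, ‖f s‖ ^ 2| with hE
  have hE0 : ∀ t, 0 ≤ E t := fun t => by positivity
  have hEc : Continuous E := continuous_const.add (continuous_const.mul
    (intervalIntegral.continuous_primitive (fun a b => hf.intervalIntegrable_norm_sq a b) 0).abs)
  -- The summand `1` makes the radius strictly larger than the a priori bound, which leaves room for
  -- the continuation argument.
  set R : ℝ → ℝ := fun t => √(1 + E t) with hRdef
  have hR : Continuous R := (continuous_const.add hEc).sqrt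
  have hR0 : ∀ s, 0 < R s := fun s => Real.sqrt_pos.2 (by linarith [hE0 s])
  obtain ⟨z, hzc, hz0, hz⟩ := exists_isWaveMild
    (isCaratheodory_nonlinearity_retract (A := A) hγ.le hf hR hR0) hf.one_add_norm
    (fun s => by positivity) z₀
  have hmild : ∀ b, (∀ s ∈ Icc 0 b, ‖z s‖ ≤ R s) →
      IsWaveMild A b (fun s => nonlinearity γ (z s) (f s)) z := fun b h =>
    (hz b).congr_ae ((ae_restrict_iff' measurableSet_Ioc).2 (ae_of_all _ fun s hs => by
      rw [retract_of_norm_le (hR0 s) (h s ⟨hs.1.le, hs.2⟩)]))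
  refine ⟨z, hzc, hz0, fun b => hmild b ?_⟩
  have hcl : IsClosed ({t | ‖z t‖ ≤ R t} ∩ Icc 0 b) :=
    (isClosed_le hzc.norm hR).inter isClosed_Icc
  have hlt : ∀ t, 0 ≤ t → (∀ s ∈ Icc 0 t, ‖z s‖ ≤ R s) → ‖z t‖ < R t := fun t ht h => by
    have h1 := (hmild t h).norm_sq_le hγ hf hzc.continuousOn (by rw [hz0, hp]) (by rw [hz0, hq])
      t ⟨ht, le_rfl⟩
    refine Real.lt_sqrt_of_sq_lt (h1.trans_lt ?_)
    have h2 := mul_le_mul_of_nonneg_left (le_abs_self (∫ s in (0 : ℝ)..t, ‖f s‖ ^ 2))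
      (by positivity : 0 ≤ 1 / (2 * γ))
    simp only [hE, hz0]
    linarith
  -- Continuous induction: while `‖z‖ ≤ R` on `[0, t]`, the cut-off is inactive there and the energy
  -- estimate gives `‖z t‖ < R t`, so the bound persists beyond `t`.
  refine fun s hs => hcl.Icc_subset_of_forall_mem_nhdsGT_of_Icc_subset ?_ (fun t ht h => ?_) hs
  · refine Real.le_sqrt_of_sq_le ?_
    simp only [hz0, hE, intervalIntegral.integral_same, abs_zero, mul_zero, add_zero]
    linarith
  · have := hlt t ht.1 h
    exact mem_nhdsWithin_of_mem_nhds (((continuous_iff_continuousAt.1 hzc.norm t).eventually_lt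
      (continuous_iff_continuousAt.1 hR t) this).mono fun s hs => le_of_lt hs)

/-- Uniqueness of mild solutions. -/
lemma IsWaveMild.eqOn_of_nonlinearity {b : ℝ} {z w : ℝ → PhaseSpace A} (hγ : 0 ≤ γ) (hf : L2Loc f)
    (hzc : ContinuousOn z (Icc 0 b)) (hwc : ContinuousOn w (Icc 0 b)) (h0 : z 0 = w 0)
    (hz : IsWaveMild A b (fun s => nonlinearity γ (z s) (f s)) z)
    (hw : IsWaveMild A b (fun s => nonlinearity γ (w s) (f s)) w) : EqOn z w (Icc 0 b) := by
  rcases lt_or_ge b 0 with hb | hb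
  · rw [Icc_eq_empty (not_le.2 hb)]; exact fun _ h => h.elim
  have hu := uIcc_of_le hb
  obtain ⟨r, hr, hzr⟩ := exists_norm_le hzc
  obtain ⟨r', hr', hwr⟩ := exists_norm_le hwc
  have hm : 0 ≤ max r r' := hr.trans (le_max_left _ _)
  exact hz.eqOn hf.one_add_norm (fun s => by positivity)
    (by positivity : 0 ≤ 5 * (max r r') ^ 2 + 2 * max r r' + γ) hw
    (intervalIntegrable_nonlinearity γ (hf.intervalIntegrable 0 b) (by rwa [hu]))
    (intervalIntegrable_nonlinearity γ (hf.intervalIntegrable 0 b) (by rwa [hu])) hzc hwc h0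
    fun s hs => norm_nonlinearity_sub_le hγ ((hzr s hs).trans (le_max_left _ _))
      ((hwr s hs).trans (le_max_right _ _)) (f s)

/-- Regularity: a mild solution stays in the range of `P` if the data are in it. -/
lemma exists_phaseMap_eq {P : H →L[ℝ] H} (hP : CommutesWith A P) {g : ℝ → H} (hg : L2Loc g)
    (hγ : 0 ≤ γ) {z : ℝ → PhaseSpace A} (hzc : Continuous z) {Y₀ : PhaseSpace A}
    (h0 : z 0 = phaseMap P hP Y₀)
    (hz : ∀ b, IsWaveMild A b (fun s => nonlinearity γ (z s) (P (g s))) z) :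
    ∃ (Y : ℝ → PhaseSpace A) (k : ℝ → H), Continuous Y ∧
      (∀ b, IsWaveMild A b k Y) ∧ (∀ b, IntervalIntegrable k volume 0 b) ∧
      ∀ t, 0 ≤ t → z t = phaseMap P hP (Y t) := by
  have hf : L2Loc fun s => P (g s) := fun a b => P.comp_memLp' (hg a b)
  set φ : ℝ → ℝ := fun s => 1 + ‖P (g s)‖ with hφ
  -- The multiplier is frozen along the given solution, which makes the remaining equation linear in
  -- `(u, v)`.
  set c : ℝ → ℝ := fun s => multiplier (z s) (P (g s)) with hc
  have hci : ∀ a b, IntervalIntegrable c volume a b := fun a b =>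
    intervalIntegrable_multiplier (hf.intervalIntegrable a b) hzc.continuousOn
  have hcb : ∀ b, ∃ C, 0 ≤ C ∧ ∀ s ∈ Icc 0 b, |c s| ≤ C * φ s := fun b => by
    obtain ⟨r, hr, hzr⟩ := exists_norm_le (hzc.continuousOn (s := Icc 0 b))
    exact ⟨r ^ 2 + r, by positivity, fun s hs => abs_multiplier_le (hzr s hs) _⟩
  have hlip : ∀ (C s : ℝ), |c s| ≤ C * φ s → ∀ x y : PhaseSpace A,
      ‖c s • (pos x - pos y) - γ • (vel x - vel y)‖ ≤ (C + γ) * φ s * ‖x - y‖ := by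
    intro C s hs x y
    refine (norm_sub_le _ _).trans ?_
    rw [norm_smul, norm_smul, Real.norm_eq_abs, Real.norm_of_nonneg hγ, ← pos_sub, ← vel_sub]
    have h1 : |c s| * ‖pos (x - y)‖ ≤ C * φ s * ‖x - y‖ :=
      mul_le_mul hs (norm_pos_le _) (norm_nonneg _) ((abs_nonneg _).trans hs)
    have h2 : γ * ‖vel (x - y)‖ ≤ γ * ‖x - y‖ := mul_le_mul_of_nonneg_left (norm_vel_le _) hγ
    have h3 : 0 ≤ γ * ‖P (g s)‖ * ‖x - y‖ := by positivity
    have h4 : (C + γ) * φ s * ‖x - y‖ = C * φ s * ‖x - y‖ + γ * ‖x - y‖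
      + γ * ‖P (g s)‖ * ‖x - y‖ := by simp only [hφ]; ring
    linarith
  have hNi : ∀ y : ℝ → PhaseSpace A, Continuous y → ∀ k : ℝ → H, L2Loc k → ∀ a b,
      IntervalIntegrable (fun s => c s • pos (y s) - γ • vel (y s) + k s) volume a b :=
    fun y hy k hk a b => (((hci a b).smul_continuousOn
      (continuous_pos.comp_continuousOn hy.continuousOn)).sub
      ((continuous_vel.comp_continuousOn hy.continuousOn).const_smul γ).intervalIntegrable).add
      (hk.intervalIntegrable a b)
  have hN : IsCaratheodory φ
      fun s (y : PhaseSpace A) => c s • pos y - γ • vel y + g s := by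
    refine ⟨fun y hy a b => hNi y hy g hg a b, fun b => ?_⟩
    obtain ⟨C, hC, hCb⟩ := hcb b
    refine ⟨C + γ, by positivity, fun s hs x y => ?_⟩
    refine le_trans (le_of_eq ?_) (hlip C s (hCb s hs) x y)
    congr 1
    module
  obtain ⟨Y, hYc, hY0, hY⟩ := exists_isWaveMild hN hf.one_add_norm (fun s => by positivity) Y₀
  refine ⟨Y, _, hYc, hY, hNi Y hYc g hg 0, fun t ht => ?_⟩
  obtain ⟨C, hC, hCb⟩ := hcb t
  have hYP := (hY t).phaseMap (hNi Y hYc g hg 0 t) hP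
  have hPYc : Continuous fun s => phaseMap P hP (Y s) := (phaseMap P hP).continuous.comp hYc
  -- With a scalar coefficient, `P` passes through the linear right-hand side. Hence the image of
  -- `Y` solves the frozen equation of `z`, and uniqueness identifies them.
  have e1 : ∀ s, P (c s • pos (Y s) - γ • vel (Y s) + g s)
      = c s • pos (phaseMap P hP (Y s)) - γ • vel (phaseMap P hP (Y s)) + P (g s) := fun s => by
    simp
  simp only [e1] at hYP
  have hz' := hz t
  simp only [nonlinearity_eq] at hz'
  refine hz'.eqOn hf.one_add_norm (fun s => by positivity) (by positivity : 0 ≤ C + γ) hYP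
    (hNi z hzc _ hf 0 t) (hNi _ hPYc _ hf 0 t) hzc.continuousOn hPYc.continuousOn
    (by rw [h0, hY0]) (fun s hs => ?_) ⟨ht, le_rfl⟩
  refine le_trans (le_of_eq ?_) (hlip C s (hCb s hs) _ _)
  congr 1
  simp only [hc]
  module

end Global

/-! ### The main result -/

section Primitive

variable {E : Type*} [NormedAddCommGroup E] [NormedSpace ℝ E] [CompleteSpace E] {u v : ℝ → E}
  {c : E}

lemma hasDerivWithinAt_of_eq_integral (hv : Continuous v)
    (hu : ∀ t, 0 ≤ t → u t = c + ∫ s in (0 : ℝ)..t, v s) {t : ℝ} (ht : 0 ≤ t) :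
    HasDerivWithinAt u (v t) (Ici 0) t :=
  (((hv.integral_hasStrictDerivAt 0 t).hasDerivAt.const_add c).hasDerivWithinAt).congr
    (fun s hs => hu s hs) (hu t ht)

lemma contDiffOn_of_eq_integral (hv : Continuous v)
    (hu : ∀ t, 0 ≤ t → u t = c + ∫ s in (0 : ℝ)..t, v s) : ContDiffOn ℝ 1 u (Ici 0) := by
  have hd : ∀ t, HasDerivAt (fun t => c + ∫ s in (0 : ℝ)..t, v s) (v t) t := fun t =>
    (hv.integral_hasStrictDerivAt 0 t).hasDerivAt.const_add c
  have h : ContDiff ℝ 1 fun t => c + ∫ s in (0 : ℝ)..t, v s := by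
    rw [contDiff_one_iff_deriv]
    refine ⟨fun t => (hd t).differentiableAt, ?_⟩
    rw [show deriv (fun t => c + ∫ s in (0 : ℝ)..t, v s) = v from funext fun t => (hd t).deriv]
    exact hv
  exact h.contDiffOn.congr fun t ht => hu t ht

end Primitive

section Main

variable {H : Type*} [NormedAddCommGroup H] [InnerProductSpace ℝ H] [CompleteSpace H]
  {A : H →ₗ.[ℝ] H} [hA : Fact (IsSelfAdjoint A)] {γ : ℝ} {f : ℝ → H}

/-- Links the factored form used in `IsWaveMild` to the convolution form of the statement. -/
lemma waveGroup_apply_add_integral {h : ℝ → H} {t : ℝ} (hh : IntervalIntegrable h volume 0 t)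
    (x : PhaseSpace A) :
    waveGroup A t (x + ∫ s in (0 : ℝ)..t, waveGroup A (-s) (force A (h s)))
      = waveGroup A t x + ∫ s in (0 : ℝ)..t, waveGroup A (t - s) (force A (h s)) := by
  rw [map_add, ← ContinuousLinearMap.intervalIntegral_comp_comm _
    (intervalIntegrable_waveGroup_force hh)]
  simp only [← waveGroup_add_apply, ← sub_eq_add_neg]

/-- On `(0, ∞)`, a function in `L²_loc([0, ∞); D(A ^ α))` is almost everywhere equal to
`A₁ ^ (-α) g` with `g` square integrable on bounded intervals. -/
lemma L2LocInFracDom.exists_l2Loc {H : Type*} [NormedAddCommGroup H] [InnerProductSpace ℝ H]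
    {A : H →ₗ.[ℝ] H} {α : ℝ} {f : ℝ → H} (hf : L2LocInFracDom A α f) :
    ∃ g : ℝ → H, L2Loc g ∧ ∀ᵐ t ∂(volume.restrict (Ioi (0 : ℝ))), f t = negPow A α (g t) := by
  obtain ⟨g, hg, hgL⟩ := hf
  -- Extension by zero: `L2Loc` refers to all bounded intervals, including those with negative
  -- times.
  refine ⟨(Ioi 0).indicator g, fun a b => ?_, ?_⟩
  · rw [memLp_indicator_iff_restrict measurableSet_Ioi, Measure.restrict_restrict measurableSet_Ioi]
    have h : Ioi 0 ∩ Ioc a b ⊆ Ioc 0 b := fun s hs => ⟨hs.1, hs.2.2⟩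
    exact (hgL b).mono_measure (Measure.restrict_mono h le_rfl)
  · rw [ae_restrict_iff' measurableSet_Ioi] at hg ⊢
    filter_upwards [hg] with s hs hs0
    rw [indicator_of_mem hs0]
    exact hs hs0

lemma ae_nonlinearity_eq {H : Type*} [NormedAddCommGroup H] [InnerProductSpace ℝ H]
    {A : H →ₗ.[ℝ] H} {γ : ℝ} {f f₁ : ℝ → H}
    (hff : ∀ᵐ t ∂(volume.restrict (Ioi (0 : ℝ))), f t = f₁ t)
    (z : ℝ → PhaseSpace A) (b : ℝ) :
    ∀ᵐ s ∂(volume.restrict (Ioc 0 b)),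
      nonlinearity γ (z s) (f s) = nonlinearity γ (z s) (f₁ s) := by
  filter_upwards [ae_mono (Measure.restrict_mono Ioc_subset_Ioi_self le_rfl) hff] with s hs
  rw [hs]

/-- Uniqueness of the group removes the existential over `S`, and `f` may be replaced by a
representative that is square integrable on all bounded intervals, since only its values almost
everywhere on `(0, ∞)` matter. -/
lemma isMildSolution_iff {f₁ : ℝ → H} (hf₁ : L2Loc f₁)
    (hff : ∀ᵐ t ∂(volume.restrict (Ioi (0 : ℝ))), f t = f₁ t) {z : ℝ → PhaseSpace A}
    (hz : ContinuousOn z (Ici 0)) :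
    IsMildSolution A γ f z ↔ ∀ b, IsWaveMild A b (fun s => nonlinearity γ (z s) (f₁ s)) z := by
  have hi : ∀ t, 0 ≤ t → IntervalIntegrable (fun s => nonlinearity γ (z s) (f s)) volume 0 t :=
    fun t ht => by
      refine (intervalIntegrable_nonlinearity γ (hf₁.intervalIntegrable 0 t) (hz.mono ?_)).congr_ae ?_
      · rw [uIcc_of_le ht]; exact Icc_subset_Ici_self
      · rw [uIoc_of_le ht]
        exact (ae_nonlinearity_eq hff z t).mono fun s hs => hs.symm
  constructor
  · rintro ⟨S, hS, hG, h⟩ b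
    obtain rfl := eq_waveGroup hS hG
    refine IsWaveMild.congr_ae (fun t ht => ?_) (ae_nonlinearity_eq hff z b)
    rw [waveGroup_apply_add_integral (hi t ht.1)]
    exact h t ht.1
  · intro h
    refine ⟨waveGroup A, isC0Group_waveGroup, isGenerator_waveGroup, fun t ht => ?_⟩
    rw [← waveGroup_apply_add_integral (hi t ht)]
    exact (h t).congr_ae ((ae_nonlinearity_eq hff z t).mono fun s hs => hs.symm) t ⟨ht, le_rfl⟩

/-- Initial data in `D(A ^ (1 + α)) × D(A ^ α)` come from the phase space. -/
lemma exists_phaseMap_negPow_eq {α : ℝ} (hα : 0 ≤ α) {u v : H} (hu : u ∈ fracDom A (1 + α))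
    (hv : v ∈ fracDom A α) :
    ∃ Y : PhaseSpace A, pos (phaseMap (negPow A α) (commutesWith_negPow hα) Y) = u ∧
      vel (phaseMap (negPow A α) (commutesWith_negPow hα) Y) = v := by
  obtain ⟨y, hy⟩ := hu
  obtain ⟨w, hw⟩ := hv
  obtain ⟨y', hy', -⟩ := exists_negPow_one_mem_graph (A := A) y
  refine ⟨WithLp.toLp 2 (mkGraphDom hy', w), ?_, ?_⟩
  · rw [pos_phaseMap]
    change negPow A α (negPow A 1 y) = u
    rw [← negPow_add hα zero_le_one, add_comm]
    exact hy.symm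
  · rw [vel_phaseMap]
    exact hw.symm

end Main

end ConstrainedWave

end

open ConstrainedWave in
theorem theorem2p2 {H : Type*} [NormedAddCommGroup H] [InnerProductSpace ℝ H] [CompleteSpace H]
    [TopologicalSpace.SeparableSpace H]
    (A₀ : H →ₗ.[ℝ] H) (hA₀ : IsSelfAdjoint A₀)
    (hA₀_nonneg : ∀ x : A₀.domain, 0 ≤ inner ℝ (A₀ x) (x : H))
    (γ : ℝ) (hγ : 0 < γ) (α : ℝ) (hα : 0 ≤ α)
    (f : ℝ → H) (hf : L2LocInFracDom A₀ α f)
    (u₀ v₀ : H) (hu₀ : u₀ ∈ fracDom A₀ (1 + α)) (hv₀ : v₀ ∈ fracDom A₀ α)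
    (hu₀_norm : ‖u₀‖ = 1) (huv : inner ℝ u₀ v₀ = 0) :
    ∃ z : ℝ → PhaseSpace A₀,
      IsSolution A₀ γ f u₀ v₀ z ∧
      (∀ w : ℝ → PhaseSpace A₀, IsSolution A₀ γ f u₀ v₀ w → EqOn w z (Ici 0)) ∧
      ContInFracDom A₀ (1 + α) (fun t => pos (z t)) ∧
      ContInFracDom A₀ α (fun t => vel (z t)) ∧
      C1InFracDom A₀ α (fun t => pos (z t)) := by
  have := Fact.mk hA₀
  obtain ⟨g, hg, hfg⟩ := hf.exists_l2Loc
  have hP : CommutesWith A₀ (negPow A₀ α) := commutesWith_negPow hα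
  have hf₁ : L2Loc fun s => negPow A₀ α (g s) := fun a b => (negPow A₀ α).comp_memLp' (hg a b)
  obtain ⟨Y₀, hpos, hvel⟩ := exists_phaseMap_negPow_eq hα hu₀ hv₀
  obtain ⟨z, hzc, hz0, hz⟩ := exists_constrained_isWaveMild hγ hf₁
    (phaseMap (negPow A₀ α) hP Y₀) (by rw [hpos, hu₀_norm]) (by rw [hpos, hvel, huv])
  have hzi : ∀ b, IntervalIntegrable (fun s => nonlinearity γ (z s) (negPow A₀ α (g s))) volume 0 b :=
    fun b => intervalIntegrable_nonlinearity γ (hf₁.intervalIntegrable 0 b) hzc.continuousOn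
  have hu : ∀ t, 0 ≤ t → pos (z t) = pos (z 0) + ∫ s in (0 : ℝ)..t, vel (z s) := fun t ht =>
    (hz t).pos_eq ht (hzi t) ⟨ht, le_rfl⟩
  have hvc : Continuous fun t => vel (z t) := continuous_vel.comp hzc
  -- `Y` plays the role of `A₁^α z`; the three regularity claims are read off from its continuity in
  -- the phase space and from `pos_eq`.
  obtain ⟨Y, k, hYc, hY, hk, hzY⟩ := exists_phaseMap_eq hP hg hγ.le hzc hz0 hz
  refine ⟨z, ⟨hzc.continuousOn, by rw [hz0, hpos], by rw [hz0, hvel], fun t ht => ?_,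
    contDiffOn_of_eq_integral hvc hu, fun t ht => hasDerivWithinAt_of_eq_integral hvc hu ht,
    (isMildSolution_iff hf₁ hfg hzc.continuousOn).2 hz⟩, fun w hw t ht => ?_, ?_, ?_, ?_⟩
  · exact ((hz t).constraint hγ.le hf₁ hzc.continuousOn (by rw [hz0, hpos, hu₀_norm])
      (by rw [hz0, hpos, hvel, huv]) t ⟨ht, le_rfl⟩).1
  · have hw' := (isMildSolution_iff hf₁ hfg hw.continuousOn).1 hw.mild t
    have h0 : w 0 = z 0 := phase_ext (by rw [hw.pos_zero, hz0, hpos])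
      (by rw [hw.vel_zero, hz0, hvel])
    exact hw'.eqOn_of_nonlinearity hγ.le hf₁ (hw.continuousOn.mono Icc_subset_Ici_self)
      hzc.continuousOn h0 (hz t) ⟨ht, le_rfl⟩
  · obtain ⟨V, hV⟩ := exists_negPowOne_inverse (A := A₀)
    -- As `u = A₁^(-α) (pos Y)` and `pos Y = A₁⁻¹ V (pos Y)`, the function `A₁^(1+α) u` is `V`
    -- applied to the `D(A)` component of `Y`.
    refine ⟨fun t => V (fstL A₀ (Y t)), fun t ht => ?_,
      (V.continuous.comp ((fstL A₀).continuous.comp hYc)).continuousOn⟩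
    change pos (z t) = _
    rw [add_comm, negPow_add hα zero_le_one, hV, hzY t ht, pos_phaseMap]
    rfl
  · refine ⟨fun t => vel (Y t), fun t ht => ?_, (continuous_vel.comp hYc).continuousOn⟩
    change vel (z t) = negPow A₀ α (vel (Y t))
    rw [hzY t ht, vel_phaseMap]
  · refine ⟨fun t => pos (Y t), fun t ht => ?_, contDiffOn_of_eq_integral
      (continuous_vel.comp hYc) fun t ht => (hY t).pos_eq ht (hk t) ⟨ht, le_rfl⟩⟩
    change pos (z t) = negPow A₀ α (pos (Y t))
    rw [hzY t ht, pos_phaseMap]
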